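/- Let $d\ge 1$, $I=[-1,1]$, and let $\mu=\mu_1\otimes\cdots\otimes\mu_d$, where each $\mu_j$ is a finite positive Borel measure supported in $I$ which is Nevai-class: $\int P^2\,d\mu_j>0$ for every nonzero polynomial $P$, and the coefficients of the three-term recurrence $$x\,\varphi_k(x)=a_k\varphi_{k+1}(x)+b_k\varphi_k(x)+a_{k-1}\varphi_{k-1}(x)\qquad (k\ge 0,\ a_{-1}=0)$$ of its orthonormal polynomials $(\varphi_k)$ (with positive leading coefficients) satisfy $a_k\to\frac12$ and $b_k\to 0$ as $k\to\infty$. Order $\mathbb N^d$ ($\mathbb N=\{0,1,2,\dots\}$) by the graded lexicographic order: $\alpha<\beta$ if $\max_j\alpha_j<\max_j\beta_j$, or if $\max_j\alpha_j=\max_j\beta_j$ and $\alpha$ precedes $\beta$ lexicographically. Let $\mathfrak b:\mathbb N\to\mathbb N^d$ be the increasing bijection, and let $(\phi_k)_{k\ge0}$ be the orthonormal polynomials obtained by applying the Gram–Schmidt algorithm in $L^2(\mu)$ to the monomials $x^{\mathfrak b(0)},x^{\mathfrak b(1)},\dots$. For each $N$ let $\mathbf x_1,\dots,\mathbf x_N$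 be the multivariate orthogonal polynomial ensemble of $\mu$, i.e. random points with joint law $$\frac1{N!}\det\big[K_N(x_i,x_\ell)\big]_{i,\ell=1}^N\prod_{i=1}^N\mu(dx_i),\qquad K_N(x,y)=\sum_{k=0}^{N-1}\phi_k(x)\phi_k(y).$$ Then for every $f\in\mathscr C^1(I^d,\mathbb R)$, $$\lim_{N\to\infty}\frac1{N^{1-1/d}}\,\mathbb{V}\mathrm{ar}\Big[\sum_{i=1}^N f(\mathbf x_i)\Big]=\sigma_f^2,\qquad \sigma_f^2=\frac12\sum_{k_1,\dots,k_d=0}^\infty (k_1+\cdots+k_d)\,\hat f(k_1,\dots,k_d)^2<\infty,$$ where $$\hat f(k_1,\dots,k_d)=\int_{I^d} f(x_1,\dots,x_d)\prod_{j=1}^d T_{k_j}(x_j)\frac{dx_j}{\pi\sqrt{1-x_j^2}}$$ and $T_0=1$, $T_k(\cos\theta)=\sqrt2\cos(k\theta)$ for $k\ge1$, are the normalized Chebyshev polynomials. -/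

import Mathlib

open MeasureTheory ProbabilityTheory Filter Topology

noncomputable section

/-! ### Orthonormal polynomials -/

/-- Gram-Schmidt algorithm in `L²(μ)`, applied to a sequence of functions `u 0, u 1, …`:
subtract from `u n` its components along the previous orthonormal functions and normalize. -/
def orthonormalize {α : Type*} [MeasurableSpace α] (μ : Measure α) (u : ℕ → α → ℝ) (n : ℕ) :
    α → ℝ :=
  let p : α → ℝ := fun x =>
    u n x - ∑ k : Fin n, (∫ y, u n y * orthonormalize μ u k y ∂μ) * orthonormalize μ u k x
  fun x => p x / √(∫ y, p y ^ 2 ∂μ)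
termination_by n
decreasing_by all_goals exact k.2

/-- The `k`-th orthonormal polynomial (positive leading coefficient) of a measure on `ℝ`. -/
def orthoPoly (ν : Measure ℝ) (k : ℕ) : ℝ → ℝ :=
  orthonormalize ν (fun n x => x ^ n) k

/-- Recurrence coefficient `a k` in `x φ_k = a_k φ_{k+1} + b_k φ_k + a_{k-1} φ_{k-1}`, i.e. the
coordinate of `x φ_k` along `φ_{k+1}`. -/
def recCoeffA (ν : Measure ℝ) (k : ℕ) : ℝ :=
  ∫ x, x * orthoPoly ν k x * orthoPoly ν (k + 1) x ∂ν

/-- Recurrence coefficient `b k` in `x φ_k = a_k φ_{k+1} + b_k φ_k + a_{k-1} φ_{k-1}`, i.e. the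
coordinate of `x φ_k` along `φ_k`. -/
def recCoeffB (ν : Measure ℝ) (k : ℕ) : ℝ :=
  ∫ x, x * orthoPoly ν k x * orthoPoly ν k x ∂ν

/-- Nevai-class measures on `I = [-1, 1]`. -/
structure IsNevaiClass (ν : Measure ℝ) : Prop where
  /-- `ν` is supported in `[-1, 1]`. -/
  support : ν (Set.Icc (-1) 1)ᶜ = 0
  /-- The orthonormal polynomials of `ν` are well defined. -/
  nondegenerate : ∀ p : Polynomial ℝ, p ≠ 0 → 0 < ∫ x, p.eval x ^ 2 ∂ν
  tendsto_a : Tendsto (recCoeffA ν) atTop (𝓝 (1 / 2))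
  tendsto_b : Tendsto (recCoeffB ν) atTop (𝓝 0)

/-! ### The graded lexicographic order on `ℕ^d` -/

/-- Strict lexicographic order, graded by the sup norm. -/
def GradedLexLT {d : ℕ} (α β : Fin d → ℕ) : Prop :=
  Finset.univ.sup α < Finset.univ.sup β ∨
    (Finset.univ.sup α = Finset.univ.sup β ∧ ∃ j, (∀ i, i < j → α i = β i) ∧ α j < β j)

theorem gradedLexLT_wf (d : ℕ) : WellFounded (GradedLexLT (d := d)) := by
  have h : WellFounded (fun α β : ℕ ×ₗ Lex (Fin d → ℕ) => α < β) := wellFounded_lt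
  refine Subrelation.wf ?_ (InvImage.wf
    (fun α : Fin d → ℕ => toLex (Finset.univ.sup α, toLex α)) h)
  intro α β hab
  rcases hab with hab | ⟨h1, h2⟩
  · exact Prod.Lex.toLex_lt_toLex.2 (Or.inl hab)
  · exact Prod.Lex.toLex_lt_toLex.2 (Or.inr ⟨h1, h2⟩)

open Classical in
/-- The increasing enumeration of `ℕ^d` for the graded lexicographic order: the `n`-th multi-index
is the smallest one not among the first `n`. (For `d ≥ 1` the set is never empty, and the `else`
branch is not used.) -/
def gradedLexEnum (d : ℕ) (n : ℕ) : Fin d → ℕ :=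
  if h : {α : Fin d → ℕ | ∀ m : Fin n, gradedLexEnum d m ≠ α}.Nonempty then
    (gradedLexLT_wf d).min {α : Fin d → ℕ | ∀ m : Fin n, gradedLexEnum d m ≠ α} h
  else 0
termination_by n
decreasing_by all_goals exact m.2

/-! ### Multivariate orthogonal polynomial ensembles -/

/-- The multivariate orthonormal polynomials of `μ`: Gram-Schmidt applied to the monomials in
graded lexicographic order. -/
def multiOrthoPoly {d : ℕ} (μ : Measure (Fin d → ℝ)) (n : ℕ) : (Fin d → ℝ) → ℝ :=
  orthonormalize μ (fun k x => ∏ j, x j ^ gradedLexEnum d k j) n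

/-- The kernel `K_N(x, y) = ∑_{k < N} φ_k(x) φ_k(y)`. -/
def cdKernel {d : ℕ} (μ : Measure (Fin d → ℝ)) (N : ℕ) (x y : Fin d → ℝ) : ℝ :=
  ∑ k ∈ Finset.range N, multiOrthoPoly μ k x * multiOrthoPoly μ k y

/-- The joint law of the points `x_1, …, x_N` of the multivariate OP ensemble of `μ`:
`(1 / N!) det [K_N(x_i, x_l)] ∏ μ(dx_i)`. -/
def opEnsemble {d : ℕ} (μ : Measure (Fin d → ℝ)) (N : ℕ) : Measure (Fin N → Fin d → ℝ) :=
  (Measure.pi fun _ : Fin N => μ).withDensity fun x =>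
    ENNReal.ofReal (1 / (N.factorial : ℝ) *
      (Matrix.of fun i l : Fin N => cdKernel μ N (x i) (x l)).det)

/-! ### The limiting variance -/

/-- Normalized Chebyshev polynomials of the first kind: `T_0 = 1`, `T_k(cos θ) = √2 cos (k θ)`. -/
def normChebyshev (k : ℕ) (x : ℝ) : ℝ :=
  if k = 0 then 1 else √2 * (Polynomial.Chebyshev.T ℝ (k : ℤ)).eval x

/-- The Chebyshev-Fourier coefficient `f̂(k_1, …, k_d)`. -/
def chebCoeff {d : ℕ} (f : (Fin d → ℝ) → ℝ) (k : Fin d → ℕ) : ℝ :=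
  ∫ x in Set.Icc (-1 : Fin d → ℝ) 1,
    f x * ∏ j, (normChebyshev (k j) (x j) * (1 / (Real.pi * √(1 - x j ^ 2))))

/-- `σ_f² = ½ ∑_k (k_1 + ⋯ + k_d) f̂(k)²`. -/
def limitVariance {d : ℕ} (f : (Fin d → ℝ) → ℝ) : ℝ :=
  1 / 2 * ∑' k : Fin d → ℕ, (∑ j, (k j : ℝ)) * chebCoeff f k ^ 2

end

/-!
The joint law of the points is `det[φ_k(x_i)]² / N!`, so Andréief's identity gives
`𝔼 ∏ (1 + t g(x_i)) = det (1 + t A)` with `A_{kl} = ∫ g φ_k φ_l dμ`, `k, l < N`. Comparing the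
coefficients of `t` and `t²` (`moments_opEnsemble`) yields `variance_opEnsemble`:
`Var ∑ g(x_i) = ∑_{k < N} (∫ g² φ_k² dμ - ∑_{l < N} A_{kl}²)`, the functional `ensembleVar`.
By Parseval this is `∑_{k < N ≤ l} ⟨g φ_k, φ_l⟩²` when `g` is a polynomial, and it is always
`½ ∬ (g(x) - g(y))² K_N(x, y)² μ(dx) μ(dy)` (`integral_sq_sub_mul_cdKernel`).

*Polynomials.* The graded lexicographic order extends the coordinatewise order, so the multivariate
orthonormal polynomials of a product measure are the products `φ_α` of the one-variable ones
(`orthonormalize_eq_of_triangular`, `multiOrthoPoly_pi`). For a polynomial `g`, with Chebyshev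
coefficients `c_m`, the matrix `⟨g φ_α, φ_β⟩` is banded, and since the recurrence coefficients tend
to those of the free Jacobi matrix `(S + S⁻¹) / 2`, for which `T_m` is `(S^m + S^(-m)) / 2`, its
entries at `(α, α + δ)` converge, as all coordinates of `α` tend to infinity, to `c_{|δ|}` times
`2^(-1/2)` to the power of the number of nonzero `δ_j` (`IsNevaiClass.tendsto_chebEntry`,
`freeMulEntry_eq`). It remains to count, for each `δ`, the `α` among the first `N` multi-indices for
which `α + δ` is not one of them: divided by `N^(1-1/d)`, their number tends to `∑ δ_j⁺`
(`tendsto_card_exitSet`). When `N = M^d` the first `N` multi-indices form a cube and the count is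
explicit. When `N` grows from `M^d` to `(M + 1)^d`, each new multi-index `γ` changes the count by
`1_{γ + δ > γ} - 1_{γ - δ < γ}`, which vanishes unless `γ` is near a corner of the cube or near a
coordinate hyperplane, because translations by `δ` and `-δ` go to opposite sides in the order; the
exceptional `γ` are `O(M^(d-2))` many. Symmetrizing in `δ ↦ -δ` gives the limit
`½ ∑ (m_1 + ⋯ + m_d) c_m²` (`tendsto_ensembleVar_chebSum`).

*Continuously differentiable functions.* By the double integral formula, the variance for a function
with Lipschitz constant `L` is at most `d L²` times the sum of the variances for the coordinates
(`ensembleVar_le_of_lipschitz`), hence `O(L² N^(1-1/d))` by the polynomial case. Bernstein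
polynomials approximate `f` in the Lipschitz seminorm (`exists_chebSum_approx`), and both the
variance and the partial sums of `σ_f²` are nonnegative quadratic forms, controlled uniformly by the
square of this seminorm (`exists_ensembleVar_le`, `partialVar_sub_le`). This gives the summability
and the convergence (`tendsto_ensembleVar`).
-/

/-! ### Integrability -/

theorem Continuous.integrable_of_compl_null {E : Type*} [TopologicalSpace E] [T2Space E]
    [MeasurableSpace E]
    [OpensMeasurableSpace E] {μ : Measure E} [IsFiniteMeasure μ] {K : Set E}
    (hK : IsCompact K) (h0 : μ Kᶜ = 0) {g : E → ℝ} (hg : Continuous g) : Integrable g μ := by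
  have h1 : μ.restrict K = μ := Measure.restrict_eq_self_of_ae_mem (by
    rw [ae_iff]; exact h0)
  rw [← h1]
  exact hg.continuousOn.integrableOn_compact hK

/-! ### The Gram-Schmidt algorithm -/

theorem orthonormalize_apply {α : Type*} [MeasurableSpace α] (μ : Measure α) (u : ℕ → α → ℝ)
    (n : ℕ) (x : α) :
    orthonormalize μ u n x =
      (u n x - ∑ k : Fin n, (∫ y, u n y * orthonormalize μ u k y ∂μ) * orthonormalize μ u k x) /
        √(∫ y, (u n y - ∑ k : Fin n, (∫ y, u n y * orthonormalize μ u k y ∂μ) *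
          orthonormalize μ u k y) ^ 2 ∂μ) := by
  rw [orthonormalize]

/-- Uniqueness of the Gram-Schmidt family: an orthonormal family to which `u` is related by a
triangular change of basis with positive diagonal is the output of the algorithm. -/
theorem orthonormalize_eq_of_triangular {α : Type*} [MeasurableSpace α] {μ : Measure α}
    {u ψ : ℕ → α → ℝ} (t : ℕ → ℕ → ℝ)
    (hint : ∀ m n, Integrable (fun x => ψ m x * ψ n x) μ)
    (horth : ∀ m n, ∫ x, ψ m x * ψ n x ∂μ = if m = n then 1 else 0)
    (hu : ∀ n x, u n x = ∑ k ∈ Finset.range (n + 1), t n k * ψ k x)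
    (ht : ∀ n, 0 < t n n) (n : ℕ) : orthonormalize μ u n = ψ n := by
  have hcoef : ∀ n k, k ≤ n → ∫ y, u n y * ψ k y ∂μ = t n k := by
    intro n k hk
    have : ∀ y, u n y * ψ k y = ∑ l ∈ Finset.range (n + 1), t n l * (ψ l y * ψ k y) := by
      intro y
      rw [hu, Finset.sum_mul]
      exact Finset.sum_congr rfl fun l _ => mul_assoc _ _ _
    simp_rw [this]
    rw [integral_finsetSum _ fun l _ => (hint l k).const_mul _]
    simp_rw [integral_const_mul, horth]
    simp [Nat.lt_succ_iff.2 hk]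
  induction n using Nat.strong_induction_on with
  | _ n ih =>
    have key : ∀ y, u n y - ∑ k : Fin n, (∫ y, u n y * orthonormalize μ u k y ∂μ) *
        orthonormalize μ u k y = t n n * ψ n y := by
      intro y
      have : ∑ k : Fin n, (∫ y, u n y * orthonormalize μ u k y ∂μ) * orthonormalize μ u k y =
          ∑ k ∈ Finset.range n, t n k * ψ k y := by
        rw [Finset.sum_range]
        refine Finset.sum_congr rfl fun k _ => ?_
        rw [ih k k.2, hcoef n k k.2.le]
      rw [this, hu, Finset.sum_range_succ]
      ring
    funext x
    rw [orthonormalize_apply]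
    simp_rw [key]
    have h2 : ∫ y, (t n n * ψ n y) ^ 2 ∂μ = t n n ^ 2 := by
      simp_rw [mul_pow, sq (ψ n _)]
      rw [integral_const_mul, horth]
      simp
    rw [h2, Real.sqrt_sq (ht n).le]
    field_simp [(ht n).ne']

/-! ### Orthonormal polynomials in one variable -/

section OrthonormalPolynomials

open Polynomial in
/-- The orthonormal polynomial `orthoPoly ν n` as an element of `ℝ[X]`. -/
noncomputable def orthoPolynomial (ν : Measure ℝ) (n : ℕ) : Polynomial ℝ :=
  let p : Polynomial ℝ :=
    X ^ n - ∑ k : Fin n, C (∫ y, y ^ n * (orthoPolynomial ν k).eval y ∂ν) * orthoPolynomial ν k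
  C (√(∫ y, p.eval y ^ 2 ∂ν))⁻¹ * p
termination_by n
decreasing_by all_goals exact k.2

open Polynomial in
/-- The monic orthogonal polynomial of degree `n`. -/
noncomputable def monicOrthoPolynomial (ν : Measure ℝ) (n : ℕ) : Polynomial ℝ :=
  X ^ n - ∑ k : Fin n, C (∫ y, y ^ n * (orthoPolynomial ν k).eval y ∂ν) * orthoPolynomial ν k

open Polynomial in
theorem orthoPolynomial_eq (ν : Measure ℝ) (n : ℕ) :
    orthoPolynomial ν n =
      C (√(∫ y, (monicOrthoPolynomial ν n).eval y ^ 2 ∂ν))⁻¹ * monicOrthoPolynomial ν n := by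
  rw [orthoPolynomial, monicOrthoPolynomial]

theorem orthoPoly_eq_eval (ν : Measure ℝ) (n : ℕ) :
    orthoPoly ν n = fun x => (orthoPolynomial ν n).eval x := by
  induction n using Nat.strong_induction_on with
  | _ n ih =>
    have ih' : ∀ k : Fin n, orthonormalize ν (fun n x => x ^ n) k =
      fun x => (orthoPolynomial ν k).eval x := fun k => ih k k.2
    funext x
    rw [orthoPoly, orthonormalize_apply, orthoPolynomial_eq]
    simp_rw [ih']
    simp [monicOrthoPolynomial, Polynomial.eval_finsetSum, div_eq_inv_mul]

variable {ν : Measure ℝ}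

theorem IsNevaiClass.integrable [IsFiniteMeasure ν] (hν : IsNevaiClass ν) {g : ℝ → ℝ}
    (hg : Continuous g) : Integrable g ν :=
  hg.integrable_of_compl_null isCompact_Icc hν.support

open Polynomial in
theorem IsNevaiClass.degree_orthoPolynomial (hν : IsNevaiClass ν) (n : ℕ) :
    (monicOrthoPolynomial ν n).Monic ∧ (orthoPolynomial ν n).degree = n := by
  induction n using Nat.strong_induction_on with
  | _ n ih =>
    have hlt : (∑ k : Fin n, C (∫ y, y ^ n * (orthoPolynomial ν k).eval y ∂ν) *
        orthoPolynomial ν k).degree < n := by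
      rw [← Polynomial.mem_degreeLT]
      refine Submodule.sum_mem _ fun k _ => ?_
      rw [← smul_eq_C_mul]
      refine Submodule.smul_mem _ _ ?_
      rw [Polynomial.mem_degreeLT, (ih k k.2).2]
      exact_mod_cast k.2
    have hm : (monicOrthoPolynomial ν n).Monic := monic_X_pow_sub hlt
    refine ⟨hm, ?_⟩
    have hpos := hν.nondegenerate _ hm.ne_zero
    rw [orthoPolynomial_eq, degree_C_mul (by positivity), monicOrthoPolynomial,
      degree_sub_eq_left_of_degree_lt (by rwa [degree_X_pow]), degree_X_pow]

theorem IsNevaiClass.norm_pos (hν : IsNevaiClass ν) (n : ℕ) :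
    0 < √(∫ y, (monicOrthoPolynomial ν n).eval y ^ 2 ∂ν) :=
  Real.sqrt_pos.2 (hν.nondegenerate _ (hν.degree_orthoPolynomial n).1.ne_zero)

theorem IsNevaiClass.orthonormal [IsFiniteMeasure ν] (hν : IsNevaiClass ν) (m n : ℕ) :
    ∫ x, (orthoPolynomial ν m).eval x * (orthoPolynomial ν n).eval x ∂ν =
      if m = n then 1 else 0 := by
  have hdiag : ∀ n, ∫ x, (orthoPolynomial ν n).eval x * (orthoPolynomial ν n).eval x ∂ν = 1 := by
    intro n
    have hpos := hν.norm_pos n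
    have h1 : ∀ x, (orthoPolynomial ν n).eval x * (orthoPolynomial ν n).eval x =
        (√(∫ y, (monicOrthoPolynomial ν n).eval y ^ 2 ∂ν))⁻¹ ^ 2 *
          (monicOrthoPolynomial ν n).eval x ^ 2 := by
      intro x
      rw [orthoPolynomial_eq]
      simp only [Polynomial.eval_mul, Polynomial.eval_C]
      ring
    simp_rw [h1]
    rw [integral_const_mul, inv_pow, Real.sq_sqrt (Real.sqrt_pos.1 hpos).le]
    exact inv_mul_cancel₀ (Real.sqrt_pos.1 hpos).ne'
  have hoff : ∀ n, ∀ k < n,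
      ∫ x, (orthoPolynomial ν n).eval x * (orthoPolynomial ν k).eval x ∂ν = 0 := by
    intro n
    induction n using Nat.strong_induction_on with
    | _ n ih =>
      intro k hk
      have hcross : ∀ l : Fin n, ∫ x, (orthoPolynomial ν l).eval x *
          (orthoPolynomial ν k).eval x ∂ν = if l = ⟨k, hk⟩ then 1 else 0 := by
        intro l
        rcases lt_trichotomy (l : ℕ) k with h | h | h
        · rw [if_neg (by intro hh; simp [hh] at h), ← ih k hk l h]
          simp_rw [mul_comm]
        · have : l = ⟨k, hk⟩ := Fin.ext h
          subst this
          simp [hdiag]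
        · rw [if_neg (by intro hh; simp [hh] at h), ih l l.2 k h]
      have h1 : ∀ x, (orthoPolynomial ν n).eval x * (orthoPolynomial ν k).eval x =
          (√(∫ y, (monicOrthoPolynomial ν n).eval y ^ 2 ∂ν))⁻¹ *
          (x ^ n * (orthoPolynomial ν k).eval x -
            ∑ l : Fin n, (∫ y, y ^ n * (orthoPolynomial ν l).eval y ∂ν) *
              ((orthoPolynomial ν l).eval x * (orthoPolynomial ν k).eval x)) := by
        intro x
        rw [orthoPolynomial_eq ν n]
        simp only [Polynomial.eval_mul, Polynomial.eval_C, monicOrthoPolynomial,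
          Polynomial.eval_sub, Polynomial.eval_finsetSum, Polynomial.eval_pow, Polynomial.eval_X]
        rw [mul_assoc, sub_mul, Finset.sum_mul]
        simp_rw [mul_assoc]
      simp_rw [h1]
      rw [integral_const_mul, integral_sub (hν.integrable (by fun_prop))
        (hν.integrable (by fun_prop)), integral_finsetSum _ fun l _ =>
        hν.integrable (by fun_prop)]
      simp_rw [integral_const_mul, hcross]
      simp
  rcases lt_trichotomy m n with h | h | h
  · rw [if_neg h.ne, ← hoff n m h]
    simp_rw [mul_comm]
  · subst h
    simp [hdiag]
  · rw [if_neg h.ne', hoff m n h]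

open Polynomial in
/-- A sequence with one polynomial of each degree spans the polynomials. -/
theorem Polynomial.exists_eq_sum_of_degree {P : ℕ → Polynomial ℝ} (hP : ∀ n, (P n).degree = n)
    (n : ℕ) (p : Polynomial ℝ) (hp : p.degree < n) :
    ∃ c : ℕ → ℝ, p = ∑ k ∈ Finset.range n, C (c k) * P k := by
  induction n generalizing p with
  | zero => exact ⟨0, by simpa using hp⟩
  | succ n ih =>
    have hd := hP n
    have hlc : (P n).coeff n ≠ 0 := coeff_ne_zero_of_eq_degree hd
    obtain ⟨c, hc⟩ := ih (p - C (p.coeff n / (P n).coeff n) * P n) (by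
      rw [degree_lt_iff_coeff_zero] at hp ⊢
      intro m hm
      rcases hm.eq_or_lt with rfl | hm
      · simp [hlc]
      · have h1 := hp m hm
        have h2 : (P n).coeff m = 0 := coeff_eq_zero_of_degree_lt (by
          rw [hd]; exact_mod_cast hm)
        simp [h1, h2])
    refine ⟨fun k => if k = n then p.coeff n / (P n).coeff n else c k, ?_⟩
    simp only [Finset.sum_range_succ, if_true]
    rw [Finset.sum_congr rfl (g := fun k => C (c k) * P k) (by
      intro k hk
      rw [if_neg (Finset.mem_range.1 hk).ne]), ← hc]
    ring

open Polynomial in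
/-- Expansion of a polynomial in the orthonormal polynomials. -/
theorem IsNevaiClass.eval_eq_sum [IsFiniteMeasure ν] (hν : IsNevaiClass ν) (n : ℕ)
    (p : Polynomial ℝ) (hp : p.degree < n) (x : ℝ) :
    p.eval x = ∑ k ∈ Finset.range n, (∫ y, p.eval y * (orthoPolynomial ν k).eval y ∂ν) *
      (orthoPolynomial ν k).eval x := by
  obtain ⟨c, hc⟩ := Polynomial.exists_eq_sum_of_degree
    (fun n => (hν.degree_orthoPolynomial n).2) n p hp
  have hev : ∀ y, p.eval y = ∑ k ∈ Finset.range n, c k * (orthoPolynomial ν k).eval y := by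
    intro y
    conv_lhs => rw [hc]
    simp [eval_finsetSum]
  rw [hev]
  refine Finset.sum_congr rfl fun k hk => ?_
  congr 1
  simp_rw [hev, Finset.sum_mul, mul_assoc]
  rw [integral_finsetSum _ fun l _ => hν.integrable (by fun_prop)]
  simp_rw [integral_const_mul, hν.orthonormal]
  rw [Finset.sum_eq_single k]
  · simp
  · intro b _ hb
    simp [hb]
  · intro h
    exact absurd hk h

/-- Orthogonality of `φ_n` to lower degrees. -/
theorem IsNevaiClass.integral_mul_eq_zero [IsFiniteMeasure ν] (hν : IsNevaiClass ν) {n : ℕ}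
    {p : Polynomial ℝ} (hp : p.degree < n) :
    ∫ y, p.eval y * (orthoPolynomial ν n).eval y ∂ν = 0 := by
  obtain ⟨c, hc⟩ : ∃ c : ℕ → ℝ, ∀ y, p.eval y =
      ∑ k ∈ Finset.range n, c k * (orthoPolynomial ν k).eval y := ⟨_, hν.eval_eq_sum n p hp⟩
  simp_rw [hc, Finset.sum_mul, mul_assoc]
  rw [integral_finsetSum _ fun l _ => hν.integrable (by fun_prop)]
  simp_rw [integral_const_mul, hν.orthonormal]
  refine Finset.sum_eq_zero fun k hk => ?_
  simp [(Finset.mem_range.1 hk).ne]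

theorem IsNevaiClass.pow_coeff_pos [IsFiniteMeasure ν] (hν : IsNevaiClass ν) (n : ℕ) :
    0 < ∫ y, y ^ n * (orthoPolynomial ν n).eval y ∂ν := by
  have hpos := hν.norm_pos n
  have h1 : ∀ y, y ^ n * (orthoPolynomial ν n).eval y =
      √(∫ y, (monicOrthoPolynomial ν n).eval y ^ 2 ∂ν) *
        ((orthoPolynomial ν n).eval y * (orthoPolynomial ν n).eval y) +
      ∑ k : Fin n, (∫ y, y ^ n * (orthoPolynomial ν k).eval y ∂ν) *
        ((orthoPolynomial ν k).eval y * (orthoPolynomial ν n).eval y) := by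
    intro y
    have h2 : y ^ n = √(∫ y, (monicOrthoPolynomial ν n).eval y ^ 2 ∂ν) *
        (orthoPolynomial ν n).eval y + ∑ k : Fin n,
        (∫ y, y ^ n * (orthoPolynomial ν k).eval y ∂ν) * (orthoPolynomial ν k).eval y := by
      rw [orthoPolynomial_eq ν n, Polynomial.eval_mul, Polynomial.eval_C,
        mul_inv_cancel_left₀ hpos.ne']
      simp [monicOrthoPolynomial, Polynomial.eval_finsetSum]
    conv_lhs => rw [h2]
    rw [add_mul, Finset.sum_mul]
    simp_rw [mul_assoc]
  simp_rw [h1]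
  rw [integral_add (hν.integrable (by fun_prop)) (hν.integrable (by fun_prop)),
    integral_finsetSum _ fun l _ => hν.integrable (by fun_prop)]
  simp_rw [integral_const_mul, hν.orthonormal]
  rw [Finset.sum_eq_zero fun k _ => by simp [k.2.ne]]
  simpa using hpos

open Polynomial in
/-- The three-term recurrence. -/
theorem IsNevaiClass.recurrence [IsFiniteMeasure ν] (hν : IsNevaiClass ν) (n : ℕ) (x : ℝ) :
    x * (orthoPolynomial ν (n + 1)).eval x =
      recCoeffA ν (n + 1) * (orthoPolynomial ν (n + 2)).eval x +
      recCoeffB ν (n + 1) * (orthoPolynomial ν (n + 1)).eval x +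
      recCoeffA ν n * (orthoPolynomial ν n).eval x := by
  have hdeg : (X * orthoPolynomial ν (n + 1)).degree < ((n + 3 : ℕ) : WithBot ℕ) := by
    rw [degree_mul, degree_X, (hν.degree_orthoPolynomial (n + 1)).2]
    norm_cast
    omega
  have h := hν.eval_eq_sum (n + 3) _ hdeg x
  simp only [eval_mul, eval_X] at h
  rw [h, Finset.sum_range_succ, Finset.sum_range_succ, Finset.sum_range_succ,
    Finset.sum_eq_zero]
  · simp_rw [recCoeffA, recCoeffB, orthoPoly_eq_eval]
    have : ∀ y, y * (orthoPolynomial ν (n + 1)).eval y * (orthoPolynomial ν n).eval y =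
      y * (orthoPolynomial ν n).eval y * (orthoPolynomial ν (n + 1)).eval y := fun y => by ring
    simp_rw [this]
    ring
  · intro k hk
    rw [Finset.mem_range] at hk
    have h0 : ∫ y, (X * orthoPolynomial ν k).eval y * (orthoPolynomial ν (n + 1)).eval y ∂ν = 0 :=
      hν.integral_mul_eq_zero (by
        rw [degree_mul, degree_X, (hν.degree_orthoPolynomial k).2]
        norm_cast
        omega)
    simp only [eval_mul, eval_X] at h0
    have : ∀ y, y * (orthoPolynomial ν (n + 1)).eval y * (orthoPolynomial ν k).eval y =
      y * (orthoPolynomial ν k).eval y * (orthoPolynomial ν (n + 1)).eval y := fun y => by ring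
    simp_rw [this, h0, zero_mul]

end OrthonormalPolynomials

/-! ### The graded lexicographic enumeration -/

section Enumeration

variable {d : ℕ}

theorem GradedLexLT.irrefl (α : Fin d → ℕ) : ¬ GradedLexLT α α := by
  rintro (h | ⟨-, j, -, h⟩) <;> exact lt_irrefl _ h

theorem GradedLexLT.trichotomy {α β : Fin d → ℕ} (h : α ≠ β) :
    GradedLexLT α β ∨ GradedLexLT β α := by
  rcases lt_trichotomy (Finset.univ.sup α) (Finset.univ.sup β) with h1 | h1 | h1
  · exact Or.inl (Or.inl h1)
  · have h2 : toLex α ≠ toLex β := fun h3 => h (toLex.injective h3)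
    rcases lt_or_gt_of_ne h2 with ⟨j, h3, h4⟩ | ⟨j, h3, h4⟩
    · exact Or.inl (Or.inr ⟨h1, j, h3, h4⟩)
    · exact Or.inr (Or.inr ⟨h1.symm, j, h3, h4⟩)
  · exact Or.inr (Or.inl h1)

theorem GradedLexLT.asymm {α β : Fin d → ℕ} (h : GradedLexLT α β) : ¬ GradedLexLT β α :=
  (gradedLexLT_wf d).asymmetric _ _ h

theorem gradedLexEnum_spec (hd : 0 < d) (n : ℕ) :
    (∀ m < n, gradedLexEnum d m ≠ gradedLexEnum d n) ∧
      ∀ α, (∀ m < n, gradedLexEnum d m ≠ α) → ¬ GradedLexLT α (gradedLexEnum d n) := by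
  have : Nonempty (Fin d) := ⟨⟨0, hd⟩⟩
  have hne : {α : Fin d → ℕ | ∀ m : Fin n, gradedLexEnum d m ≠ α}.Nonempty := by
    have hfin : (Set.range fun m : Fin n => gradedLexEnum d m).Finite := Set.finite_range _
    obtain ⟨α, hα⟩ := hfin.exists_notMem
    exact ⟨α, fun m hm => hα ⟨m, hm⟩⟩
  have heq : gradedLexEnum d n = (gradedLexLT_wf d).min _ hne := by
    rw [gradedLexEnum, dif_pos hne]
  constructor
  · intro m hm
    have := (gradedLexLT_wf d).min_mem _ hne
    rw [heq]
    exact this ⟨m, hm⟩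
  · intro α hα
    rw [heq]
    exact (gradedLexLT_wf d).not_lt_min (s := {α : Fin d → ℕ | ∀ m : Fin n, gradedLexEnum d m ≠ α})
      (fun m : Fin n => hα m m.2)

theorem gradedLexEnum_lt (hd : 0 < d) {m n : ℕ} (h : m < n) :
    GradedLexLT (gradedLexEnum d m) (gradedLexEnum d n) := by
  have h1 := (gradedLexEnum_spec hd n).1 m h
  refine (GradedLexLT.trichotomy h1).resolve_right ?_
  exact (gradedLexEnum_spec hd m).2 _ fun k hk =>
    (gradedLexEnum_spec hd n).1 k (hk.trans h)

theorem gradedLexEnum_injective (hd : 0 < d) : Function.Injective (gradedLexEnum d) := by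
  intro m n h
  rcases lt_trichotomy m n with h1 | h1 | h1
  · exact absurd h ((gradedLexEnum_spec hd n).1 m h1)
  · exact h1
  · exact absurd h.symm ((gradedLexEnum_spec hd m).1 n h1)

theorem gradedLexEnum_surjective (hd : 0 < d) : Function.Surjective (gradedLexEnum d) := by
  intro α
  by_contra hα
  push Not at hα
  have h1 : ∀ n, gradedLexEnum d n ∈ Fintype.piFinset
      fun _ : Fin d => Finset.range (Finset.univ.sup α + 1) := by
    intro n
    have h2 : GradedLexLT (gradedLexEnum d n) α :=
      (GradedLexLT.trichotomy (hα n)).resolve_right ((gradedLexEnum_spec hd n).2 _ fun m _ => hα m)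
    have h3 : Finset.univ.sup (gradedLexEnum d n) ≤ Finset.univ.sup α := by
      rcases h2 with h2 | h2
      · exact h2.le
      · exact h2.1.le
    rw [Fintype.mem_piFinset]
    intro j
    rw [Finset.mem_range, Nat.lt_succ_iff]
    exact (Finset.le_sup (f := gradedLexEnum d n) (Finset.mem_univ j)).trans h3
  exact not_injective_infinite_finite
    (fun n => (⟨gradedLexEnum d n, h1 n⟩ : Fintype.piFinset
      fun _ : Fin d => Finset.range (Finset.univ.sup α + 1)))
    fun m n h => gradedLexEnum_injective hd (congrArg Subtype.val h)

theorem gradedLexEnum_lt_iff (hd : 0 < d) {m n : ℕ} :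
    GradedLexLT (gradedLexEnum d m) (gradedLexEnum d n) ↔ m < n := by
  refine ⟨fun h => ?_, gradedLexEnum_lt hd⟩
  by_contra h1
  rcases (not_lt.1 h1).eq_or_lt with h2 | h2
  · subst h2
    exact GradedLexLT.irrefl _ h
  · exact h.asymm (gradedLexEnum_lt hd h2)

/-- The set of the first `N` multi-indices. -/
noncomputable def firstIndices (d N : ℕ) : Finset (Fin d → ℕ) :=
  (Finset.range N).image (gradedLexEnum d)

theorem mem_firstIndices_iff (hd : 0 < d) {N k : ℕ} :
    gradedLexEnum d k ∈ firstIndices d N ↔ k < N := by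
  simp [firstIndices, (gradedLexEnum_injective hd).eq_iff]

theorem firstIndices_mono {M N : ℕ} (h : M ≤ N) : firstIndices d M ⊆ firstIndices d N :=
  Finset.image_subset_image (Finset.range_subset_range.2 h)

theorem firstIndices_succ (N : ℕ) :
    firstIndices d (N + 1) = insert (gradedLexEnum d N) (firstIndices d N) := by
  rw [firstIndices, Finset.range_add_one, Finset.image_insert, firstIndices]

/-- The cube `{0, …, M - 1}^d` of multi-indices. -/
def indexBox (d M : ℕ) : Finset (Fin d → ℕ) := Fintype.piFinset fun _ => Finset.range M

theorem mem_indexBox {M : ℕ} {α : Fin d → ℕ} : α ∈ indexBox d M ↔ ∀ j, α j < M := by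
  simp [indexBox]

theorem card_indexBox (M : ℕ) : (indexBox d M).card = M ^ d := by
  simp [indexBox, Fintype.card_piFinset]

/-- The cube is an initial segment of the graded lexicographic order. -/
theorem firstIndices_pow (hd : 0 < d) (M : ℕ) : firstIndices d (M ^ d) = indexBox d M := by
  set T := (indexBox d M).preimage (gradedLexEnum d) (gradedLexEnum_injective hd).injOn with hT
  have hbT : T.image (gradedLexEnum d) = indexBox d M := by
    ext α
    constructor
    · intro h
      obtain ⟨k, hk, rfl⟩ := Finset.mem_image.1 h
      simpa [hT] using hk
    · intro h
      obtain ⟨k, rfl⟩ := gradedLexEnum_surjective hd α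
      exact Finset.mem_image_of_mem _ (by simpa [hT] using h)
  have hcard : T.card = M ^ d := by
    rw [← card_indexBox, ← hbT, Finset.card_image_of_injective _ (gradedLexEnum_injective hd)]
  have hlow : ∀ a ∈ T, ∀ b < a, b ∈ T := by
    intro a ha b hb
    simp only [hT, Finset.mem_preimage, mem_indexBox] at ha ⊢
    have hM : 0 < M := (Nat.zero_le _).trans_lt (ha ⟨0, hd⟩)
    have h1 : Finset.univ.sup (gradedLexEnum d a) < M :=
      (Finset.sup_lt_iff hM).2 fun j _ => ha j
    have h2 : Finset.univ.sup (gradedLexEnum d b) ≤ Finset.univ.sup (gradedLexEnum d a) := by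
      rcases gradedLexEnum_lt hd hb with h2 | h2
      · exact h2.le
      · exact h2.1.le
    exact fun j => (Finset.le_sup (f := gradedLexEnum d b) (Finset.mem_univ j)).trans_lt
      (h2.trans_lt h1)
  have hrange : T = Finset.range (M ^ d) := by
    refine Finset.eq_of_subset_of_card_le (fun a ha => ?_) (by simp [hcard])
    have : Finset.range (a + 1) ⊆ T := by
      intro b hb
      rcases (Nat.lt_succ_iff.1 (Finset.mem_range.1 hb)).eq_or_lt with h | h
      · exact h ▸ ha
      · exact hlow a ha b h
    have := Finset.card_le_card this
    rw [Finset.card_range, hcard] at this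
    exact Finset.mem_range.2 this
  rw [firstIndices, ← hrange, hbT]

/-- The graded lexicographic order extends the coordinatewise order. -/
theorem gradedLexEnum_le_of_le (hd : 0 < d) {m n : ℕ}
    (h : ∀ j, gradedLexEnum d m j ≤ gradedLexEnum d n j) : m ≤ n := by
  by_contra hlt
  have hlt := gradedLexEnum_lt hd (not_le.1 hlt)
  rcases hlt with h1 | ⟨-, j, -, h1⟩
  · exact absurd h1 (not_lt.2 (Finset.sup_mono_fun fun j _ => h j))
  · exact absurd h1 (not_lt.2 (h j))

end Enumeration

/-! ### Counting boundary multi-indices -/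

section Counting

variable {d : ℕ}

/-- The translate of a multi-index by an integer vector (meaningful when the coordinates of the
result are nonnegative, see `ShiftNonneg`). -/
def shiftIndex (α : Fin d → ℕ) (δ : Fin d → ℤ) : Fin d → ℕ := fun j => (α j + δ j).toNat

/-- The translate of `α` by `δ` lies in `ℕ^d`. -/
def ShiftNonneg (α : Fin d → ℕ) (δ : Fin d → ℤ) : Prop := ∀ j, 0 ≤ (α j : ℤ) + δ j

theorem ShiftNonneg.coe {α : Fin d → ℕ} {δ : Fin d → ℤ} (h : ShiftNonneg α δ) (j : Fin d) :
    (shiftIndex α δ j : ℤ) = α j + δ j := Int.toNat_of_nonneg (h j)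

open Classical in
/-- The multi-indices `α` among the first `N` which the translation by `δ` moves to a multi-index
not among the first `N`. -/
noncomputable def exitSet (d N : ℕ) (δ : Fin d → ℤ) : Finset (Fin d → ℕ) :=
  (firstIndices d N).filter fun α => ShiftNonneg α δ ∧ shiftIndex α δ ∉ firstIndices d N

theorem sup_eq_of_forall_le {α : Fin d → ℕ} {j : Fin d} (h : ∀ i, α i ≤ α j) :
    Finset.univ.sup α = α j :=
  le_antisymm (Finset.sup_le fun i _ => h i) (Finset.le_sup (f := α) (Finset.mem_univ j))

/-- At a multi-index which is far from the coordinate hyperplanes and whose largest coordinate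
exceeds all other ones by a wide margin, translations by `δ` and `-δ` go to opposite sides in the
graded lexicographic order: the margin `2 D` makes sure that the `j`-th coordinate remains the
largest. -/
theorem gradedLexLT_shift_iff {γ : Fin d → ℕ} {δ : Fin d → ℤ} {D : ℕ} (hδ : ∀ j, |δ j| ≤ D)
    {j : Fin d} (hjD : D ≤ γ j) (hi : ∀ i, i ≠ j → D ≤ γ i ∧ γ i + 2 * D < γ j) :
    ShiftNonneg γ δ ∧ ShiftNonneg γ (-δ) ∧
      (GradedLexLT γ (shiftIndex γ δ) ↔ GradedLexLT (shiftIndex γ (-δ)) γ) := by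
  have hall : ∀ i, D ≤ γ i := fun i => by
    by_cases h : i = j
    · exact h ▸ hjD
    · exact (hi i h).1
  have h1 : ShiftNonneg γ δ := fun i => by
    have := abs_le.1 (hδ i); have := hall i; omega
  have h2 : ShiftNonneg γ (-δ) := fun i => by
    have := abs_le.1 (hδ i); have := hall i; simp only [Pi.neg_apply]; omega
  refine ⟨h1, h2, ?_⟩
  have hc1 := h1.coe
  have hc2 := h2.coe
  simp only [Pi.neg_apply] at hc2
  have hs : Finset.univ.sup γ = γ j := sup_eq_of_forall_le fun i => by
    by_cases h : i = j
    · rw [h]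
    · have := (hi i h).2; omega
  have hs1 : Finset.univ.sup (shiftIndex γ δ) = shiftIndex γ δ j := sup_eq_of_forall_le fun i => by
    by_cases h : i = j
    · rw [h]
    · have := (hi i h).2; have := hc1 i; have := hc1 j
      have := abs_le.1 (hδ i); have := abs_le.1 (hδ j); omega
  have hs2 : Finset.univ.sup (shiftIndex γ (-δ)) = shiftIndex γ (-δ) j :=
    sup_eq_of_forall_le fun i => by
      by_cases h : i = j
      · rw [h]
      · have := (hi i h).2; have := hc2 i; have := hc2 j
        have := abs_le.1 (hδ i); have := abs_le.1 (hδ j); omega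
  rw [GradedLexLT, GradedLexLT, hs, hs1, hs2]
  have e1 : ∀ i, γ i = shiftIndex γ δ i ↔ shiftIndex γ (-δ) i = γ i := fun i => by
    have := hc1 i; have := hc2 i; omega
  have e2 : ∀ i, γ i < shiftIndex γ δ i ↔ shiftIndex γ (-δ) i < γ i := fun i => by
    have := hc1 i; have := hc2 i; omega
  simp_rw [e1, e2]

/-- Multi-indices with maximum `M` at which the maximum is nearly attained twice, or which are
close to a coordinate hyperplane. -/
def cornerSet (d M D : ℕ) : Finset (Fin d → ℕ) :=
  (indexBox d (M + 1)).filter fun γ =>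
    ∃ i j, i ≠ j ∧ γ j = M ∧ (γ i < D ∨ M ≤ γ i + 2 * D)

theorem shiftIndex_neg_eq {α γ : Fin d → ℕ} {δ : Fin d → ℤ} (h : ShiftNonneg α δ)
    (he : shiftIndex α δ = γ) : ShiftNonneg γ (-δ) ∧ shiftIndex γ (-δ) = α := by
  have hc := h.coe
  rw [he] at hc
  constructor
  · intro j
    rw [hc j]
    simp
  · funext j
    simp [shiftIndex, hc j]

open Classical in
/-- Adding the multi-index `γ` of rank `N` to the first `N` ones changes the size of the exit set by
`1` if `γ` itself exits, and by `-1` if `γ - δ`, which exited to `γ`, no longer does. -/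
theorem card_exitSet_succ (hd : 0 < d) (N : ℕ) (δ : Fin d → ℤ) :
    ((exitSet d (N + 1) δ).card : ℤ) - (exitSet d N δ).card =
      (if ShiftNonneg (gradedLexEnum d N) δ ∧
        shiftIndex (gradedLexEnum d N) δ ∉ firstIndices d (N + 1) then 1 else 0) -
      (if ShiftNonneg (gradedLexEnum d N) (-δ) ∧
        shiftIndex (gradedLexEnum d N) (-δ) ∈ firstIndices d N then 1 else 0) := by
  set γ := gradedLexEnum d N with hγ
  have hγN : γ ∉ firstIndices d N := by rw [mem_firstIndices_iff hd]; exact lt_irrefl _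
  have h1 : ((exitSet d (N + 1) δ).card : ℤ) =
      (if ShiftNonneg γ δ ∧ shiftIndex γ δ ∉ firstIndices d (N + 1) then 1 else 0) +
      ∑ α ∈ firstIndices d N,
        if ShiftNonneg α δ ∧ shiftIndex α δ ∉ firstIndices d (N + 1) then (1 : ℤ) else 0 := by
    rw [exitSet, Finset.card_filter]
    push_cast
    have hins : ∀ F : (Fin d → ℕ) → ℤ, ∑ α ∈ firstIndices d (N + 1), F α =
        F γ + ∑ α ∈ firstIndices d N, F α := fun F => by
      rw [firstIndices_succ, Finset.sum_insert hγN]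
    exact hins _
  have h2 : ((exitSet d N δ).card : ℤ) = ∑ α ∈ firstIndices d N,
      if ShiftNonneg α δ ∧ shiftIndex α δ ∉ firstIndices d N then (1 : ℤ) else 0 := by
    rw [exitSet, Finset.card_filter]
    push_cast
    rfl
  have h3 : (∑ α ∈ firstIndices d N,
      if ShiftNonneg α δ ∧ shiftIndex α δ ∉ firstIndices d N then (1 : ℤ) else 0) -
      (∑ α ∈ firstIndices d N,
      if ShiftNonneg α δ ∧ shiftIndex α δ ∉ firstIndices d (N + 1) then (1 : ℤ) else 0) =
      if ShiftNonneg γ (-δ) ∧ shiftIndex γ (-δ) ∈ firstIndices d N then 1 else 0 := by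
    rw [← Finset.sum_sub_distrib]
    have h4 : ∀ α ∈ firstIndices d N,
        ((if ShiftNonneg α δ ∧ shiftIndex α δ ∉ firstIndices d N then (1 : ℤ) else 0) -
        if ShiftNonneg α δ ∧ shiftIndex α δ ∉ firstIndices d (N + 1) then (1 : ℤ) else 0) =
        if α = shiftIndex γ (-δ) then (if ShiftNonneg γ (-δ) then 1 else 0) else 0 := by
      intro α hα
      simp only [firstIndices_succ, Finset.mem_insert, ← hγ]
      by_cases h5 : ShiftNonneg α δ ∧ shiftIndex α δ = γ
      · obtain ⟨h6, h7⟩ := shiftIndex_neg_eq h5.1 h5.2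
        rw [if_pos ⟨h5.1, by rwa [h5.2]⟩, if_neg (by simp [h5.2]), if_pos h7.symm, if_pos h6]
        simp
      · have h6 : ¬ (α = shiftIndex γ (-δ) ∧ ShiftNonneg γ (-δ)) := by
          rintro ⟨h6, h7⟩
          have := shiftIndex_neg_eq h7 h6.symm
          rw [neg_neg] at this
          exact h5 this
        have h7 : (if α = shiftIndex γ (-δ) then
            (if ShiftNonneg γ (-δ) then (1 : ℤ) else 0) else 0) = 0 := by
          split_ifs <;> tauto
        rw [h7]
        by_cases h8 : ShiftNonneg α δ
        · have : shiftIndex α δ ≠ γ := fun h => h5 ⟨h8, h⟩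
          simp [h8, this]
        · simp [h8]
    rw [Finset.sum_congr rfl h4, Finset.sum_ite_eq']
    by_cases h6 : ShiftNonneg γ (-δ) <;> simp [h6]
  rw [h1, h2, ← h3]
  ring

/-- Away from the corners the two contributions of `card_exitSet_succ` cancel. -/
theorem abs_card_exitSet_succ_le (hd : 0 < d) {M N D : ℕ} {δ : Fin d → ℤ}
    (hδ : ∀ j, |δ j| ≤ D) (hDM : D ≤ M) (h1 : M ^ d ≤ N) (h2 : N < (M + 1) ^ d) :
    |((exitSet d (N + 1) δ).card : ℤ) - (exitSet d N δ).card| ≤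
      if gradedLexEnum d N ∈ cornerSet d M D then 1 else 0 := by
  rw [card_exitSet_succ hd]
  by_cases h5 : gradedLexEnum d N ∈ cornerSet d M D
  · rw [if_pos h5]
    split_ifs <;> simp
  · rw [if_neg h5]
    have hbox : gradedLexEnum d N ∈ indexBox d (M + 1) := by
      rwa [← firstIndices_pow hd, mem_firstIndices_iff hd]
    have hnbox : gradedLexEnum d N ∉ indexBox d M := by
      rwa [← firstIndices_pow hd, mem_firstIndices_iff hd, not_lt]
    simp only [mem_indexBox] at hbox hnbox
    push Not at hnbox
    obtain ⟨j, hj⟩ := hnbox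
    have hjM : gradedLexEnum d N j = M := le_antisymm (Nat.lt_succ_iff.1 (hbox j)) hj
    have hgen : ∀ i, i ≠ j → D ≤ gradedLexEnum d N i ∧
        gradedLexEnum d N i + 2 * D < gradedLexEnum d N j := by
      intro i hij
      by_contra hcon
      apply h5
      simp only [cornerSet, Finset.mem_filter, mem_indexBox]
      exact ⟨hbox, i, j, hij, hjM, by omega⟩
    obtain ⟨g1, g2, g3⟩ := gradedLexLT_shift_iff hδ (hjM ▸ hDM) hgen
    obtain ⟨a, ha⟩ := gradedLexEnum_surjective hd (shiftIndex (gradedLexEnum d N) δ)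
    obtain ⟨b, hb⟩ := gradedLexEnum_surjective hd (shiftIndex (gradedLexEnum d N) (-δ))
    rw [← ha, ← hb, gradedLexEnum_lt_iff hd, gradedLexEnum_lt_iff hd] at g3
    simp only [← ha, ← hb, g1, g2, true_and, mem_firstIndices_iff hd, ← g3]
    -- `γ + δ = γ` only for `δ = 0`, when `γ - δ = γ` as well.
    have hne : a ≠ N ∨ b = N := by
      by_cases haN : a = N
      · right
        rw [haN] at ha
        have : δ = 0 := funext fun i => by
          have h7 := g1.coe i
          rw [← ha] at h7
          simpa using h7
        apply gradedLexEnum_injective hd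
        rw [hb, this]
        funext i
        simp [shiftIndex]
      · exact Or.inl haN
    split_ifs <;> simp <;> omega

theorem abs_card_exitSet_sub_le (hd : 0 < d) {M N D : ℕ} {δ : Fin d → ℤ}
    (hδ : ∀ j, |δ j| ≤ D) (hDM : D ≤ M) (h1 : M ^ d ≤ N) (h2 : N ≤ (M + 1) ^ d) :
    |((exitSet d N δ).card : ℤ) - (exitSet d (M ^ d) δ).card| ≤ (cornerSet d M D).card := by
  classical
  have key : ∀ N, M ^ d ≤ N → N ≤ (M + 1) ^ d →
      |((exitSet d N δ).card : ℤ) - (exitSet d (M ^ d) δ).card| ≤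
        ((firstIndices d N).filter (· ∈ cornerSet d M D)).card := by
    intro N h1
    induction N, h1 using Nat.le_induction with
    | base => intro _; simp
    | succ N h1 ih =>
      intro h2
      have h3 := abs_card_exitSet_succ_le hd hδ hDM h1 h2
      have h4 := ih (by omega)
      have hN : gradedLexEnum d N ∉ (firstIndices d N).filter (· ∈ cornerSet d M D) := by
        simp [mem_firstIndices_iff hd]
      rw [firstIndices_succ, Finset.filter_insert]
      refine (abs_sub_le _ ((exitSet d N δ).card : ℤ) _).trans ?_
      split_ifs at h3 ⊢ with h5
      · rw [Finset.card_insert_of_notMem hN]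
        push_cast
        linarith
      · linarith
  refine (key N h1 h2).trans ?_
  exact_mod_cast Finset.card_le_card fun α hα => (Finset.mem_filter.1 hα).2

/-- A cube of side `K` has at most `|A| |B| K^(d-2)` points with two coordinates prescribed to lie
in `A` and `B`. -/
theorem card_filter_two_coords_le {K : ℕ} {i j : Fin d} (hij : i ≠ j) (A B : Finset ℕ) :
    ((indexBox d K).filter fun γ => γ i ∈ A ∧ γ j ∈ B).card * K ^ 2 ≤
      A.card * B.card * K ^ d := by
  have hsub : (indexBox d K).filter (fun γ => γ i ∈ A ∧ γ j ∈ B) ⊆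
      Fintype.piFinset fun k => if k = i then A else if k = j then B else Finset.range K := by
    intro γ hγ
    rw [Finset.mem_filter, mem_indexBox] at hγ
    rw [Fintype.mem_piFinset]
    intro k
    split_ifs with h1 h2
    · exact h1 ▸ hγ.2.1
    · exact h2 ▸ hγ.2.2
    · exact Finset.mem_range.2 (hγ.1 k)
  refine (Nat.mul_le_mul_right _ (Finset.card_le_card hsub)).trans (le_of_eq ?_)
  rw [Fintype.card_piFinset]
  have e1 : ∀ (a : ℕ) (i : Fin d), (∏ k : Fin d, if k = i then a else 1) = a := by
    intro a i
    simp
  have e2 : A.card * B.card * K ^ d =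
      ∏ k : Fin d, (if k = i then A.card else 1) * (if k = j then B.card else 1) * K := by
    rw [Finset.prod_mul_distrib, Finset.prod_mul_distrib, e1, e1]
    simp
  have e3 : K ^ 2 = ∏ k : Fin d, (if k = i then K else 1) * (if k = j then K else 1) := by
    rw [Finset.prod_mul_distrib, e1, e1, sq]
  rw [e2, e3, ← Finset.prod_mul_distrib]
  refine Finset.prod_congr rfl fun k _ => ?_
  by_cases h1 : k = i
  · have h2 : k ≠ j := h1 ▸ hij
    simp [h1, hij]
  · by_cases h2 : k = j <;> simp [h1, h2, hij.symm]

/-- Union of the bounds of `card_filter_two_coords_le` over the pairs of coordinates. -/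
theorem card_filter_exists_two_coords_le {K c : ℕ} (A B : Finset ℕ) (hc : A.card * B.card ≤ c)
    (S : Finset (Fin d → ℕ))
    (hS : ∀ γ ∈ S, γ ∈ indexBox d K ∧ ∃ i j, i ≠ j ∧ γ i ∈ A ∧ γ j ∈ B) :
    S.card * K ^ 2 ≤ d ^ 2 * c * K ^ d := by
  have hsub : S ⊆ (Finset.univ.filter fun p : Fin d × Fin d => p.1 ≠ p.2).biUnion fun p =>
      (indexBox d K).filter fun γ => γ p.1 ∈ A ∧ γ p.2 ∈ B := by
    intro γ hγ
    obtain ⟨h1, i, j, hij, h2, h3⟩ := hS γ hγ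
    simp only [Finset.mem_biUnion, Finset.mem_filter, Finset.mem_univ, true_and]
    exact ⟨(i, j), hij, h1, h2, h3⟩
  calc S.card * K ^ 2
      ≤ (∑ p ∈ Finset.univ.filter (fun p : Fin d × Fin d => p.1 ≠ p.2),
          ((indexBox d K).filter fun γ => γ p.1 ∈ A ∧ γ p.2 ∈ B).card) * K ^ 2 :=
        Nat.mul_le_mul_right _ ((Finset.card_le_card hsub).trans Finset.card_biUnion_le)
    _ ≤ ∑ p ∈ Finset.univ.filter (fun p : Fin d × Fin d => p.1 ≠ p.2), c * K ^ d := by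
        rw [Finset.sum_mul]
        refine Finset.sum_le_sum fun p hp => ?_
        exact (card_filter_two_coords_le (Finset.mem_filter.1 hp).2 A B).trans
          (Nat.mul_le_mul_right _ hc)
    _ ≤ d ^ 2 * c * K ^ d := by
        rw [Finset.sum_const, smul_eq_mul, mul_assoc]
        refine Nat.mul_le_mul_right _ ((Finset.card_filter_le _ _).trans ?_)
        simp [sq]

theorem card_cornerSet_le (M D : ℕ) :
    (cornerSet d M D).card * (M + 1) ^ 2 ≤ d ^ 2 * (3 * D + 1) * (M + 1) ^ d := by
  refine card_filter_exists_two_coords_le (Finset.range D ∪ Finset.Icc (M - 2 * D) M) {M} ?_ _ ?_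
  · rw [Finset.card_singleton, mul_one]
    refine (Finset.card_union_le _ _).trans ?_
    rw [Finset.card_range, Nat.card_Icc]
    omega
  · intro γ hγ
    rw [cornerSet, Finset.mem_filter] at hγ
    obtain ⟨h1, i, j, hij, h2, h3⟩ := hγ
    refine ⟨h1, i, j, hij, ?_, by simp [h2]⟩
    have := mem_indexBox.1 h1 i
    simp only [Finset.mem_union, Finset.mem_range, Finset.mem_Icc]
    omega

open Classical in
/-- In an exit set between the cubes of sides `M` and `M + 1` some coordinate is at least `M - D`;
prescribing another one to be less than `L` leaves `O(M^(d-2))` multi-indices. -/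
theorem card_filter_exitSet_le (hd : 0 < d) {M N D L : ℕ} {δ : Fin d → ℤ}
    (hδ : ∀ j, |δ j| ≤ D) (hDM : D + L < M) (h1 : M ^ d ≤ N) (h2 : N ≤ (M + 1) ^ d) :
    ((exitSet d N δ).filter fun α => ∃ i, α i < L).card * (M + 1) ^ 2 ≤
      d ^ 2 * (L * (D + 1)) * (M + 1) ^ d := by
  refine card_filter_exists_two_coords_le (Finset.range L) (Finset.Icc (M - D) M) ?_ _ ?_
  · rw [Finset.card_range, Nat.card_Icc]
    exact Nat.mul_le_mul_left _ (by omega)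
  · intro α hα
    rw [Finset.mem_filter, exitSet, Finset.mem_filter] at hα
    obtain ⟨⟨h3, h4, h5⟩, i, h6⟩ := hα
    have h7 : α ∈ indexBox d (M + 1) := by
      rw [← firstIndices_pow hd]
      exact firstIndices_mono h2 h3
    refine ⟨h7, i, ?_⟩
    have h8 : shiftIndex α δ ∉ indexBox d M := fun h => h5 (by
      rw [← firstIndices_pow hd] at h
      exact firstIndices_mono h1 h)
    rw [mem_indexBox] at h8
    push Not at h8
    obtain ⟨j, hj⟩ := h8
    have h9 := h4.coe j
    have h10 := abs_le.1 (hδ j)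
    have h11 := mem_indexBox.1 h7 j
    have h12 : M - D ≤ α j := by omega
    refine ⟨j, ?_, Finset.mem_range.2 h6, Finset.mem_Icc.2 ⟨h12, by omega⟩⟩
    rintro rfl
    omega

/-- The exit set of a cube is the difference of two boxes: the `α` with `α + δ ≥ 0`, and those for
which `α + δ` is in the cube. -/
theorem card_exitSet_pow (hd : 0 < d) (M : ℕ) (δ : Fin d → ℤ) :
    ((exitSet d (M ^ d) δ).card : ℤ) =
      ∏ j, ((M - (-δ j).toNat : ℕ) : ℤ) - ∏ j, ((M - (δ j).toNat - (-δ j).toNat : ℕ) : ℤ) := by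
  classical
  have h1 : ((indexBox d M).filter fun α => ShiftNonneg α δ) =
      Fintype.piFinset fun j => Finset.Ico (-δ j).toNat M := by
    ext α
    rw [Finset.mem_filter, Fintype.mem_piFinset]
    simp only [mem_indexBox, ShiftNonneg, Finset.mem_Ico, ← forall_and]
    exact forall_congr' fun j => by omega
  have h2 : ((indexBox d M).filter fun α => ShiftNonneg α δ ∧ shiftIndex α δ ∈ indexBox d M) =
      Fintype.piFinset fun j => Finset.Ico (-δ j).toNat (M - (δ j).toNat) := by
    ext α
    rw [Finset.mem_filter, Fintype.mem_piFinset]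
    simp only [mem_indexBox, ShiftNonneg, Finset.mem_Ico, ← forall_and, shiftIndex]
    exact forall_congr' fun j => by omega
  have h3 : (exitSet d (M ^ d) δ).card +
      ((indexBox d M).filter fun α => ShiftNonneg α δ ∧ shiftIndex α δ ∈ indexBox d M).card =
      ((indexBox d M).filter fun α => ShiftNonneg α δ).card := by
    rw [exitSet, firstIndices_pow hd, add_comm, ← Finset.filter_filter, ← Finset.filter_filter,
      Finset.card_filter_add_card_filter_not]
  rw [h1, h2, Fintype.card_piFinset, Fintype.card_piFinset] at h3
  simp only [Nat.card_Ico] at h3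
  rw [eq_sub_iff_add_eq]
  exact_mod_cast h3

end Counting

/-! ### Asymptotics of the number of boundary multi-indices -/

section CountingLimit

variable {d : ℕ}

/-- Side of the largest cube contained in the first `N` multi-indices. -/
noncomputable def cubeSide (d N : ℕ) : ℕ := ⌊(N : ℝ) ^ (1 / (d : ℝ))⌋₊

theorem rpow_inv_pow (hd : 0 < d) (N : ℕ) : ((N : ℝ) ^ (1 / (d : ℝ))) ^ d = N := by
  rw [← Real.rpow_natCast, ← Real.rpow_mul (Nat.cast_nonneg N), one_div,
    inv_mul_cancel₀ (by positivity), Real.rpow_one]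

theorem cubeSide_pow_le (hd : 0 < d) (N : ℕ) : cubeSide d N ^ d ≤ N := by
  have h : (cubeSide d N : ℝ) ≤ (N : ℝ) ^ (1 / (d : ℝ)) := Nat.floor_le (by positivity)
  have := pow_le_pow_left₀ (by positivity) h d
  rw [rpow_inv_pow hd] at this
  exact_mod_cast this

theorem lt_cubeSide_succ_pow (hd : 0 < d) (N : ℕ) : N < (cubeSide d N + 1) ^ d := by
  have h : (N : ℝ) ^ (1 / (d : ℝ)) < (cubeSide d N : ℝ) + 1 := Nat.lt_floor_add_one _
  have := pow_lt_pow_left₀ h (by positivity) hd.ne'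
  rw [rpow_inv_pow hd] at this
  exact_mod_cast this

theorem rpow_one_sub_eq (hd : 0 < d) (N : ℕ) :
    (N : ℝ) ^ (1 - 1 / (d : ℝ)) = ((N : ℝ) ^ (1 / (d : ℝ))) ^ (d - 1) := by
  rw [← Real.rpow_natCast, ← Real.rpow_mul (Nat.cast_nonneg N)]
  congr 1
  rw [Nat.cast_sub hd]
  field_simp
  simp

theorem tendsto_rpow_one_div (hd : 0 < d) :
    Tendsto (fun N : ℕ => (N : ℝ) ^ (1 / (d : ℝ))) atTop atTop :=
  (tendsto_rpow_atTop (by positivity)).comp tendsto_natCast_atTop_atTop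

theorem tendsto_cubeSide (hd : 0 < d) : Tendsto (cubeSide d) atTop atTop :=
  tendsto_nat_floor_atTop.comp (tendsto_rpow_one_div hd)

/-- Quantities of the order of `M^(d-2)`, where `M` is the side of the cube, are negligible. The
bound is multiplied by `(M + 1)²` to avoid negative exponents when `d = 1`. -/
theorem tendsto_div_rpow_zero (hd : 0 < d) (C : ℝ) (u : ℕ → ℝ) (hu0 : ∀ N, 0 ≤ u N)
    (hu : ∀ᶠ N in atTop, u N * ((cubeSide d N : ℝ) + 1) ^ 2 ≤ C * ((cubeSide d N : ℝ) + 1) ^ d) :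
    Tendsto (fun N : ℕ => u N / (N : ℝ) ^ (1 - 1 / (d : ℝ))) atTop (𝓝 0) := by
  have hlim : Tendsto (fun N : ℕ => (|C| * 2 ^ d) * ((N : ℝ) ^ (1 / (d : ℝ)))⁻¹) atTop (𝓝 0) := by
    simpa using (tendsto_rpow_one_div hd).inv_tendsto_atTop.const_mul (|C| * 2 ^ d)
  refine squeeze_zero' (Eventually.of_forall fun N => div_nonneg (hu0 N) (by positivity)) ?_ hlim
  filter_upwards [hu, eventually_gt_atTop 0, (tendsto_rpow_one_div hd).eventually_ge_atTop 1]
    with N h1 hN hr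
  rw [rpow_one_sub_eq hd N]
  set r := (N : ℝ) ^ (1 / (d : ℝ)) with hrdef
  have hr0 : 0 < r := by linarith
  have ha : (cubeSide d N : ℝ) ≤ r := Nat.floor_le (by positivity)
  have hb : r < (cubeSide d N : ℝ) + 1 := Nat.lt_floor_add_one _
  have h2 : u N * r ^ 2 ≤ |C| * (2 * r) ^ d := by
    calc u N * r ^ 2 ≤ u N * ((cubeSide d N : ℝ) + 1) ^ 2 := by
          have := hu0 N
          gcongr
      _ ≤ C * ((cubeSide d N : ℝ) + 1) ^ d := h1
      _ ≤ |C| * (2 * r) ^ d := by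
          have : (cubeSide d N : ℝ) + 1 ≤ 2 * r := by linarith
          have := le_abs_self C
          gcongr
  rw [div_le_iff₀ (by positivity)]
  have h3 : (2 * r) ^ d = 2 ^ d * (r ^ (d - 1) * r) := by
    rw [mul_pow, ← pow_succ, Nat.sub_add_cancel hd]
  rw [h3] at h2
  have h4 : u N ≤ |C| * (2 ^ d * (r ^ (d - 1) * r)) / r ^ 2 := by
    rwa [le_div_iff₀ (by positivity)]
  refine h4.trans (le_of_eq ?_)
  field_simp

theorem tendsto_cubeSide_pow_div (hd : 0 < d) :
    Tendsto (fun N : ℕ => (cubeSide d N : ℝ) ^ (d - 1) / (N : ℝ) ^ (1 - 1 / (d : ℝ)))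
      atTop (𝓝 1) := by
  have h1 : Tendsto (fun N : ℕ => (cubeSide d N : ℝ) / (N : ℝ) ^ (1 / (d : ℝ))) atTop (𝓝 1) :=
    (tendsto_nat_floor_div_atTop (R := ℝ)).comp (tendsto_rpow_one_div hd)
  have h2 := h1.pow (d - 1)
  rw [one_pow] at h2
  refine h2.congr' ?_
  filter_upwards [eventually_gt_atTop 0] with N hN
  rw [rpow_one_sub_eq hd N, div_pow]

/-- The leading term `M^d` cancels; the next one is the derivative at `0` of
`x ↦ ∏ (1 - a_j x) - ∏ (1 - b_j x)`. -/
theorem tendsto_prod_sub_prod (hd : 0 < d) (a b : Fin d → ℝ) :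
    Tendsto (fun M : ℕ => (∏ j, ((M : ℝ) - a j) - ∏ j, ((M : ℝ) - b j)) / (M : ℝ) ^ (d - 1))
      atTop (𝓝 (∑ j, (b j - a j))) := by
  have hder : ∀ a : Fin d → ℝ,
      HasDerivAt (fun x : ℝ => ∏ j, (1 - a j * x)) (∑ j, -a j) 0 := by
    intro a
    have h := HasDerivAt.fun_finsetProd (u := Finset.univ) (x := (0 : ℝ))
      (f := fun (j : Fin d) x => 1 - a j * x) (f' := fun j => -a j) (fun j _ => by
        simpa using ((hasDerivAt_id (0 : ℝ)).const_mul (a j)).const_sub 1)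
    simpa using h
  have h1 := (hder a).sub (hder b)
  rw [hasDerivAt_iff_tendsto_slope_zero] at h1
  have h2 : Tendsto (fun M : ℕ => ((M : ℝ))⁻¹) atTop (𝓝[≠] 0) := by
    refine tendsto_nhdsWithin_iff.2 ⟨tendsto_inv_atTop_nhds_zero_nat, ?_⟩
    filter_upwards [eventually_gt_atTop 0] with M hM
    simp [hM.ne']
  have h3 := h1.comp h2
  have h4 : ∑ j, -a j - ∑ j, -b j = ∑ j, (b j - a j) := by
    rw [← Finset.sum_sub_distrib]
    exact Finset.sum_congr rfl fun j _ => by ring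
  rw [h4] at h3
  refine h3.congr' ?_
  filter_upwards [eventually_gt_atTop 0] with M hM
  have hM' : (M : ℝ) ≠ 0 := by positivity
  have h5 : ∀ a : Fin d → ℝ, ∏ j, ((M : ℝ) - a j) = (M : ℝ) ^ (d - 1) * M *
      ∏ j, (1 - a j * (M : ℝ)⁻¹) := by
    intro a
    rw [← pow_succ, Nat.sub_add_cancel hd]
    have : (M : ℝ) ^ d = ∏ _j : Fin d, (M : ℝ) := by simp
    rw [this, ← Finset.prod_mul_distrib]
    refine Finset.prod_congr rfl fun j _ => ?_
    field_simp
  rw [h5 a, h5 b]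
  simp only [Function.comp, Pi.sub_apply, zero_add, mul_zero, sub_zero, Finset.prod_const_one,
    smul_eq_mul, inv_inv, sub_self]
  field_simp

/-- The number of multi-indices that the translation by `δ` moves out of the first `N` ones, divided
by `N^(1-1/d)`, tends to `∑ δ_j⁺`. -/
theorem tendsto_card_exitSet (hd : 0 < d) (δ : Fin d → ℤ) :
    Tendsto (fun N : ℕ => ((exitSet d N δ).card : ℝ) / (N : ℝ) ^ (1 - 1 / (d : ℝ))) atTop
      (𝓝 (∑ j, ((δ j).toNat : ℝ))) := by
  obtain ⟨D, hD⟩ : ∃ D : ℕ, ∀ j, |δ j| ≤ D := by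
    refine ⟨∑ j, (δ j).natAbs, fun j => ?_⟩
    rw [Int.abs_eq_natAbs]
    exact_mod_cast Finset.single_le_sum (f := fun j => (δ j).natAbs) (fun _ _ => Nat.zero_le _)
      (Finset.mem_univ j)
  -- The count for the largest cube contained in the first `N` multi-indices …
  have hbox : Tendsto (fun N : ℕ => ((exitSet d (cubeSide d N ^ d) δ).card : ℝ) /
      (N : ℝ) ^ (1 - 1 / (d : ℝ))) atTop (𝓝 (∑ j, ((δ j).toNat : ℝ))) := by
    have h1 := ((tendsto_prod_sub_prod hd (fun j => ((-δ j).toNat : ℝ))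
      (fun j => ((δ j).toNat : ℝ) + ((-δ j).toNat : ℝ))).comp (tendsto_cubeSide hd)).mul
        (tendsto_cubeSide_pow_div hd)
    simp only [add_sub_cancel_right, mul_one] at h1
    refine h1.congr' ?_
    filter_upwards [(tendsto_cubeSide hd).eventually_ge_atTop (D + 1)] with N hN
    have h2 := card_exitSet_pow hd (cubeSide d N) δ
    have h3 : ((exitSet d (cubeSide d N ^ d) δ).card : ℝ) =
        ∏ j, ((cubeSide d N : ℝ) - ((-δ j).toNat : ℝ)) -
        ∏ j, ((cubeSide d N : ℝ) - (((δ j).toNat : ℝ) + ((-δ j).toNat : ℝ))) := by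
      have h4 : ((exitSet d (cubeSide d N ^ d) δ).card : ℝ) =
        (((exitSet d (cubeSide d N ^ d) δ).card : ℤ) : ℝ) := by simp
      rw [h4, h2]
      push_cast
      congr 1
      · refine Finset.prod_congr rfl fun j _ => ?_
        have := abs_le.1 (hD j)
        rw [Nat.cast_sub (by omega)]
      · refine Finset.prod_congr rfl fun j _ => ?_
        have := abs_le.1 (hD j)
        rw [Nat.cast_sub (by omega), Nat.cast_sub (by omega)]
        ring
    have hpos : (0 : ℝ) < (cubeSide d N : ℝ) ^ (d - 1) := by
      have : (0 : ℝ) < cubeSide d N := by exact_mod_cast (by omega : 0 < cubeSide d N)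
      positivity
    simp only [Function.comp]
    rw [h3]
    field_simp
  -- … and what the multi-indices outside this cube change, of the order of its corners.
  have hdiff : Tendsto (fun N : ℕ => |((exitSet d N δ).card : ℝ) -
      (exitSet d (cubeSide d N ^ d) δ).card| / (N : ℝ) ^ (1 - 1 / (d : ℝ))) atTop (𝓝 0) := by
    refine tendsto_div_rpow_zero hd (d ^ 2 * (3 * D + 1)) _ (fun _ => abs_nonneg _) ?_
    filter_upwards [(tendsto_cubeSide hd).eventually_ge_atTop D] with N hN
    have h1 := abs_card_exitSet_sub_le hd hD hN (cubeSide_pow_le hd N)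
      (lt_cubeSide_succ_pow hd N).le
    have h2 := card_cornerSet_le (d := d) (cubeSide d N) D
    have h1' : |((exitSet d N δ).card : ℝ) - (exitSet d (cubeSide d N ^ d) δ).card| ≤
      (cornerSet d (cubeSide d N) D).card := by exact_mod_cast h1
    have h2' : ((cornerSet d (cubeSide d N) D).card : ℝ) * ((cubeSide d N : ℝ) + 1) ^ 2 ≤
        d ^ 2 * (3 * D + 1) * ((cubeSide d N : ℝ) + 1) ^ d := by exact_mod_cast h2
    refine le_trans ?_ h2'
    gcongr
  have hdiff' : Tendsto (fun N : ℕ => (((exitSet d N δ).card : ℝ) -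
      (exitSet d (cubeSide d N ^ d) δ).card) / (N : ℝ) ^ (1 - 1 / (d : ℝ))) atTop (𝓝 0) := by
    rw [tendsto_zero_iff_abs_tendsto_zero]
    refine hdiff.congr fun N => ?_
    simp only [Function.comp]
    rw [abs_div, abs_of_nonneg (by positivity : (0 : ℝ) ≤ (N : ℝ) ^ (1 - 1 / (d : ℝ)))]
  have := hbox.add hdiff'
  rw [add_zero] at this
  refine this.congr fun N => ?_
  ring

open Classical in
/-- Multi-indices close to the coordinate hyperplanes do not contribute to the limit. -/
theorem tendsto_card_filter_exitSet (hd : 0 < d) (δ : Fin d → ℤ) (L : ℕ) :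
    Tendsto (fun N : ℕ => (((exitSet d N δ).filter fun α => ∃ i, α i < L).card : ℝ) /
      (N : ℝ) ^ (1 - 1 / (d : ℝ))) atTop (𝓝 0) := by
  obtain ⟨D, hD⟩ : ∃ D : ℕ, ∀ j, |δ j| ≤ D := by
    refine ⟨∑ j, (δ j).natAbs, fun j => ?_⟩
    rw [Int.abs_eq_natAbs]
    exact_mod_cast Finset.single_le_sum (f := fun j => (δ j).natAbs) (fun _ _ => Nat.zero_le _)
      (Finset.mem_univ j)
  refine tendsto_div_rpow_zero hd (d ^ 2 * (L * (D + 1))) _ (fun _ => Nat.cast_nonneg _) ?_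
  filter_upwards [(tendsto_cubeSide hd).eventually_gt_atTop (D + L)] with N hN
  exact_mod_cast card_filter_exitSet_le hd hD hN (cubeSide_pow_le hd N)
    (lt_cubeSide_succ_pow hd N).le

end CountingLimit

/-! ### Linear statistics of projection determinantal point processes -/

section LinearAlgebra

open Polynomial

variable {ι : Type*}

/-- The polynomial `∏ (1 + v_i X)`, whose coefficients are the elementary symmetric functions. -/
noncomputable def esymmPoly (s : Finset ι) (v : ι → ℝ) : ℝ[X] := ∏ i ∈ s, (1 + C (v i) * X)

theorem esymmPoly_coeff (s : Finset ι) (v : ι → ℝ) :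
    (esymmPoly s v).coeff 0 = 1 ∧ (esymmPoly s v).coeff 1 = ∑ i ∈ s, v i ∧
      (esymmPoly s v).coeff 2 = ((∑ i ∈ s, v i) ^ 2 - ∑ i ∈ s, v i ^ 2) / 2 := by
  classical
  induction s using Finset.induction_on with
  | empty => simp [esymmPoly, coeff_one]
  | insert a s ha ih =>
    obtain ⟨h0, h1, h2⟩ := ih
    have : esymmPoly (insert a s) v = esymmPoly s v + C (v a) * (esymmPoly s v * X) := by
      rw [esymmPoly, Finset.prod_insert ha, ← esymmPoly]
      ring
    rw [this, Finset.sum_insert ha, Finset.sum_insert ha]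
    simp only [coeff_add, coeff_C_mul, coeff_mul_X, coeff_mul_X_zero, h0, h1, h2]
    refine ⟨by ring, by ring, by ring⟩

theorem natDegree_esymmPoly_le (s : Finset ι) (v : ι → ℝ) :
    (esymmPoly s v).natDegree ≤ s.card := by
  refine (natDegree_prod_le _ _).trans ?_
  rw [Finset.card_eq_sum_ones]
  refine Finset.sum_le_sum fun i _ => ?_
  rw [add_comm]
  exact natDegree_linear_le

theorem eval_esymmPoly (s : Finset ι) (v : ι → ℝ) (t : ℝ) :
    (esymmPoly s v).eval t = ∏ i ∈ s, (1 + t * v i) := by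
  simp only [esymmPoly, eval_prod, eval_add, eval_one, eval_mul, eval_C, eval_X, mul_comm t]

theorem continuous_coeff_esymmPoly {E : Type*} [TopologicalSpace E] (s : Finset ι) (v : ι → E → ℝ)
    (hv : ∀ i, Continuous (v i)) (n : ℕ) :
    Continuous fun x => (esymmPoly s fun i => v i x).coeff n := by
  classical
  induction s using Finset.induction_on generalizing n with
  | empty => simpa [esymmPoly] using continuous_const
  | insert a s ha ih =>
    have : ∀ x, esymmPoly (insert a s) (fun i => v i x) =
        esymmPoly s (fun i => v i x) + C (v a x) * (esymmPoly s (fun i => v i x) * X) := by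
      intro x
      rw [esymmPoly, Finset.prod_insert ha, ← esymmPoly]
      ring
    simp_rw [this, coeff_add, coeff_C_mul]
    cases n with
    | zero => simpa using ih 0
    | succ n =>
      simp_rw [coeff_mul_X]
      exact (ih (n + 1)).add ((hv a).mul (ih n))

/-- A real symmetric matrix `A` has numbers `λ_i` (its eigenvalues) with `det (1 + t A)`, the trace
of `A` and the trace of `A ^ 2` given by the expected expressions. -/
theorem Matrix.exists_eigenvalues [Fintype ι] [DecidableEq ι] (A : Matrix ι ι ℝ)
    (hA : A.IsHermitian) : ∃ l : ι → ℝ, (∀ t : ℝ, (1 + t • A).det = ∏ i, (1 + t * l i)) ∧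
      A.trace = ∑ i, l i ∧ (A * A).trace = ∑ i, l i ^ 2 := by
  obtain ⟨U, V, l, hUV, hVU, hAe⟩ : ∃ (U V : Matrix ι ι ℝ) (l : ι → ℝ), U * V = 1 ∧ V * U = 1 ∧
      A = U * Matrix.diagonal l * V := by
    refine ⟨hA.eigenvectorUnitary, star (hA.eigenvectorUnitary : Matrix ι ι ℝ), hA.eigenvalues,
      Unitary.mul_star_self_of_mem hA.eigenvectorUnitary.2,
      Unitary.star_mul_self_of_mem hA.eigenvectorUnitary.2, ?_⟩
    have h := hA.spectral_theorem
    rw [Unitary.conjStarAlgAut_apply] at h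
    simpa using h
  refine ⟨l, fun t => ?_, ?_, ?_⟩
  · have h1 : 1 + t • A = U * (1 + t • Matrix.diagonal l) * V := by
      rw [mul_add, add_mul, mul_one, hUV, hAe]
      simp
    have h2 : (1 : Matrix ι ι ℝ) + t • Matrix.diagonal l = Matrix.diagonal fun i => 1 + t * l i := by
      rw [← Matrix.diagonal_one, ← Matrix.diagonal_smul, Matrix.diagonal_add]
      rfl
    rw [h1, Matrix.det_mul, Matrix.det_mul, mul_right_comm, ← Matrix.det_mul, hUV, Matrix.det_one,
      one_mul, h2, Matrix.det_diagonal]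
  · rw [hAe, Matrix.trace_mul_comm, ← mul_assoc, hVU, one_mul, Matrix.trace_diagonal]
  · have h1 : A * A = U * (Matrix.diagonal l * Matrix.diagonal l) * V := by
      calc A * A = U * Matrix.diagonal l * (V * U) * Matrix.diagonal l * V := by
            rw [hAe]; simp only [mul_assoc]
        _ = _ := by rw [hVU]; simp only [mul_assoc, one_mul]
    rw [h1, Matrix.trace_mul_comm, ← mul_assoc, hVU, one_mul, Matrix.diagonal_mul_diagonal,
      Matrix.trace_diagonal]
    simp [sq]

end LinearAlgebra

section Andreief

variable {E : Type*}

theorem det_sum_mul_eq_sq {N : ℕ} (φ : Fin N → E → ℝ) (x : Fin N → E) :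
    (Matrix.of fun i l : Fin N => ∑ k, φ k (x i) * φ k (x l)).det =
      (Matrix.of fun k i : Fin N => φ k (x i)).det ^ 2 := by
  have : (Matrix.of fun i l : Fin N => ∑ k, φ k (x i) * φ k (x l)) =
      (Matrix.of fun k i : Fin N => φ k (x i)).transpose * Matrix.of fun k i : Fin N => φ k (x i) := by
    ext i l
    simp [Matrix.mul_apply]
  rw [this, Matrix.det_mul, Matrix.det_transpose, sq]

/-- Andréief's identity for the square of `det [φ_k(x_i)]`. -/
theorem integral_prod_mul_det [MeasurableSpace E] {μ : Measure E} [SigmaFinite μ] {N : ℕ}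
    (φ : Fin N → E → ℝ) (g : E → ℝ)
    (hint : ∀ k l, Integrable (fun x => g x * (φ k x * φ l x)) μ) :
    ∫ x : Fin N → E, (∏ i, g (x i)) *
      (Matrix.of fun i l : Fin N => ∑ k, φ k (x i) * φ k (x l)).det ∂(Measure.pi fun _ => μ) =
    N.factorial * (Matrix.of fun k l : Fin N => ∫ x, g x * (φ k x * φ l x) ∂μ).det := by
  set A : Matrix (Fin N) (Fin N) ℝ := Matrix.of fun k l => ∫ x, g x * (φ k x * φ l x) ∂μ with hA
  have h1 : ∀ x : Fin N → E, (∏ i, g (x i)) *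
      (Matrix.of fun i l : Fin N => ∑ k, φ k (x i) * φ k (x l)).det =
      ∑ σ : Equiv.Perm (Fin N), ∑ τ : Equiv.Perm (Fin N),
        ((Equiv.Perm.sign σ : ℤ) : ℝ) * (((Equiv.Perm.sign τ : ℤ) : ℝ) *
          ∏ i, g (x i) * (φ (σ i) (x i) * φ (τ i) (x i))) := by
    intro x
    rw [det_sum_mul_eq_sq, sq, Matrix.det_apply', Finset.sum_mul_sum, Finset.mul_sum]
    refine Finset.sum_congr rfl fun σ _ => ?_
    rw [Finset.mul_sum]
    refine Finset.sum_congr rfl fun τ _ => ?_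
    simp only [Matrix.of_apply, Finset.prod_mul_distrib]
    ring
  have hi : ∀ σ τ : Equiv.Perm (Fin N), Integrable (fun x : Fin N → E =>
      ∏ i, g (x i) * (φ (σ i) (x i) * φ (τ i) (x i))) (Measure.pi fun _ => μ) := fun σ τ =>
    Integrable.fintype_prod (f := fun i x => g x * (φ (σ i) x * φ (τ i) x))
      fun i => hint (σ i) (τ i)
  simp_rw [h1]
  rw [integral_finsetSum _ fun σ _ => integrable_finsetSum _ fun τ _ =>
    ((hi σ τ).const_mul _).const_mul _]
  have h2 : ∀ σ : Equiv.Perm (Fin N), ∫ x : Fin N → E, ∑ τ : Equiv.Perm (Fin N),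
        ((Equiv.Perm.sign σ : ℤ) : ℝ) * (((Equiv.Perm.sign τ : ℤ) : ℝ) *
          ∏ i, g (x i) * (φ (σ i) (x i) * φ (τ i) (x i))) ∂(Measure.pi fun _ => μ) = A.det := by
    intro σ
    rw [integral_finsetSum _ fun τ _ => ((hi σ τ).const_mul _).const_mul _]
    have h3 : ∀ τ : Equiv.Perm (Fin N), ∫ x : Fin N → E,
        ∏ i, g (x i) * (φ (σ i) (x i) * φ (τ i) (x i)) ∂(Measure.pi fun _ => μ) =
        ∏ i, A (σ i) (τ i) := fun τ =>
      integral_fintype_prod_eq_prod (f := fun i x => g x * (φ (σ i) x * φ (τ i) x))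
        (μ := fun _ => μ)
    simp_rw [integral_const_mul, h3]
    rw [← Finset.mul_sum]
    have h4 : ∑ τ : Equiv.Perm (Fin N), ((Equiv.Perm.sign τ : ℤ) : ℝ) * ∏ i, A (σ i) (τ i) =
        (A.submatrix σ id).det := by
      rw [← Matrix.det_transpose, Matrix.det_apply']
      rfl
    rw [h4, Matrix.det_permute, ← mul_assoc]
    have h5 : (((Equiv.Perm.sign σ : ℤ) : ℝ)) * ((Equiv.Perm.sign σ : ℤ) : ℝ) = 1 := by
      rw [← Int.cast_mul, ← Units.val_mul, Int.units_mul_self]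
      simp
    rw [h5, one_mul]
  simp_rw [h2]
  simp [Fintype.card_perm]

end Andreief

section Ensemble

variable {d : ℕ} {μ : Measure (Fin d → ℝ)} {K : Set (Fin d → ℝ)}

theorem cdKernel_eq (N : ℕ) (x y : Fin d → ℝ) :
    cdKernel μ N x y = ∑ k : Fin N, multiOrthoPoly μ k x * multiOrthoPoly μ k y := by
  rw [cdKernel, Finset.sum_range]

theorem det_cdKernel_nonneg (N : ℕ) (x : Fin N → Fin d → ℝ) :
    0 ≤ (Matrix.of fun i l : Fin N => cdKernel μ N (x i) (x l)).det := by
  simp_rw [cdKernel_eq]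
  rw [det_sum_mul_eq_sq (fun k : Fin N => multiOrthoPoly μ k)]
  positivity

theorem continuous_det_cdKernel (hφ : ∀ k, Continuous (multiOrthoPoly μ k)) (N : ℕ) :
    Continuous fun x : Fin N → Fin d → ℝ =>
      (Matrix.of fun i l : Fin N => cdKernel μ N (x i) (x l)).det := by
  refine Continuous.matrix_det ?_
  refine continuous_matrix fun i l => ?_
  simp only [Matrix.of_apply, cdKernel]
  refine continuous_finsetSum _ fun k _ => ?_
  exact ((hφ k).comp (continuous_apply i)).mul ((hφ k).comp (continuous_apply l))

theorem integral_opEnsemble (hφ : ∀ k, Continuous (multiOrthoPoly μ k)) (N : ℕ)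
    (F : (Fin N → Fin d → ℝ) → ℝ) :
    ∫ x, F x ∂(opEnsemble μ N) = 1 / (N.factorial : ℝ) * ∫ x, F x *
      (Matrix.of fun i l : Fin N => cdKernel μ N (x i) (x l)).det ∂(Measure.pi fun _ => μ) := by
  have hc := continuous_det_cdKernel hφ N
  rw [opEnsemble, integral_withDensity_eq_integral_toReal_smul
    (hc.measurable.const_mul _).ennreal_ofReal
    (Eventually.of_forall fun _ => ENNReal.ofReal_lt_top), ← integral_const_mul]
  refine integral_congr_ae (Eventually.of_forall fun x => ?_)
  have := det_cdKernel_nonneg (μ := μ) N x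
  simp only [smul_eq_mul]
  rw [ENNReal.toReal_ofReal (by positivity)]
  ring

variable [IsFiniteMeasure μ]

theorem pi_compl_null (h0 : μ Kᶜ = 0) (N : ℕ) :
    (Measure.pi fun _ : Fin N => μ) (Set.univ.pi fun _ : Fin N => K)ᶜ = 0 := by
  have h1 : ∀ i : Fin N, ∀ᵐ x ∂(Measure.pi fun _ : Fin N => μ), x i ∈ K := fun i =>
    (Measure.quasiMeasurePreserving_eval (fun _ : Fin N => μ) i).ae (p := fun y => y ∈ K)
      (by rw [ae_iff]; exact h0)
  have h2 := ae_all_iff.2 h1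
  rw [ae_iff] at h2
  convert h2 using 2
  ext x
  simp

theorem opEnsemble_compl_null (h0 : μ Kᶜ = 0) (N : ℕ) :
    opEnsemble μ N (Set.univ.pi fun _ : Fin N => K)ᶜ = 0 :=
  withDensity_absolutelyContinuous _ _ (pi_compl_null h0 N)

/-- The expectation of a product over the points is the determinant of a Gram matrix. -/
theorem integral_prod_opEnsemble (hK : IsCompact K) (h0 : μ Kᶜ = 0)
    (hφ : ∀ k, Continuous (multiOrthoPoly μ k)) (N : ℕ) {g : (Fin d → ℝ) → ℝ} (hg : Continuous g) :
    ∫ x, ∏ i, g (x i) ∂(opEnsemble μ N) = (Matrix.of fun k l : Fin N =>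
      ∫ x, g x * (multiOrthoPoly μ k x * multiOrthoPoly μ l x) ∂μ).det := by
  rw [integral_opEnsemble hφ]
  simp_rw [cdKernel_eq]
  rw [integral_prod_mul_det (fun k : Fin N => multiOrthoPoly μ k) g fun k l =>
    (hg.mul ((hφ k).mul (hφ l))).integrable_of_compl_null hK h0]
  field_simp

theorem isProbabilityMeasure_opEnsemble (hK : IsCompact K) (h0 : μ Kᶜ = 0)
    (hφ : ∀ k, Continuous (multiOrthoPoly μ k))
    (horth : ∀ m n, ∫ x, multiOrthoPoly μ m x * multiOrthoPoly μ n x ∂μ = if m = n then 1 else 0)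
    (N : ℕ) : IsProbabilityMeasure (opEnsemble μ N) := by
  have hfin : IsFiniteMeasure (opEnsemble μ N) :=
    isFiniteMeasure_withDensity_ofReal
      ((continuous_const.mul (continuous_det_cdKernel hφ N)).integrable_of_compl_null
        (isCompact_univ_pi fun _ => hK) (pi_compl_null h0 N)).2
  have h1 := integral_prod_opEnsemble hK h0 hφ N (g := fun _ => 1) continuous_const
  have h2 : (Matrix.of fun k l : Fin N =>
      ∫ x, 1 * (multiOrthoPoly μ k x * multiOrthoPoly μ l x) ∂μ) = 1 := by
    ext k l
    simp [horth, Matrix.one_apply, Fin.ext_iff]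
  rw [h2, Matrix.det_one] at h1
  simp only [Finset.prod_const_one, integral_const, smul_eq_mul, mul_one] at h1
  exact ⟨(ENNReal.toReal_eq_one_iff _).1 h1⟩

/-- The variance of a linear statistic of the ensemble as a function of the test function:
`∫ g² K_N(x, x) dμ - ∬ g(x) g(y) K_N(x, y)² dμ dμ`. -/
noncomputable def ensembleVar (μ : Measure (Fin d → ℝ)) (N : ℕ) (g : (Fin d → ℝ) → ℝ) : ℝ :=
  ∑ k ∈ Finset.range N, ∫ x, g x ^ 2 * (multiOrthoPoly μ k x * multiOrthoPoly μ k x) ∂μ -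
    ∑ k ∈ Finset.range N, ∑ l ∈ Finset.range N,
      (∫ x, g x * (multiOrthoPoly μ k x * multiOrthoPoly μ l x) ∂μ) ^ 2

/-- First two factorial moments of a linear statistic. They are read off from the coefficients of
`t` and `t²` in `𝔼 ∏ (1 + t g(x_i)) = det (1 + t A)`. -/
theorem moments_opEnsemble (hK : IsCompact K) (h0 : μ Kᶜ = 0)
    (hφ : ∀ k, Continuous (multiOrthoPoly μ k))
    (horth : ∀ m n, ∫ x, multiOrthoPoly μ m x * multiOrthoPoly μ n x ∂μ = if m = n then 1 else 0)
    (N : ℕ) {g : (Fin d → ℝ) → ℝ} (hg : Continuous g) :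
    ∫ x, ∑ i, g (x i) ∂(opEnsemble μ N) =
      ∑ k : Fin N, ∫ x, g x * (multiOrthoPoly μ k x * multiOrthoPoly μ k x) ∂μ ∧
    ∫ x, ((∑ i, g (x i)) ^ 2 - ∑ i, g (x i) ^ 2) ∂(opEnsemble μ N) =
      (∑ k : Fin N, ∫ x, g x * (multiOrthoPoly μ k x * multiOrthoPoly μ k x) ∂μ) ^ 2 -
      ∑ k : Fin N, ∑ l : Fin N,
        (∫ x, g x * (multiOrthoPoly μ k x * multiOrthoPoly μ l x) ∂μ) ^ 2 := by
  have hP := isProbabilityMeasure_opEnsemble hK h0 hφ horth N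
  set A : Matrix (Fin N) (Fin N) ℝ := Matrix.of fun k l : Fin N =>
    ∫ x, g x * (multiOrthoPoly μ k x * multiOrthoPoly μ l x) ∂μ with hA
  have hsymm : ∀ k l, A k l = A l k := fun k l => by
    simp only [hA, Matrix.of_apply]
    exact integral_congr_ae (Eventually.of_forall fun x => by ring)
  obtain ⟨l, hl1, hl2, hl3⟩ := A.exists_eigenvalues (by
    ext k l
    simp [hsymm l k])
  have hint : ∀ {F : (Fin N → Fin d → ℝ) → ℝ}, Continuous F → Integrable F (opEnsemble μ N) :=
    fun hF => hF.integrable_of_compl_null (isCompact_univ_pi fun _ => hK)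
      (opEnsemble_compl_null h0 N)
  have hdet : ∀ t : ℝ, ∫ x, ∏ i, (1 + t * g (x i)) ∂(opEnsemble μ N) = ∏ i, (1 + t * l i) := by
    intro t
    rw [integral_prod_opEnsemble hK h0 hφ N (g := fun x => 1 + t * g x) (by fun_prop), ← hl1]
    congr 1
    ext k m
    have hi : ∀ {F : (Fin d → ℝ) → ℝ}, Continuous F → Integrable F μ :=
      fun hF => hF.integrable_of_compl_null hK h0
    have hk := hφ k
    have hm := hφ m
    simp only [Matrix.of_apply, Matrix.add_apply, Matrix.smul_apply, smul_eq_mul, hA, add_mul,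
      one_mul, mul_assoc]
    rw [integral_add (hi (by fun_prop)) (hi (by fun_prop)), integral_const_mul, horth]
    simp [Matrix.one_apply, Fin.ext_iff]
  have hcont : ∀ n, Continuous fun x : Fin N → Fin d → ℝ =>
      (esymmPoly Finset.univ fun i => g (x i)).coeff n := fun n =>
    continuous_coeff_esymmPoly _ (fun i (x : Fin N → Fin d → ℝ) => g (x i))
      (fun i => hg.comp (continuous_apply i)) n
  -- Both sides are polynomials in `t` with the same values: compare coefficients.
  have hpoly : (∑ n ∈ Finset.range (N + 1), Polynomial.C (∫ x : Fin N → Fin d → ℝ,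
      (esymmPoly Finset.univ fun i => g (x i)).coeff n ∂(opEnsemble μ N)) * Polynomial.X ^ n) =
      esymmPoly Finset.univ l := by
    refine Polynomial.funext fun t => ?_
    rw [eval_esymmPoly, ← hdet]
    simp_rw [← eval_esymmPoly]
    have h1 : ∀ x : Fin N → Fin d → ℝ, (esymmPoly Finset.univ fun i => g (x i)).eval t =
        ∑ n ∈ Finset.range (N + 1), (esymmPoly Finset.univ fun i => g (x i)).coeff n * t ^ n :=
      fun x => Polynomial.eval_eq_sum_range' (Nat.lt_succ_iff.2
        ((natDegree_esymmPoly_le _ _).trans (by simp))) t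
    simp_rw [h1]
    rw [integral_finsetSum _ fun n _ => (hint (hcont n)).mul_const _]
    simp_rw [integral_mul_const]
    simp [Polynomial.eval_finsetSum]
  have hcoeff : ∀ n, ∫ x : Fin N → Fin d → ℝ,
      (esymmPoly Finset.univ fun i => g (x i)).coeff n ∂(opEnsemble μ N) =
      (esymmPoly Finset.univ l).coeff n := by
    intro n
    by_cases hn : n < N + 1
    · rw [← hpoly]
      simp only [Polynomial.finsetSum_coeff, Polynomial.coeff_C_mul, Polynomial.coeff_X_pow]
      simp [hn]
    · have hz : ∀ v : Fin N → ℝ, (esymmPoly Finset.univ v).coeff n = 0 := fun v =>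
        Polynomial.coeff_eq_zero_of_natDegree_lt
          ((natDegree_esymmPoly_le _ _).trans_lt (by simpa using hn))
      simp [hz]
  have htr : ∑ k : Fin N, ∫ x, g x * (multiOrthoPoly μ k x * multiOrthoPoly μ k x) ∂μ =
      ∑ i, l i := by
    rw [← hl2]
    rfl
  have htr2 : ∑ k : Fin N, ∑ l : Fin N,
        (∫ x, g x * (multiOrthoPoly μ k x * multiOrthoPoly μ l x) ∂μ) ^ 2 = ∑ i, l i ^ 2 := by
    rw [← hl3, Matrix.trace]
    refine Finset.sum_congr rfl fun k _ => ?_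
    rw [Matrix.diag_apply, Matrix.mul_apply]
    refine Finset.sum_congr rfl fun m _ => ?_
    rw [hsymm m k, sq]
    rfl
  constructor
  · have h1 := hcoeff 1
    simp_rw [(esymmPoly_coeff _ _).2.1] at h1
    rw [h1, htr]
  · have h1 := hcoeff 2
    simp_rw [(esymmPoly_coeff _ _).2.2] at h1
    rw [integral_div] at h1
    rw [htr, htr2]
    linarith

/-- The factorial moments of `g`, and the first moment of `g ^ 2`, give the variance. -/
theorem variance_opEnsemble (hK : IsCompact K) (h0 : μ Kᶜ = 0)
    (hφ : ∀ k, Continuous (multiOrthoPoly μ k))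
    (horth : ∀ m n, ∫ x, multiOrthoPoly μ m x * multiOrthoPoly μ n x ∂μ = if m = n then 1 else 0)
    (N : ℕ) {g : (Fin d → ℝ) → ℝ} (hg : Continuous g) :
    variance (fun x : Fin N → Fin d → ℝ => ∑ i, g (x i)) (opEnsemble μ N) =
      ensembleVar μ N g := by
  have hP := isProbabilityMeasure_opEnsemble hK h0 hφ horth N
  have hint : ∀ {F : (Fin N → Fin d → ℝ) → ℝ}, Continuous F → Integrable F (opEnsemble μ N) :=
    fun hF => hF.integrable_of_compl_null (isCompact_univ_pi fun _ => hK)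
      (opEnsemble_compl_null h0 N)
  have hc : Continuous fun x : Fin N → Fin d → ℝ => ∑ i, g (x i) := by fun_prop
  have hc2 : Continuous fun x : Fin N → Fin d → ℝ => ∑ i, g (x i) ^ 2 := by fun_prop
  have hL2 : MemLp (fun x : Fin N → Fin d → ℝ => ∑ i, g (x i)) 2 (opEnsemble μ N) :=
    (memLp_two_iff_integrable_sq hc.aestronglyMeasurable).2 (hint (hc.pow 2))
  rw [variance_eq_sub hL2]
  obtain ⟨h1, h2⟩ := moments_opEnsemble hK h0 hφ horth N hg
  obtain ⟨h3, -⟩ := moments_opEnsemble hK h0 hφ horth N (hg.pow 2)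
  rw [integral_sub (f := fun x : Fin N → Fin d → ℝ => (∑ i, g (x i)) ^ 2) (hint (hc.pow 2))
    (hint hc2)] at h2
  simp only [Pi.pow_apply] at h3
  rw [h3] at h2
  rw [h1, ensembleVar]
  simp_rw [Finset.sum_range]
  simp only [Pi.pow_apply]
  linarith

end Ensemble

/-! ### Chebyshev polynomials of the Jacobi matrix in one variable -/

section OneVariable

open Polynomial

variable {ν : Measure ℝ}

/-- The normalized Chebyshev polynomial as an element of `ℝ[X]`. -/
noncomputable def chebPolynomial (m : ℕ) : ℝ[X] :=
  C (if m = 0 then 1 else √2) * Chebyshev.T ℝ (m : ℤ)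

theorem normChebyshev_eq_eval (m : ℕ) (x : ℝ) : normChebyshev m x = (chebPolynomial m).eval x := by
  rw [normChebyshev, chebPolynomial]
  split_ifs with h
  · simp [h]
  · simp

theorem continuous_normChebyshev (m : ℕ) : Continuous (normChebyshev m) := by
  have : normChebyshev m = fun x => (chebPolynomial m).eval x := funext (normChebyshev_eq_eval m)
  rw [this]
  fun_prop

theorem degree_chebPolynomial (m : ℕ) : (chebPolynomial m).degree = m := by
  rw [chebPolynomial, degree_C_mul (by split_ifs <;> simp), Chebyshev.degree_T]
  simp

/-- The matrix of multiplication by the `m`-th normalized Chebyshev polynomial in the basis of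
orthonormal polynomials of `ν`. -/
noncomputable def chebEntry (ν : Measure ℝ) (m n l : ℕ) : ℝ :=
  ∫ x, normChebyshev m x * ((orthoPolynomial ν n).eval x * (orthoPolynomial ν l).eval x) ∂ν

theorem chebEntry_comm (m n l : ℕ) : chebEntry ν m n l = chebEntry ν m l n := by
  simp_rw [chebEntry, mul_comm ((orthoPolynomial ν n).eval _)]

variable [IsFiniteMeasure ν]

theorem IsNevaiClass.chebEntry_eq_zero (hν : IsNevaiClass ν) {m n l : ℕ} (h : n + m < l) :
    chebEntry ν m n l = 0 := by
  have h0 := hν.integral_mul_eq_zero (n := l) (p := chebPolynomial m * orthoPolynomial ν n) (by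
    rw [degree_mul, degree_chebPolynomial, (hν.degree_orthoPolynomial n).2]
    norm_cast
    omega)
  simp only [eval_mul, ← normChebyshev_eq_eval, mul_assoc] at h0
  exact h0

theorem IsNevaiClass.normChebyshev_mul_eq_sum (hν : IsNevaiClass ν) {m n B : ℕ} (h : n + m < B)
    (x : ℝ) : normChebyshev m x * (orthoPolynomial ν n).eval x =
      ∑ l ∈ Finset.range B, chebEntry ν m n l * (orthoPolynomial ν l).eval x := by
  have h0 := hν.eval_eq_sum B (chebPolynomial m * orthoPolynomial ν n) (by
    rw [degree_mul, degree_chebPolynomial, (hν.degree_orthoPolynomial n).2]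
    norm_cast
    omega) x
  simp only [eval_mul, ← normChebyshev_eq_eval, mul_assoc] at h0
  exact h0

/-- If the entries of multiplication by `G` converge along diagonals, then so do those of
multiplication by `x G`: the recurrence coefficients tend to `1/2` and `0`. -/
theorem IsNevaiClass.tendsto_mul_X (hν : IsNevaiClass ν) {G : ℝ → ℝ} (hG : Continuous G)
    {γ : ℤ → ℝ} (h : ∀ p q : ℕ, Tendsto (fun n => ∫ x, G x * ((orthoPolynomial ν (n + p)).eval x *
      (orthoPolynomial ν (n + q)).eval x) ∂ν) atTop (𝓝 (γ (q - p)))) (p q : ℕ) :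
    Tendsto (fun n => ∫ x, (x * G x) * ((orthoPolynomial ν (n + p)).eval x *
      (orthoPolynomial ν (n + q)).eval x) ∂ν) atTop
      (𝓝 ((γ (q - p - 1) + γ (q - p + 1)) / 2)) := by
  -- Shift `n` by one, so that the recurrence for `φ_(n+1+p)` has its three terms.
  rw [← tendsto_add_atTop_iff_nat 1]
  have h1 : ∀ n, ∫ x, (x * G x) * ((orthoPolynomial ν (n + 1 + p)).eval x *
      (orthoPolynomial ν (n + 1 + q)).eval x) ∂ν =
      recCoeffA ν (n + (p + 1)) * (∫ x, G x * ((orthoPolynomial ν (n + (p + 2))).eval x *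
        (orthoPolynomial ν (n + (q + 1))).eval x) ∂ν) +
      recCoeffB ν (n + (p + 1)) * (∫ x, G x * ((orthoPolynomial ν (n + (p + 1))).eval x *
        (orthoPolynomial ν (n + (q + 1))).eval x) ∂ν) +
      recCoeffA ν (n + p) * (∫ x, G x * ((orthoPolynomial ν (n + p)).eval x *
        (orthoPolynomial ν (n + (q + 1))).eval x) ∂ν) := by
    intro n
    rw [← integral_const_mul, ← integral_const_mul, ← integral_const_mul,
      ← integral_add (hν.integrable (by fun_prop)) (hν.integrable (by fun_prop)),
      ← integral_add (hν.integrable (by fun_prop)) (hν.integrable (by fun_prop))]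
    refine integral_congr_ae (Eventually.of_forall fun x => ?_)
    have h2 := hν.recurrence (n + p) x
    have e1 : n + 1 + p = n + p + 1 := by ring
    have e2 : n + 1 + q = n + (q + 1) := by ring
    simp only [e1, e2, ← add_assoc] at h2 ⊢
    linear_combination (G x * (orthoPolynomial ν (n + q + 1)).eval x) * h2
  simp_rw [h1]
  have ha : ∀ p, Tendsto (fun n => recCoeffA ν (n + p)) atTop (𝓝 (1 / 2)) := fun p =>
    (tendsto_add_atTop_iff_nat p).2 hν.tendsto_a
  have hb : ∀ p, Tendsto (fun n => recCoeffB ν (n + p)) atTop (𝓝 0) := fun p =>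
    (tendsto_add_atTop_iff_nat p).2 hν.tendsto_b
  have := (((ha (p + 1)).mul (h (p + 2) (q + 1))).add ((hb (p + 1)).mul (h (p + 1) (q + 1)))).add
    ((ha p).mul (h p (q + 1)))
  convert this using 2
  have e1 : ((q : ℤ) - p - 1) = ((q + 1 : ℕ) : ℤ) - ((p + 2 : ℕ) : ℤ) := by push_cast; ring
  have e2 : ((q : ℤ) - p + 1) = ((q + 1 : ℕ) : ℤ) - (p : ℤ) := by push_cast; ring
  rw [e1, e2]
  ring

/-- The limits along diagonals are those of the free Jacobi matrix `(S + S⁻¹) / 2`, for which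
`T_m` is `(S^m + S^(-m)) / 2`. -/
theorem IsNevaiClass.tendsto_T (hν : IsNevaiClass ν) (m : ℕ) : ∀ p q : ℕ,
    Tendsto (fun n => ∫ x, (Chebyshev.T ℝ (m : ℤ)).eval x * ((orthoPolynomial ν (n + p)).eval x *
      (orthoPolynomial ν (n + q)).eval x) ∂ν) atTop
      (𝓝 (((if (q : ℤ) - p = m then (1 : ℝ) else 0) + (if (q : ℤ) - p = -m then 1 else 0)) / 2)) := by
  induction m using Nat.twoStepInduction with
  | zero =>
    intro p q
    simp only [Nat.cast_zero, Chebyshev.T_zero, eval_one, one_mul, hν.orthonormal, neg_zero]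
    refine tendsto_const_nhds.congr fun n => ?_
    by_cases h : p = q
    · simp [h]
    · have h2 : ¬ ((q : ℤ) - p = 0) := by omega
      simp [h, h2]
  | one =>
    have h0 : ∀ p q : ℕ, Tendsto (fun n => ∫ x, (1 : ℝ) * ((orthoPolynomial ν (n + p)).eval x *
        (orthoPolynomial ν (n + q)).eval x) ∂ν) atTop
        (𝓝 ((fun δ : ℤ => if δ = 0 then (1 : ℝ) else 0) (q - p))) := by
      intro p q
      simp only [one_mul, hν.orthonormal]
      refine tendsto_const_nhds.congr fun n => ?_
      by_cases h : p = q
      · simp [h]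
      · have h2 : ¬ ((q : ℤ) - p = 0) := by omega
        simp [h, h2]
    intro p q
    have h1 := hν.tendsto_mul_X (G := fun _ => 1) continuous_const
      (γ := fun δ : ℤ => if δ = 0 then (1 : ℝ) else 0) h0 p q
    simp only [mul_one] at h1
    simp only [Nat.cast_one, Chebyshev.T_one, eval_X]
    have c1 : ((q : ℤ) - p - 1 = 0) ↔ (q : ℤ) - p = 1 := by omega
    have c2 : ((q : ℤ) - p + 1 = 0) ↔ (q : ℤ) - p = -1 := by omega
    simpa only [c1, c2] using h1
  | more m ih0 ih1 =>
    intro p q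
    have h1 := hν.tendsto_mul_X (G := fun x => (Chebyshev.T ℝ ((m + 1 : ℕ) : ℤ)).eval x)
      (by fun_prop) (γ := fun δ => ((if δ = (m + 1 : ℕ) then (1 : ℝ) else 0) +
        (if δ = -((m + 1 : ℕ) : ℤ) then 1 else 0)) / 2) ih1 p q
    have h2 := (h1.const_mul 2).sub (ih0 p q)
    have e1 : ∀ n, ∫ x, (Chebyshev.T ℝ ((m + 2 : ℕ) : ℤ)).eval x *
        ((orthoPolynomial ν (n + p)).eval x * (orthoPolynomial ν (n + q)).eval x) ∂ν =
        2 * (∫ x, (x * (Chebyshev.T ℝ ((m + 1 : ℕ) : ℤ)).eval x) *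
          ((orthoPolynomial ν (n + p)).eval x * (orthoPolynomial ν (n + q)).eval x) ∂ν) -
        ∫ x, (Chebyshev.T ℝ (m : ℤ)).eval x * ((orthoPolynomial ν (n + p)).eval x *
          (orthoPolynomial ν (n + q)).eval x) ∂ν := by
      intro n
      rw [← integral_const_mul, ← integral_sub (hν.integrable (by fun_prop))
        (hν.integrable (by fun_prop))]
      refine integral_congr_ae (Eventually.of_forall fun x => ?_)
      have h3 : Chebyshev.T ℝ ((m + 2 : ℕ) : ℤ) =
          2 * X * Chebyshev.T ℝ ((m + 1 : ℕ) : ℤ) - Chebyshev.T ℝ (m : ℤ) := by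
        push_cast
        exact Chebyshev.T_add_two ℝ m
      simp only [h3, eval_sub, eval_mul, eval_X, eval_ofNat]
      ring
    simp_rw [e1]
    convert h2 using 2
    have c1 : ((q : ℤ) - p - 1 = ((m + 1 : ℕ) : ℤ)) ↔ (q : ℤ) - p = ((m + 2 : ℕ) : ℤ) := by omega
    have c2 : ((q : ℤ) - p - 1 = -((m + 1 : ℕ) : ℤ)) ↔ (q : ℤ) - p = -(m : ℤ) := by omega
    have c3 : ((q : ℤ) - p + 1 = ((m + 1 : ℕ) : ℤ)) ↔ (q : ℤ) - p = (m : ℤ) := by omega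
    have c4 : ((q : ℤ) - p + 1 = -((m + 1 : ℕ) : ℤ)) ↔ (q : ℤ) - p = -((m + 2 : ℕ) : ℤ) := by omega
    simp only [c1, c2, c3, c4]
    ring

/-- Entries of the normalized Chebyshev polynomials of the free Jacobi matrix `(S + S⁻¹) / 2`, as
a function of the difference `δ` of the indices: `1` at `δ = 0` if `m = 0`, and `√2 / 2` at
`δ = ± m` otherwise. -/
noncomputable def freeEntry (m : ℕ) (δ : ℤ) : ℝ :=
  if δ.natAbs = m then (if δ = 0 then 1 else (√2)⁻¹) else 0

theorem IsNevaiClass.tendsto_chebEntry (hν : IsNevaiClass ν) (m : ℕ) (δ : ℤ) :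
    Tendsto (fun n : ℕ => chebEntry ν m n (n + δ).toNat) atTop (𝓝 (freeEntry m δ)) := by
  rw [← tendsto_add_atTop_iff_nat (-δ).toNat]
  have h := (hν.tendsto_T m (-δ).toNat δ.toNat).const_mul (if m = 0 then 1 else √2)
  have e1 : ((δ.toNat : ℤ) - ((-δ).toNat : ℤ)) = δ := by omega
  rw [e1] at h
  have e2 : (if m = 0 then 1 else √2) * (((if δ = (m : ℤ) then (1 : ℝ) else 0) +
      (if δ = -(m : ℤ) then 1 else 0)) / 2) = freeEntry m δ := by
    rw [freeEntry]
    have hs : √2 * √2 = 2 := Real.mul_self_sqrt (by norm_num)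
    rcases Nat.eq_zero_or_pos m with rfl | hm
    · by_cases h0 : δ = 0 <;> simp [h0]
    · by_cases h1 : δ.natAbs = m
      · have h0 : δ ≠ 0 := by omega
        have : ((if δ = (m : ℤ) then (1 : ℝ) else 0) + (if δ = -(m : ℤ) then 1 else 0)) = 1 := by
          rcases Int.natAbs_eq δ with h2 | h2
          · rw [if_pos (by omega), if_neg (by omega), add_zero]
          · rw [if_neg (by omega), if_pos (by omega), zero_add]
        rw [this, if_pos h1, if_neg h0, if_neg hm.ne']
        field_simp
        linarith
      · have h2 : ¬ δ = (m : ℤ) := by omega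
        have h3 : ¬ δ = -(m : ℤ) := by omega
        simp [h1, h2, h3]
  rw [e2] at h
  refine h.congr fun n => ?_
  have e3 : (((n + (-δ).toNat : ℕ) : ℤ) + δ).toNat = n + δ.toNat := by omega
  rw [e3, chebEntry, ← integral_const_mul]
  refine integral_congr_ae (Eventually.of_forall fun x => ?_)
  simp only [normChebyshev_eq_eval, chebPolynomial, eval_mul, eval_C]
  ring

end OneVariable

/-! ### Products of orthonormal polynomials -/

section Product

variable {d : ℕ} {ν : Fin d → Measure ℝ}

/-- The products of one-variable orthonormal polynomials. -/
noncomputable def prodOrthoPoly (ν : Fin d → Measure ℝ) (α : Fin d → ℕ) (x : Fin d → ℝ) : ℝ :=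
  ∏ j, (orthoPolynomial (ν j) (α j)).eval (x j)

theorem continuous_prodOrthoPoly (α : Fin d → ℕ) : Continuous (prodOrthoPoly ν α) := by
  unfold prodOrthoPoly
  fun_prop

/-- The products of one-variable normalized Chebyshev polynomials. -/
noncomputable def chebProd (m : Fin d → ℕ) (x : Fin d → ℝ) : ℝ := ∏ j, normChebyshev (m j) (x j)

theorem continuous_chebProd (m : Fin d → ℕ) : Continuous (chebProd m) :=
  continuous_finsetProd _ fun j _ => (continuous_normChebyshev (m j)).comp (continuous_apply j)

variable [∀ j, IsFiniteMeasure (ν j)]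

theorem pi_cube_compl_null (hν : ∀ j, IsNevaiClass (ν j)) :
    Measure.pi ν (Set.Icc (-1 : Fin d → ℝ) 1)ᶜ = 0 := by
  have h1 : ∀ j, ∀ᵐ x ∂(Measure.pi ν), x j ∈ Set.Icc (-1 : ℝ) 1 := fun j =>
    (Measure.quasiMeasurePreserving_eval ν j).ae (p := fun y => y ∈ Set.Icc (-1 : ℝ) 1)
      (by rw [ae_iff]; exact (hν j).support)
  have h2 := ae_all_iff.2 h1
  rw [ae_iff] at h2
  convert h2 using 2
  ext x
  simp [Pi.le_def, forall_and]

theorem integrable_pi_of_continuous (hν : ∀ j, IsNevaiClass (ν j)) {g : (Fin d → ℝ) → ℝ}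
    (hg : Continuous g) : Integrable g (Measure.pi ν) :=
  hg.integrable_of_compl_null isCompact_Icc (pi_cube_compl_null hν)

theorem prodOrthoPoly_orthonormal (hν : ∀ j, IsNevaiClass (ν j)) (α β : Fin d → ℕ) :
    ∫ x, prodOrthoPoly ν α x * prodOrthoPoly ν β x ∂(Measure.pi ν) = if α = β then 1 else 0 := by
  simp_rw [prodOrthoPoly, ← Finset.prod_mul_distrib]
  rw [integral_fintype_prod_eq_prod (f := fun (j : Fin d) (x : ℝ) =>
    (orthoPolynomial (ν j) (α j)).eval x *
    (orthoPolynomial (ν j) (β j)).eval x)]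
  simp_rw [fun j => (hν j).orthonormal, Finset.prod_boole, funext_iff]
  simp

/-- The multivariate orthonormal polynomials of a product measure are products of one-variable
ones: the graded lexicographic order refines the coordinatewise one, so the change of basis from
monomials is triangular. -/
theorem multiOrthoPoly_pi (hd : 0 < d) (hν : ∀ j, IsNevaiClass (ν j)) (n : ℕ) :
    multiOrthoPoly (Measure.pi ν) n = prodOrthoPoly ν (gradedLexEnum d n) := by
  unfold multiOrthoPoly
  set τ : (Fin d → ℕ) → (Fin d → ℕ) → ℝ := fun α β =>
    ∏ j, ∫ y, y ^ α j * (orthoPolynomial (ν j) (β j)).eval y ∂(ν j) with hτ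
  refine orthonormalize_eq_of_triangular (μ := Measure.pi ν)
    (u := fun k (x : Fin d → ℝ) => ∏ j, x j ^ gradedLexEnum d k j)
    (ψ := fun n => prodOrthoPoly ν (gradedLexEnum d n))
    (fun n k => τ (gradedLexEnum d n) (gradedLexEnum d k)) (fun m n => ?_) (fun m n => ?_)
    (fun n x => ?_) (fun n => ?_) n
  · exact integrable_pi_of_continuous hν
      ((continuous_prodOrthoPoly _).mul (continuous_prodOrthoPoly _))
  · rw [prodOrthoPoly_orthonormal hν]
    simp [(gradedLexEnum_injective hd).eq_iff]
  · set α := gradedLexEnum d n with hα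
    have h1 : ∀ j, x j ^ α j = ∑ b ∈ Finset.range (α j + 1),
        (∫ y, y ^ α j * (orthoPolynomial (ν j) b).eval y ∂(ν j)) *
          (orthoPolynomial (ν j) b).eval (x j) := fun j => by
      have := (hν j).eval_eq_sum (α j + 1) (Polynomial.X ^ α j) (by
        rw [Polynomial.degree_X_pow]
        exact_mod_cast Nat.lt_succ_self _) (x j)
      simpa using this
    have h2 : ∏ j, x j ^ α j = ∑ β ∈ Fintype.piFinset fun j => Finset.range (α j + 1),
        τ α β * prodOrthoPoly ν β x := by
      simp_rw [h1]
      rw [Finset.prod_univ_sum]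
      refine Finset.sum_congr rfl fun β _ => ?_
      rw [Finset.prod_mul_distrib]
      rfl
    have h3 : ∑ k ∈ Finset.range (n + 1), τ α (gradedLexEnum d k) *
        prodOrthoPoly ν (gradedLexEnum d k) x =
        ∑ β ∈ firstIndices d (n + 1), τ α β * prodOrthoPoly ν β x := by
      rw [firstIndices, Finset.sum_image fun a _ b _ h => gradedLexEnum_injective hd h]
    rw [h2, h3]
    refine Finset.sum_subset (fun β hβ => ?_) fun β _ hβ => ?_
    · obtain ⟨k, rfl⟩ := gradedLexEnum_surjective hd β
      rw [mem_firstIndices_iff hd, Nat.lt_succ_iff]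
      refine gradedLexEnum_le_of_le hd fun j => ?_
      exact Nat.lt_succ_iff.1 (Finset.mem_range.1 (Fintype.mem_piFinset.1 hβ j))
    · rw [Fintype.mem_piFinset] at hβ
      push Not at hβ
      obtain ⟨j, hj⟩ := hβ
      rw [Finset.mem_range, not_lt] at hj
      have h0 := (hν j).integral_mul_eq_zero (n := β j) (p := Polynomial.X ^ α j) (by
        rw [Polynomial.degree_X_pow]
        exact_mod_cast hj)
      simp only [Polynomial.eval_pow, Polynomial.eval_X] at h0
      simp only [hτ]
      rw [Finset.prod_eq_zero (Finset.mem_univ j) h0, zero_mul]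
  · exact Finset.prod_pos fun j _ => (hν j).pow_coeff_pos _

theorem continuous_multiOrthoPoly_pi (hd : 0 < d) (hν : ∀ j, IsNevaiClass (ν j)) (n : ℕ) :
    Continuous (multiOrthoPoly (Measure.pi ν) n) := by
  rw [multiOrthoPoly_pi hd hν]
  exact continuous_prodOrthoPoly _

theorem multiOrthoPoly_pi_orthonormal (hd : 0 < d) (hν : ∀ j, IsNevaiClass (ν j)) (m n : ℕ) :
    ∫ x, multiOrthoPoly (Measure.pi ν) m x * multiOrthoPoly (Measure.pi ν) n x ∂(Measure.pi ν) =
      if m = n then 1 else 0 := by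
  simp_rw [multiOrthoPoly_pi hd hν]
  rw [prodOrthoPoly_orthonormal hν]
  simp [(gradedLexEnum_injective hd).eq_iff]

/-- The matrix of multiplication by `g` in the basis of products of orthonormal polynomials. -/
noncomputable def mulEntry (ν : Fin d → Measure ℝ) (g : (Fin d → ℝ) → ℝ) (α β : Fin d → ℕ) : ℝ :=
  ∫ x, g x * (prodOrthoPoly ν α x * prodOrthoPoly ν β x) ∂(Measure.pi ν)

theorem ensembleVar_pi (hd : 0 < d) (hν : ∀ j, IsNevaiClass (ν j)) (N : ℕ)
    (g : (Fin d → ℝ) → ℝ) :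
    ensembleVar (Measure.pi ν) N g = ∑ α ∈ firstIndices d N,
      (mulEntry ν (fun x => g x ^ 2) α α - ∑ β ∈ firstIndices d N, mulEntry ν g α β ^ 2) := by
  rw [ensembleVar, ← Finset.sum_sub_distrib, firstIndices,
    Finset.sum_image fun a _ b _ h => gradedLexEnum_injective hd h]
  refine Finset.sum_congr rfl fun k _ => ?_
  rw [Finset.sum_image fun a _ b _ h => gradedLexEnum_injective hd h]
  simp_rw [multiOrthoPoly_pi hd hν]
  rfl

/-- Entries of the multiplication matrix are at most the supremum of `|g|` on the cube, by
`2 |φ_α φ_β| ≤ φ_α² + φ_β²`. -/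
theorem abs_mulEntry_le (hν : ∀ j, IsNevaiClass (ν j)) {g : (Fin d → ℝ) → ℝ} (hg : Continuous g)
    {C : ℝ} (hC : ∀ x ∈ Set.Icc (-1 : Fin d → ℝ) 1, |g x| ≤ C) (α β : Fin d → ℕ) :
    |mulEntry ν g α β| ≤ C := by
  have ca := continuous_prodOrthoPoly (ν := ν) α
  have cb := continuous_prodOrthoPoly (ν := ν) β
  have h1 : ∫ x, C / 2 * (prodOrthoPoly ν α x * prodOrthoPoly ν α x +
      prodOrthoPoly ν β x * prodOrthoPoly ν β x) ∂(Measure.pi ν) = C := by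
    rw [integral_const_mul, integral_add (integrable_pi_of_continuous hν (by fun_prop))
      (integrable_pi_of_continuous hν (by fun_prop)), prodOrthoPoly_orthonormal hν,
      prodOrthoPoly_orthonormal hν, if_pos rfl, if_pos rfl]
    ring
  conv_rhs => rw [← h1]
  refine (abs_integral_le_integral_abs).trans ?_
  refine integral_mono_ae (integrable_pi_of_continuous hν (by fun_prop))
    (integrable_pi_of_continuous hν (by fun_prop)) ?_
  have hae : ∀ᵐ x ∂(Measure.pi ν), x ∈ Set.Icc (-1 : Fin d → ℝ) 1 := by
    rw [ae_iff]
    exact pi_cube_compl_null hν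
  filter_upwards [hae] with x hx
  have h2 := hC x hx
  rw [abs_mul]
  have h3 : |prodOrthoPoly ν α x * prodOrthoPoly ν β x| ≤ (prodOrthoPoly ν α x *
      prodOrthoPoly ν α x + prodOrthoPoly ν β x * prodOrthoPoly ν β x) / 2 := by
    rw [abs_le]
    constructor <;> nlinarith [sq_nonneg (prodOrthoPoly ν α x + prodOrthoPoly ν β x),
      sq_nonneg (prodOrthoPoly ν α x - prodOrthoPoly ν β x)]
  calc |g x| * |prodOrthoPoly ν α x * prodOrthoPoly ν β x| ≤ C * ((prodOrthoPoly ν α x *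
      prodOrthoPoly ν α x + prodOrthoPoly ν β x * prodOrthoPoly ν β x) / 2) := by
        have := (abs_nonneg _).trans h2
        gcongr
    _ = _ := by ring

end Product

/-! ### Linear statistics of polynomials -/

section ChebSum

variable {d : ℕ} {ν : Fin d → Measure ℝ}

/-- A polynomial of degree at most `D` in each variable, written in the Chebyshev basis. -/
noncomputable def chebSum (D : ℕ) (c : (Fin d → ℕ) → ℝ) (x : Fin d → ℝ) : ℝ :=
  ∑ m ∈ indexBox d (D + 1), c m * chebProd m x

theorem continuous_chebSum (D : ℕ) (c : (Fin d → ℕ) → ℝ) : Continuous (chebSum D c) :=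
  continuous_finsetSum _ fun m _ => continuous_const.mul (continuous_chebProd m)

variable [∀ j, IsFiniteMeasure (ν j)]

theorem mulEntry_chebSum (hν : ∀ j, IsNevaiClass (ν j)) (D : ℕ) (c : (Fin d → ℕ) → ℝ)
    (α β : Fin d → ℕ) : mulEntry ν (chebSum D c) α β =
      ∑ m ∈ indexBox d (D + 1), c m * ∏ j, chebEntry (ν j) (m j) (α j) (β j) := by
  have ca := continuous_prodOrthoPoly (ν := ν) α
  have cb := continuous_prodOrthoPoly (ν := ν) β
  simp only [mulEntry, chebSum, Finset.sum_mul, mul_assoc]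
  rw [integral_finsetSum _ fun m _ => by
    have := continuous_chebProd m
    exact integrable_pi_of_continuous hν (by fun_prop)]
  refine Finset.sum_congr rfl fun m _ => ?_
  rw [integral_const_mul]
  congr 1
  simp_rw [chebProd, prodOrthoPoly, ← Finset.prod_mul_distrib]
  exact integral_fintype_prod_eq_prod (f := fun j x => normChebyshev (m j) x *
    ((orthoPolynomial (ν j) (α j)).eval x * (orthoPolynomial (ν j) (β j)).eval x))

theorem mulEntry_chebSum_eq_zero (hν : ∀ j, IsNevaiClass (ν j)) {D : ℕ} {c : (Fin d → ℕ) → ℝ}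
    {α β : Fin d → ℕ} {j : Fin d} (h : α j + D < β j ∨ β j + D < α j) :
    mulEntry ν (chebSum D c) α β = 0 := by
  rw [mulEntry_chebSum hν]
  refine Finset.sum_eq_zero fun m hm => ?_
  have hm := mem_indexBox.1 hm j
  have h0 : chebEntry (ν j) (m j) (α j) (β j) = 0 := by
    rcases h with h | h
    · exact (hν j).chebEntry_eq_zero (by omega)
    · rw [chebEntry_comm]
      exact (hν j).chebEntry_eq_zero (by omega)
  rw [Finset.prod_eq_zero (Finset.mem_univ j) h0, mul_zero]

theorem chebSum_mul_prodOrthoPoly (hν : ∀ j, IsNevaiClass (ν j)) {D B : ℕ} {c : (Fin d → ℕ) → ℝ}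
    {α : Fin d → ℕ} (hB : ∀ j, α j + D < B) (x : Fin d → ℝ) :
    chebSum D c x * prodOrthoPoly ν α x =
      ∑ β ∈ indexBox d B, mulEntry ν (chebSum D c) α β * prodOrthoPoly ν β x := by
  simp_rw [mulEntry_chebSum hν, chebSum, Finset.sum_mul]
  rw [Finset.sum_comm]
  refine Finset.sum_congr rfl fun m hm => ?_
  simp_rw [mul_assoc]
  rw [← Finset.mul_sum]
  congr 1
  rw [chebProd, prodOrthoPoly, ← Finset.prod_mul_distrib]
  rw [Finset.prod_congr rfl fun j _ => (hν j).normChebyshev_mul_eq_sum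
    (B := B) (by have := mem_indexBox.1 hm j; have := hB j; omega) (x j), Finset.prod_univ_sum]
  refine Finset.sum_congr rfl fun β _ => ?_
  rw [Finset.prod_mul_distrib]
  rfl

/-- Parseval's identity for `g φ_α`, a finite sum as `g` is a polynomial. -/
theorem mulEntry_sq_eq_sum (hν : ∀ j, IsNevaiClass (ν j)) {D B : ℕ} {c : (Fin d → ℕ) → ℝ}
    {α : Fin d → ℕ} (hB : ∀ j, α j + D < B) :
    mulEntry ν (fun x => chebSum D c x ^ 2) α α =
      ∑ β ∈ indexBox d B, mulEntry ν (chebSum D c) α β ^ 2 := by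
  have ca := continuous_prodOrthoPoly (ν := ν) α
  have cg := continuous_chebSum (d := d) D c
  have h1 : ∀ x, chebSum D c x ^ 2 * (prodOrthoPoly ν α x * prodOrthoPoly ν α x) =
      ∑ β ∈ indexBox d B, mulEntry ν (chebSum D c) α β *
        (chebSum D c x * (prodOrthoPoly ν α x * prodOrthoPoly ν β x)) := by
    intro x
    calc _ = (chebSum D c x * prodOrthoPoly ν α x) * (chebSum D c x * prodOrthoPoly ν α x) := by
          ring
      _ = (chebSum D c x * prodOrthoPoly ν α x) *
          ∑ β ∈ indexBox d B, mulEntry ν (chebSum D c) α β * prodOrthoPoly ν β x := by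
          rw [← chebSum_mul_prodOrthoPoly hν hB x]
      _ = _ := by
          rw [Finset.mul_sum]
          exact Finset.sum_congr rfl fun β _ => by ring
  rw [mulEntry]
  simp_rw [h1]
  rw [integral_finsetSum _ fun β _ => by
    have cb := continuous_prodOrthoPoly (ν := ν) β
    exact integrable_pi_of_continuous hν (by fun_prop)]
  refine Finset.sum_congr rfl fun β _ => ?_
  rw [integral_const_mul, sq]
  rfl

/-- Integer vectors with coordinates of absolute value at most `D`. -/
noncomputable def shiftBox (d D : ℕ) : Finset (Fin d → ℤ) :=
  Fintype.piFinset fun _ => Finset.Icc (-D : ℤ) D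

theorem mem_shiftBox {D : ℕ} {δ : Fin d → ℤ} : δ ∈ shiftBox d D ↔ ∀ j, |δ j| ≤ D := by
  simp [shiftBox, abs_le]

open Classical in
/-- The variance of a polynomial linear statistic only involves matrix entries that cross the
boundary of the set of the first `N` multi-indices. -/
theorem ensembleVar_chebSum (hd : 0 < d) (hν : ∀ j, IsNevaiClass (ν j)) (N D : ℕ)
    (c : (Fin d → ℕ) → ℝ) : ensembleVar (Measure.pi ν) N (chebSum D c) =
      ∑ δ ∈ shiftBox d D, ∑ α ∈ exitSet d N δ,
        mulEntry ν (chebSum D c) α (shiftIndex α δ) ^ 2 := by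
  set J := mulEntry ν (chebSum D c) with hJ
  have hstep : ∀ α ∈ firstIndices d N, mulEntry ν (fun x => chebSum D c x ^ 2) α α -
      ∑ β ∈ firstIndices d N, J α β ^ 2 =
      ∑ δ ∈ shiftBox d D, if ShiftNonneg α δ ∧ shiftIndex α δ ∉ firstIndices d N then
        J α (shiftIndex α δ) ^ 2 else 0 := by
    intro α hα
    obtain ⟨B, hB1, hB2⟩ : ∃ B, firstIndices d N ⊆ indexBox d B ∧ ∀ j, α j + D < B := by
      refine ⟨N + ∑ j, α j + D + 1, ?_, fun j => ?_⟩
      · rw [← firstIndices_pow hd]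
        refine firstIndices_mono ?_
        calc N ≤ N + ∑ j, α j + D + 1 := by omega
          _ ≤ _ := Nat.le_self_pow hd.ne' _
      · have := Finset.single_le_sum (f := α) (fun _ _ => Nat.zero_le _) (Finset.mem_univ j)
        omega
    rw [mulEntry_sq_eq_sum hν hB2, ← Finset.sum_sdiff hB1, add_sub_cancel_right,
      ← Finset.sum_filter]
    symm
    refine Finset.sum_bij_ne_zero (fun δ _ _ => shiftIndex α δ) ?_ ?_ ?_ ?_
    · intro δ hδ _
      rw [Finset.mem_filter, mem_shiftBox] at hδ
      rw [Finset.mem_sdiff, mem_indexBox]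
      refine ⟨fun j => ?_, hδ.2.2⟩
      have := hδ.2.1.coe j
      have := hB2 j
      have := abs_le.1 (hδ.1 j)
      omega
    · intro δ hδ _ δ' hδ' _ h
      funext j
      have h1 := (Finset.mem_filter.1 hδ).2.1.coe j
      have h2 := (Finset.mem_filter.1 hδ').2.1.coe j
      rw [h] at h1
      omega
    · intro β hβ hne
      have hk : ∀ j, |(β j : ℤ) - α j| ≤ D := by
        intro j
        by_contra hcon
        refine hne ?_
        rw [mulEntry_chebSum_eq_zero hν (j := j) (by
          rw [abs_le] at hcon
          omega)]
        simp
      have h1 : ShiftNonneg α fun j => (β j : ℤ) - α j := fun j => by simp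
      have h2 : shiftIndex α (fun j => (β j : ℤ) - α j) = β := by
        funext j
        simp [shiftIndex]
      refine ⟨fun j => (β j : ℤ) - α j, ?_, ?_, h2⟩
      · rw [Finset.mem_filter, mem_shiftBox, h2]
        exact ⟨hk, h1, (Finset.mem_sdiff.1 hβ).2⟩
      · rwa [h2]
    · intro δ _ _
      rfl
  rw [ensembleVar_pi hd hν, Finset.sum_congr rfl hstep, Finset.sum_comm]
  refine Finset.sum_congr rfl fun δ _ => ?_
  rw [exitSet, Finset.sum_filter]

/-- Limits of the matrix entries of a polynomial along diagonals. -/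
noncomputable def freeMulEntry (D : ℕ) (c : (Fin d → ℕ) → ℝ) (δ : Fin d → ℤ) : ℝ :=
  ∑ m ∈ indexBox d (D + 1), c m * ∏ j, freeEntry (m j) (δ j)

theorem tendsto_mulEntry_chebSum (hν : ∀ j, IsNevaiClass (ν j)) (D : ℕ) (c : (Fin d → ℕ) → ℝ)
    (δ : Fin d → ℤ) : Tendsto (fun α : Fin d → ℕ => mulEntry ν (chebSum D c) α (shiftIndex α δ))
      atTop (𝓝 (freeMulEntry D c δ)) := by
  simp_rw [mulEntry_chebSum hν]
  refine tendsto_finsetSum _ fun m _ => Tendsto.const_mul _ ?_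
  refine tendsto_finsetProd _ fun j _ => ?_
  have hj : Tendsto (fun α : Fin d → ℕ => α j) atTop atTop :=
    tendsto_atTop.2 fun b => eventually_atTop.2 ⟨fun _ => b, fun α hα => hα j⟩
  exact ((hν j).tendsto_chebEntry (m j) (δ j)).comp hj

/-- Sums over the boundary of a bounded function that vanishes at infinity are negligible. -/
theorem tendsto_sum_exitSet_zero (hd : 0 < d) (δ : Fin d → ℤ) {h : (Fin d → ℕ) → ℝ} {C : ℝ}
    (hC : ∀ α, |h α| ≤ C) (h0 : Tendsto h atTop (𝓝 0)) :
    Tendsto (fun N : ℕ => (∑ α ∈ exitSet d N δ, h α) / (N : ℝ) ^ (1 - 1 / (d : ℝ))) atTop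
      (𝓝 0) := by
  classical
  have hC0 : 0 ≤ C := (abs_nonneg _).trans (hC 0)
  rw [Metric.tendsto_nhds]
  intro ε hε
  set S : ℝ := ∑ j, ((δ j).toNat : ℝ) with hS
  have hS0 : 0 ≤ S := Finset.sum_nonneg fun j _ => Nat.cast_nonneg _
  set ε' : ℝ := ε / (2 * (S + 1)) with hε'
  have hε'0 : 0 < ε' := by positivity
  have h1 := (Metric.tendsto_nhds.1 h0 ε' hε'0)
  obtain ⟨a, ha⟩ := eventually_atTop.1 h1
  set L := Finset.univ.sup a with hL
  have hfar : ∀ α : Fin d → ℕ, (¬ ∃ i, α i < L) → |h α| ≤ ε' := by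
    intro α hα
    push Not at hα
    have := ha α fun i => (Finset.le_sup (f := a) (Finset.mem_univ i)).trans (hα i)
    rw [dist_zero_right, Real.norm_eq_abs] at this
    exact this.le
  have hlim := ((tendsto_card_exitSet hd δ).const_mul ε').add
    ((tendsto_card_filter_exitSet hd δ L).const_mul C)
  have hlt : ε' * S + C * 0 < ε := by
    rw [mul_zero, add_zero, hε', div_mul_eq_mul_div, div_lt_iff₀ (by positivity)]
    nlinarith
  filter_upwards [hlim.eventually (gt_mem_nhds hlt)] with N hN
  have hpos : 0 ≤ (N : ℝ) ^ (1 - 1 / (d : ℝ)) := by positivity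
  rw [dist_zero_right, Real.norm_eq_abs, abs_div, abs_of_nonneg hpos]
  refine lt_of_le_of_lt ?_ hN
  rw [mul_div_assoc', mul_div_assoc', ← add_div]
  gcongr
  calc |∑ α ∈ exitSet d N δ, h α| ≤ ∑ α ∈ exitSet d N δ, |h α| :=
        Finset.abs_sum_le_sum_abs _ _
    _ ≤ ∑ α ∈ exitSet d N δ, (ε' + if ∃ i, α i < L then C else 0) := by
        refine Finset.sum_le_sum fun α _ => ?_
        split_ifs with h2
        · linarith [hC α]
        · linarith [hfar α h2]
    _ = _ := by
        rw [Finset.sum_add_distrib, Finset.sum_const, ← Finset.sum_filter, Finset.sum_const]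
        simp only [nsmul_eq_mul]
        ring

/-- The limit as a sum over translations: each of the `|exitSet|` entries is replaced by its limit. -/
theorem tendsto_ensembleVar_chebSum_aux (hd : 0 < d) (hν : ∀ j, IsNevaiClass (ν j)) (D : ℕ)
    (c : (Fin d → ℕ) → ℝ) : Tendsto (fun N : ℕ => ensembleVar (Measure.pi ν) N (chebSum D c) /
      (N : ℝ) ^ (1 - 1 / (d : ℝ))) atTop
      (𝓝 (∑ δ ∈ shiftBox d D, freeMulEntry D c δ ^ 2 * ∑ j, ((δ j).toNat : ℝ))) := by
  simp_rw [ensembleVar_chebSum hd hν, Finset.sum_div]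
  refine tendsto_finsetSum _ fun δ _ => ?_
  obtain ⟨G, hG⟩ : ∃ G, ∀ x ∈ Set.Icc (-1 : Fin d → ℝ) 1, |chebSum D c x| ≤ G := by
    obtain ⟨G, hG⟩ := isCompact_Icc.exists_bound_of_continuousOn
      (s := Set.Icc (-1 : Fin d → ℝ) 1) (continuous_chebSum D c).continuousOn
    exact ⟨G, hG⟩
  have h1 : Tendsto (fun N : ℕ => (∑ α ∈ exitSet d N δ, (mulEntry ν (chebSum D c) α
      (shiftIndex α δ) ^ 2 - freeMulEntry D c δ ^ 2)) / (N : ℝ) ^ (1 - 1 / (d : ℝ))) atTop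
      (𝓝 0) := by
    refine tendsto_sum_exitSet_zero hd δ (C := G ^ 2 + freeMulEntry D c δ ^ 2) (fun α => ?_) ?_
    · have h2 := abs_mulEntry_le hν (continuous_chebSum D c) hG α (shiftIndex α δ)
      have h3 := sq_le_sq' (abs_le.1 h2).1 (abs_le.1 h2).2
      rw [abs_le]
      constructor <;> nlinarith [sq_nonneg (mulEntry ν (chebSum D c) α (shiftIndex α δ)),
        sq_nonneg (freeMulEntry D c δ)]
    · have := ((tendsto_mulEntry_chebSum hν D c δ).pow 2).sub_const (freeMulEntry D c δ ^ 2)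
      rwa [sub_self] at this
  have h2 := h1.add ((tendsto_card_exitSet hd δ).const_mul (freeMulEntry D c δ ^ 2))
  rw [zero_add] at h2
  refine h2.congr fun N => ?_
  rw [Finset.sum_sub_distrib, Finset.sum_const, nsmul_eq_mul, ← Finset.sum_div]
  ring

omit [∀ j, IsFiniteMeasure (ν j)] in
/-- Only the Chebyshev product with `m_j = |δ_j|` has a nonzero entry at distance `δ`. -/
theorem freeMulEntry_eq {D : ℕ} (c : (Fin d → ℕ) → ℝ) {δ : Fin d → ℤ} (hδ : δ ∈ shiftBox d D) :
    freeMulEntry D c δ = c (fun j => (δ j).natAbs) * ∏ j, if δ j = 0 then 1 else (√2)⁻¹ := by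
  rw [freeMulEntry, Finset.sum_eq_single fun j => (δ j).natAbs]
  · simp [freeEntry]
  · intro m _ hne
    obtain ⟨j, hj⟩ := Function.ne_iff.1 hne
    rw [Finset.prod_eq_zero (Finset.mem_univ j) (by rw [freeEntry, if_neg (Ne.symm hj)]), mul_zero]
  · intro h
    refine absurd (mem_indexBox.2 fun j => ?_) h
    have := mem_shiftBox.1 hδ j
    rw [Int.abs_eq_natAbs] at this
    omega

/-- Summing over the `2 ^ #{j | m j ≠ 0}` integer vectors `δ` with `|δ_j| = m_j`, each of weight
`2 ^ (-#{j | m j ≠ 0})`. -/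
theorem sum_shiftBox_eq (D : ℕ) (F : (Fin d → ℕ) → ℝ) :
    ∑ δ ∈ shiftBox d D, F (fun j => (δ j).natAbs) * ∏ j, (if δ j = 0 then (1 : ℝ) else 2⁻¹) =
      ∑ m ∈ indexBox d (D + 1), F m := by
  classical
  have hmaps : ∀ δ ∈ shiftBox d D, (fun j => (δ j).natAbs) ∈ indexBox d (D + 1) := by
    intro δ hδ
    rw [mem_indexBox]
    intro j
    have := mem_shiftBox.1 hδ j
    rw [Int.abs_eq_natAbs] at this
    omega
  rw [← Finset.sum_fiberwise_of_maps_to hmaps]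
  refine Finset.sum_congr rfl fun m hm => ?_
  have hfib : (shiftBox d D).filter (fun δ => (fun j => (δ j).natAbs) = m) =
      Fintype.piFinset fun j => {(m j : ℤ), -(m j : ℤ)} := by
    ext δ
    rw [Finset.mem_filter, mem_shiftBox, Fintype.mem_piFinset, funext_iff]
    have hm' := mem_indexBox.1 hm
    constructor
    · rintro ⟨-, h⟩ j
      have := h j
      simp only [Finset.mem_insert, Finset.mem_singleton]
      omega
    · intro h
      have h' : ∀ j, (δ j).natAbs = m j := fun j => by
        have := h j
        simp only [Finset.mem_insert, Finset.mem_singleton] at this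
        omega
      refine ⟨fun j => ?_, h'⟩
      have := h' j
      have := hm' j
      rw [Int.abs_eq_natAbs]
      omega
  have h1 : ∀ δ ∈ (shiftBox d D).filter (fun δ => (fun j => (δ j).natAbs) = m),
      F (fun j => (δ j).natAbs) * ∏ j, (if δ j = 0 then (1 : ℝ) else 2⁻¹) =
      F m * ∏ j, (if δ j = 0 then (1 : ℝ) else 2⁻¹) := by
    intro δ hδ
    rw [(Finset.mem_filter.1 hδ).2]
  rw [Finset.sum_congr rfl h1, ← Finset.mul_sum, hfib,
    ← Finset.prod_univ_sum (fun j => {(m j : ℤ), -(m j : ℤ)})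
      (fun _ (z : ℤ) => if z = 0 then (1 : ℝ) else 2⁻¹)]
  rw [Finset.prod_eq_one, mul_one]
  intro j _
  by_cases h0 : m j = 0
  · simp [h0]
  · have hne : (m j : ℤ) ≠ -(m j : ℤ) := by omega
    rw [Finset.sum_pair hne]
    simp [h0]
    norm_num

/-- The variance asymptotics for polynomial test functions. -/
theorem tendsto_ensembleVar_chebSum (hd : 0 < d) (hν : ∀ j, IsNevaiClass (ν j)) (D : ℕ)
    (c : (Fin d → ℕ) → ℝ) : Tendsto (fun N : ℕ => ensembleVar (Measure.pi ν) N (chebSum D c) /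
      (N : ℝ) ^ (1 - 1 / (d : ℝ))) atTop
      (𝓝 (1 / 2 * ∑ m ∈ indexBox d (D + 1), (∑ j, (m j : ℝ)) * c m ^ 2)) := by
  have key := tendsto_ensembleVar_chebSum_aux hd hν D c
  have hterm : ∀ δ ∈ shiftBox d D, freeMulEntry D c δ ^ 2 =
      c (fun j => (δ j).natAbs) ^ 2 * ∏ j, (if δ j = 0 then (1 : ℝ) else 2⁻¹) := by
    intro δ hδ
    rw [freeMulEntry_eq c hδ, mul_pow, ← Finset.prod_pow]
    congr 1
    refine Finset.prod_congr rfl fun j _ => ?_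
    split_ifs
    · simp
    · rw [inv_pow, Real.sq_sqrt (by norm_num)]
  rw [Finset.sum_congr rfl fun δ hδ => by rw [hterm δ hδ]] at key
  -- The sum is invariant under `δ ↦ -δ`, and `δ⁺ + (-δ)⁺ = |δ|`.
  have hneg : ∑ δ ∈ shiftBox d D, (c (fun j => (δ j).natAbs) ^ 2 *
      ∏ j, (if δ j = 0 then (1 : ℝ) else 2⁻¹)) * ∑ j, ((δ j).toNat : ℝ) =
      ∑ δ ∈ shiftBox d D, (c (fun j => (δ j).natAbs) ^ 2 *
      ∏ j, (if δ j = 0 then (1 : ℝ) else 2⁻¹)) * ∑ j, ((-δ j).toNat : ℝ) := by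
    refine Finset.sum_bij' (fun δ _ => -δ) (fun δ _ => -δ) ?_ ?_ ?_ ?_ ?_
    · intro δ hδ
      rw [mem_shiftBox] at hδ ⊢
      simpa using hδ
    · intro δ hδ
      rw [mem_shiftBox] at hδ ⊢
      simpa using hδ
    · simp
    · simp
    · intro δ _
      simp
  have hsum : ∑ δ ∈ shiftBox d D, (c (fun j => (δ j).natAbs) ^ 2 *
      ∏ j, (if δ j = 0 then (1 : ℝ) else 2⁻¹)) * ∑ j, ((δ j).toNat : ℝ) =
      1 / 2 * ∑ m ∈ indexBox d (D + 1), (∑ j, (m j : ℝ)) * c m ^ 2 := by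
    rw [← sum_shiftBox_eq D fun m => (∑ j, (m j : ℝ)) * c m ^ 2]
    have h2 : ∑ δ ∈ shiftBox d D, ((∑ j, ((δ j).natAbs : ℝ)) * c (fun j => (δ j).natAbs) ^ 2) *
        ∏ j, (if δ j = 0 then (1 : ℝ) else 2⁻¹) =
        ∑ δ ∈ shiftBox d D, (c (fun j => (δ j).natAbs) ^ 2 *
          ∏ j, (if δ j = 0 then (1 : ℝ) else 2⁻¹)) * ∑ j, ((δ j).toNat : ℝ) +
        ∑ δ ∈ shiftBox d D, (c (fun j => (δ j).natAbs) ^ 2 *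
          ∏ j, (if δ j = 0 then (1 : ℝ) else 2⁻¹)) * ∑ j, ((-δ j).toNat : ℝ) := by
      rw [← Finset.sum_add_distrib]
      refine Finset.sum_congr rfl fun δ _ => ?_
      have h3 : ∑ j, ((δ j).natAbs : ℝ) = ∑ j, ((δ j).toNat : ℝ) + ∑ j, ((-δ j).toNat : ℝ) := by
        rw [← Finset.sum_add_distrib]
        refine Finset.sum_congr rfl fun j _ => ?_
        have : (δ j).natAbs = (δ j).toNat + (-δ j).toNat := by omega
        exact_mod_cast this
      rw [h3]
      ring
    rw [h2, ← hneg]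
    ring
  rwa [hsum] at key

end ChebSum

/-! ### Approximation of continuously differentiable functions by Bernstein polynomials -/

section Bernstein

/-- Values of the Bernstein polynomials. -/
noncomputable def bernVal (n k : ℕ) (t : ℝ) : ℝ := (bernsteinPolynomial ℝ n k).eval t

theorem bernVal_nonneg (n k : ℕ) {t : ℝ} (ht : t ∈ Set.Icc (0 : ℝ) 1) : 0 ≤ bernVal n k t := by
  have h0 := ht.1
  have h1 : 0 ≤ 1 - t := by linarith [ht.2]
  simp only [bernVal, bernsteinPolynomial, Polynomial.eval_mul, Polynomial.eval_natCast,
    Polynomial.eval_pow, Polynomial.eval_X, Polynomial.eval_sub, Polynomial.eval_one]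
  positivity

theorem bernVal_eq_zero {n k : ℕ} (h : n < k) (t : ℝ) : bernVal n k t = 0 := by
  rw [bernVal, bernsteinPolynomial.eq_zero_of_lt ℝ h, Polynomial.eval_zero]

theorem sum_bernVal (n : ℕ) (t : ℝ) : ∑ k ∈ Finset.range (n + 1), bernVal n k t = 1 := by
  have := congrArg (Polynomial.eval t) (bernsteinPolynomial.sum ℝ n)
  simpa [Polynomial.eval_finsetSum, bernVal] using this

theorem sum_sq_mul_bernVal (n : ℕ) (t : ℝ) :
    ∑ k ∈ Finset.range (n + 1), (n * t - k) ^ 2 * bernVal n k t = n * t * (1 - t) := by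
  have := congrArg (Polynomial.eval t) (bernsteinPolynomial.variance ℝ n)
  simpa [Polynomial.eval_finsetSum, bernVal] using this

theorem hasDerivAt_bernVal (n k : ℕ) (t : ℝ) : HasDerivAt (bernVal (n + 1) k)
    ((n + 1 : ℝ) * ((if k = 0 then 0 else bernVal n (k - 1) t) - bernVal n k t)) t := by
  have h := (bernsteinPolynomial ℝ (n + 1) k).hasDerivAt t
  have he : (Polynomial.derivative (bernsteinPolynomial ℝ (n + 1) k)).eval t =
      (n + 1 : ℝ) * ((if k = 0 then 0 else bernVal n (k - 1) t) - bernVal n k t) := by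
    cases k with
    | zero =>
      rw [bernsteinPolynomial.derivative_zero]
      simp only [bernVal, if_true, zero_sub, Nat.add_sub_cancel, Polynomial.eval_mul,
        Polynomial.eval_neg, Polynomial.eval_natCast]
      push_cast
      simp
      ring
    | succ k =>
      rw [bernsteinPolynomial.derivative_succ]
      simp [bernVal]
  rw [he] at h
  exact h

/-- The nodes `k / N`. -/
noncomputable def bernNode {d : ℕ} (N : ℕ) (k : Fin d → ℕ) : Fin d → ℝ := fun j => (k j : ℝ) / N

/-- Multivariate Bernstein approximation on `[0, 1]^d`. -/
noncomputable def bernApprox {d : ℕ} (N : ℕ) (f : (Fin d → ℝ) → ℝ) (x : Fin d → ℝ) : ℝ :=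
  ∑ k ∈ indexBox d (N + 1), (∏ j, bernVal N (k j) (x j)) * f (bernNode N k)

variable {d : ℕ}

/-- Summation by parts in the `j`-th coordinate: the substitution `k_j ↦ k_j + 1`. -/
theorem sum_shift_coord (M : ℕ) (j : Fin d) (w : ℕ → ℝ) (hw : w M = 0)
    (H : (Fin d → ℕ) → ℝ) :
    ∑ k ∈ indexBox d (M + 1), (if k j = 0 then 0 else w (k j - 1)) *
      H (Function.update k j (k j - 1)) = ∑ k ∈ indexBox d (M + 1), w (k j) * H k := by
  refine Finset.sum_bij_ne_zero (fun k _ _ => Function.update k j (k j - 1)) ?_ ?_ ?_ ?_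
  · intro k hk _
    rw [mem_indexBox] at hk ⊢
    intro i
    by_cases h : i = j
    · subst h
      have := hk i
      simp only [Function.update_self]
      omega
    · simpa [h] using hk i
  · intro k _ hk0 k' _ hk0' h
    have h1 : k j ≠ 0 := fun h => hk0 (by simp [h])
    have h2 : k' j ≠ 0 := fun h => hk0' (by simp [h])
    funext i
    have h3 := congrFun h i
    by_cases hi : i = j
    · subst hi
      simp only [Function.update_self] at h3
      omega
    · simpa [hi] using h3
  · intro k hk hk0
    have h1 : k j ≠ M := fun h => hk0 (by simp [h, hw])
    refine ⟨Function.update k j (k j + 1), ?_, ?_, ?_⟩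
    · rw [mem_indexBox] at hk ⊢
      intro i
      by_cases h : i = j
      · subst h
        have := hk i
        simp only [Function.update_self]
        omega
      · simpa [h] using hk i
    · simpa using hk0
    · simp
  · intro k _ hk0
    have h1 : k j ≠ 0 := fun h => hk0 (by simp [h])
    simp [h1]

/-- Weights appearing in the partial derivative of a Bernstein approximation: the `j`-th variable
has lost one degree. -/
noncomputable def bernWeight (n : ℕ) (j : Fin d) (x : Fin d → ℝ) (k : Fin d → ℕ) : ℝ :=
  ∏ i, bernVal (if i = j then n else n + 1) (k i) (x i)

theorem bernWeight_eq (n : ℕ) (j : Fin d) (x : Fin d → ℝ) (k : Fin d → ℕ) :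
    bernWeight n j x k =
      bernVal n (k j) (x j) * ∏ i ∈ Finset.univ.erase j, bernVal (n + 1) (k i) (x i) := by
  rw [bernWeight, ← Finset.mul_prod_erase _ _ (Finset.mem_univ j), if_pos rfl]
  congr 1
  refine Finset.prod_congr rfl fun i hi => ?_
  rw [if_neg (Finset.ne_of_mem_erase hi)]

/-- The partial derivative of a Bernstein approximation is the Bernstein-type average of the
difference quotients of `f` between neighbouring nodes. -/
theorem hasDerivAt_bernApprox (n : ℕ) (f : (Fin d → ℝ) → ℝ) (x : Fin d → ℝ) (j : Fin d) (t : ℝ) :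
    HasDerivAt (fun t => bernApprox (n + 1) f (Function.update x j t))
      (∑ k ∈ indexBox d (n + 2), bernWeight n j (Function.update x j t) k * ((n + 1 : ℝ) *
        (f (bernNode (n + 1) (Function.update k j (k j + 1))) - f (bernNode (n + 1) k)))) t := by
  set R : (Fin d → ℕ) → ℝ := fun k => ∏ i ∈ Finset.univ.erase j, bernVal (n + 1) (k i) (x i) with hR
  have hupd : ∀ (N : ℕ) (t : ℝ) (k : Fin d → ℕ),
      ∏ i ∈ Finset.univ.erase j, bernVal N (k i) (Function.update x j t i) =
      ∏ i ∈ Finset.univ.erase j, bernVal N (k i) (x i) := fun N t k =>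
    Finset.prod_congr rfl fun i hi => by rw [Function.update_of_ne (Finset.ne_of_mem_erase hi)]
  have hfun : ∀ t, bernApprox (n + 1) f (Function.update x j t) =
      ∑ k ∈ indexBox d (n + 2), bernVal (n + 1) (k j) t * (R k * f (bernNode (n + 1) k)) := by
    intro t
    refine Finset.sum_congr rfl fun k _ => ?_
    rw [← Finset.mul_prod_erase _ _ (Finset.mem_univ j), hupd, Function.update_self, mul_assoc]
  have hder : HasDerivAt (fun t => bernApprox (n + 1) f (Function.update x j t))
      (∑ k ∈ indexBox d (n + 2), ((n + 1 : ℝ) * ((if k j = 0 then 0 else bernVal n (k j - 1) t) -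
        bernVal n (k j) t)) * (R k * f (bernNode (n + 1) k))) t := by
    simp_rw [hfun]
    exact HasDerivAt.fun_sum fun k _ => (hasDerivAt_bernVal n (k j) t).mul_const _
  convert hder using 1
  have hshift := sum_shift_coord (n + 1) j (fun k => bernVal n k t)
    (bernVal_eq_zero (Nat.lt_succ_self n) t)
    (fun k => R k * f (bernNode (n + 1) (Function.update k j (k j + 1))))
  have hsh : ∀ k : Fin d → ℕ, (if k j = 0 then 0 else bernVal n (k j - 1) t) *
      (R (Function.update k j (k j - 1)) * f (bernNode (n + 1) (Function.update
        (Function.update k j (k j - 1)) j (Function.update k j (k j - 1) j + 1)))) =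
      (if k j = 0 then 0 else bernVal n (k j - 1) t) * (R k * f (bernNode (n + 1) k)) := by
    intro k
    by_cases h : k j = 0
    · simp [h]
    · have h1 : R (Function.update k j (k j - 1)) = R k := Finset.prod_congr rfl fun i hi => by
        rw [Function.update_of_ne (Finset.ne_of_mem_erase hi)]
      have h2 : Function.update (Function.update k j (k j - 1)) j
          (Function.update k j (k j - 1) j + 1) = k := by
        rw [Function.update_self, Function.update_idem, Nat.sub_add_cancel (Nat.pos_of_ne_zero h),
          Function.update_eq_self]
      rw [h1, h2]
  simp_rw [hsh] at hshift
  simp_rw [bernWeight_eq, hupd, Function.update_self]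
  have e1 : ∀ k : Fin d → ℕ, ((n + 1 : ℝ) * ((if k j = 0 then 0 else bernVal n (k j - 1) t) -
        bernVal n (k j) t)) * (R k * f (bernNode (n + 1) k)) =
      (n + 1 : ℝ) * ((if k j = 0 then 0 else bernVal n (k j - 1) t) *
        (R k * f (bernNode (n + 1) k))) -
      (n + 1 : ℝ) * (bernVal n (k j) t * (R k * f (bernNode (n + 1) k))) := fun k => by ring
  simp_rw [e1]
  rw [Finset.sum_sub_distrib, ← Finset.mul_sum, hshift, Finset.mul_sum, ← Finset.sum_sub_distrib]
  exact Finset.sum_congr rfl fun k _ => by simp only [hR]; ring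

theorem bernWeight_nonneg (n : ℕ) (j : Fin d) {x : Fin d → ℝ}
    (hx : x ∈ Set.Icc (0 : Fin d → ℝ) 1) (k : Fin d → ℕ) : 0 ≤ bernWeight n j x k :=
  Finset.prod_nonneg fun i _ => bernVal_nonneg _ _ ⟨hx.1 i, hx.2 i⟩

theorem sum_range_bernVal_ite (n : ℕ) (i j : Fin d) (t : ℝ) :
    ∑ k ∈ Finset.range (n + 2), bernVal (if i = j then n else n + 1) k t = 1 := by
  split_ifs with h
  · rw [Finset.sum_range_succ, sum_bernVal, bernVal_eq_zero (Nat.lt_succ_self n), add_zero]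
  · exact sum_bernVal (n + 1) t

theorem sum_bernWeight (n : ℕ) (j : Fin d) (x : Fin d → ℝ) :
    ∑ k ∈ indexBox d (n + 2), bernWeight n j x k = 1 := by
  rw [indexBox]
  simp_rw [bernWeight]
  rw [← Finset.prod_univ_sum (fun _ : Fin d => Finset.range (n + 2))
    (fun i k => bernVal (if i = j then n else n + 1) k (x i))]
  exact Finset.prod_eq_one fun i _ => sum_range_bernVal_ite n i j (x i)

theorem sum_sq_bernVal_le (n : ℕ) (i j : Fin d) {t : ℝ} (ht : t ∈ Set.Icc (0 : ℝ) 1) :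
    ∑ k ∈ Finset.range (n + 2), bernVal (if i = j then n else n + 1) k t *
      ((k : ℝ) / (n + 1 : ℕ) - t) ^ 2 ≤ 2 / (n + 1) := by
  have h0 := ht.1
  have h1 : 0 ≤ 1 - t := by linarith [ht.2]
  have hn : (0 : ℝ) < n + 1 := by positivity
  split_ifs with h
  · rw [Finset.sum_range_succ, bernVal_eq_zero (Nat.lt_succ_self n), zero_mul, add_zero]
    calc _ ≤ ∑ k ∈ Finset.range (n + 1), (2 / ((n : ℝ) + 1) ^ 2) *
          ((n * t - k) ^ 2 * bernVal n k t + bernVal n k t) := by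
          refine Finset.sum_le_sum fun k _ => ?_
          have hb := bernVal_nonneg n k ht
          have h2 : ((k : ℝ) / (n + 1 : ℕ) - t) ^ 2 ≤
              (2 / ((n : ℝ) + 1) ^ 2) * ((n * t - k) ^ 2 + 1) := by
            rw [div_mul_eq_mul_div, le_div_iff₀ (by positivity), ← mul_pow]
            push_cast
            have h3 : ((k : ℝ) / (n + 1) - t) * (n + 1) = -(n * t - k) - t := by
              field_simp
              ring
            rw [h3]
            nlinarith [sq_nonneg ((n * t - k) - t), mul_nonneg h0 h1]
          calc _ ≤ bernVal n k t * ((2 / ((n : ℝ) + 1) ^ 2) * ((n * t - k) ^ 2 + 1)) := by gcongr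
            _ = _ := by ring
      _ = (2 / ((n : ℝ) + 1) ^ 2) * (n * t * (1 - t) + 1) := by
          rw [← Finset.mul_sum, Finset.sum_add_distrib, sum_sq_mul_bernVal, sum_bernVal]
      _ ≤ (2 / ((n : ℝ) + 1) ^ 2) * (n + 1) := by
          have : t * (1 - t) ≤ 1 := by nlinarith
          have : n * (t * (1 - t)) ≤ n * 1 := by gcongr
          gcongr
          linarith
      _ = _ := by field_simp
  · calc _ = ∑ k ∈ Finset.range (n + 2), (1 / ((n : ℝ) + 1) ^ 2) *
          ((((n + 1 : ℕ) : ℝ) * t - k) ^ 2 * bernVal (n + 1) k t) := by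
          refine Finset.sum_congr rfl fun k _ => ?_
          push_cast
          field_simp
          ring
      _ = (1 / ((n : ℝ) + 1) ^ 2) * (((n + 1 : ℕ) : ℝ) * t * (1 - t)) := by
          rw [← Finset.mul_sum, sum_sq_mul_bernVal]
      _ = t * (1 - t) / (n + 1) := by
          push_cast
          field_simp
      _ ≤ 2 / (n + 1) := by
          gcongr
          nlinarith

/-- The weights, a probability on the nodes, concentrate near `x`. -/
theorem sum_bernWeight_sq_le (n : ℕ) (j i : Fin d) {x : Fin d → ℝ}
    (hx : x ∈ Set.Icc (0 : Fin d → ℝ) 1) :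
    ∑ k ∈ indexBox d (n + 2), bernWeight n j x k * (bernNode (n + 1) k i - x i) ^ 2 ≤
      2 / (n + 1) := by
  have h1 : ∀ k : Fin d → ℕ, bernWeight n j x k * (bernNode (n + 1) k i - x i) ^ 2 =
      ∏ l, (bernVal (if l = j then n else n + 1) (k l) (x l) *
        if l = i then ((k l : ℝ) / (n + 1 : ℕ) - x l) ^ 2 else 1) := by
    intro k
    rw [Finset.prod_mul_distrib, bernWeight]
    simp [bernNode]
  simp_rw [h1]
  rw [indexBox, ← Finset.prod_univ_sum (fun _ : Fin d => Finset.range (n + 2))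
    (fun l k => bernVal (if l = j then n else n + 1) k (x l) *
        if l = i then ((k : ℝ) / (n + 1 : ℕ) - x l) ^ 2 else 1),
    ← Finset.mul_prod_erase _ _ (Finset.mem_univ i), Finset.prod_eq_one, mul_one]
  · simpa using sum_sq_bernVal_le n i j ⟨hx.1 i, hx.2 i⟩
  · intro l hl
    simp only [if_neg (Finset.ne_of_mem_erase hl), mul_one]
    exact sum_range_bernVal_ite n l j (x l)

theorem bernNode_mem {N : ℕ} (hN : 0 < N) {k : Fin d → ℕ} (hk : k ∈ indexBox d (N + 1)) :
    bernNode N k ∈ Set.Icc (0 : Fin d → ℝ) 1 := by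
  rw [mem_indexBox] at hk
  constructor
  · intro j
    simp only [bernNode, Pi.zero_apply]
    positivity
  · intro j
    simp only [bernNode, Pi.one_apply]
    rw [div_le_one (by positivity)]
    exact_mod_cast Nat.lt_succ_iff.1 (hk j)

/-- Uniform continuity on a compact set in a form suited to averaging: the quadratic term is
controlled by the variance of the weights. -/
theorem IsCompact.exists_dist_le_add_sq {E F : Type*} [PseudoMetricSpace E]
    [SeminormedAddCommGroup F]
    {Q : Set E} (hQ : IsCompact Q) {L : E → F} (hL : ContinuousOn L Q) {ε : ℝ} (hε : 0 < ε) :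
    ∃ K, 0 ≤ K ∧ ∀ y ∈ Q, ∀ z ∈ Q, ‖L z - L y‖ ≤ ε + K * dist z y ^ 2 := by
  obtain ⟨δ, hδ, hδ'⟩ := Metric.uniformContinuousOn_iff.1
    (hQ.uniformContinuousOn_of_continuous hL) ε hε
  obtain ⟨M, hM⟩ := hQ.exists_bound_of_continuousOn hL
  refine ⟨2 * |M| / δ ^ 2, by positivity, fun y hy z hz => ?_⟩
  by_cases h : dist z y < δ
  · have := hδ' z hz y hy h
    rw [dist_eq_norm] at this
    have h2 : 0 ≤ 2 * |M| / δ ^ 2 * dist z y ^ 2 := by positivity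
    linarith
  · rw [not_lt] at h
    have h1 : ‖L z - L y‖ ≤ 2 * |M| := by
      have h2 := norm_sub_le (L z) (L y)
      have h3 := hM z hz
      have h4 := hM y hy
      have h5 := le_abs_self M
      linarith
    have h2 : 2 * |M| ≤ 2 * |M| / δ ^ 2 * dist z y ^ 2 := by
      rw [div_mul_eq_mul_div, le_div_iff₀ (by positivity)]
      gcongr
    linarith

theorem norm_sq_le_sum_sq (v : Fin d → ℝ) : ‖v‖ ^ 2 ≤ ∑ i, v i ^ 2 := by
  have h0 : 0 ≤ ∑ i, v i ^ 2 := Finset.sum_nonneg fun i _ => sq_nonneg _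
  have h1 : ‖v‖ ≤ √(∑ i, v i ^ 2) := by
    refine (pi_norm_le_iff_of_nonneg (Real.sqrt_nonneg _)).2 fun i => ?_
    refine Real.le_sqrt_of_sq_le ?_
    rw [Real.norm_eq_abs, sq_abs]
    exact Finset.single_le_sum (f := fun i => v i ^ 2) (fun i _ => sq_nonneg _) (Finset.mem_univ i)
  calc ‖v‖ ^ 2 ≤ √(∑ i, v i ^ 2) ^ 2 := by gcongr
    _ = _ := Real.sq_sqrt h0

/-- Mean value inequality along the segment from `u` to `v`, compared with the differential at a
third point `y`. -/
theorem norm_increment_le {f : (Fin d → ℝ) → ℝ} {Q : Set (Fin d → ℝ)} (hQ : Convex ℝ Q)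
    {L : (Fin d → ℝ) → (Fin d → ℝ) →L[ℝ] ℝ} (hf : ∀ x ∈ Q, HasFDerivWithinAt f (L x) Q x)
    {ε K : ℝ} (hK : 0 ≤ K)
    (hLK : ∀ y ∈ Q, ∀ z ∈ Q, ‖L z - L y‖ ≤ ε + K * dist z y ^ 2)
    {u v y : Fin d → ℝ} (hu : u ∈ Q) (hv : v ∈ Q) (hy : y ∈ Q) :
    |f v - f u - L y (v - u)| ≤ (ε + K * (2 * ‖u - y‖ ^ 2 + 2 * ‖v - u‖ ^ 2)) * ‖v - u‖ := by
  have hseg : segment ℝ u v ⊆ Q := hQ.segment_subset hu hv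
  refine (convex_segment u v).norm_image_sub_le_of_norm_hasFDerivWithin_le'
    (fun z hz => (hf z (hseg hz)).mono hseg) (fun z hz => ?_) (left_mem_segment ℝ u v)
    (right_mem_segment ℝ u v)
  refine (hLK y hy z (hseg hz)).trans ?_
  have h1 : dist z y ≤ ‖u - y‖ + ‖v - u‖ := by
    obtain ⟨a, b, ha, hb, hab, rfl⟩ := hz
    have h2 : a • u + b • v - y = (u - y) + b • (v - u) := by
      have : a = 1 - b := by linarith
      rw [this]
      module
    rw [dist_eq_norm, h2]
    refine (norm_add_le _ _).trans ?_
    rw [norm_smul, Real.norm_eq_abs, abs_of_nonneg hb]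
    have : b * ‖v - u‖ ≤ 1 * ‖v - u‖ := by gcongr; linarith
    linarith
  have h3 : dist z y ^ 2 ≤ 2 * ‖u - y‖ ^ 2 + 2 * ‖v - u‖ ^ 2 := by
    have := pow_le_pow_left₀ dist_nonneg h1 2
    nlinarith [sq_nonneg (‖u - y‖ - ‖v - u‖)]
  gcongr

/-- The partial derivatives of the Bernstein approximations converge uniformly. -/
theorem abs_deriv_bernApprox_sub_le {f : (Fin d → ℝ) → ℝ}
    {L : (Fin d → ℝ) → (Fin d → ℝ) →L[ℝ] ℝ}
    (hf : ∀ x ∈ Set.Icc (0 : Fin d → ℝ) 1, HasFDerivWithinAt f (L x) (Set.Icc 0 1) x)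
    {ε K : ℝ} (hK : 0 ≤ K)
    (hLK : ∀ y ∈ Set.Icc (0 : Fin d → ℝ) 1, ∀ z ∈ Set.Icc (0 : Fin d → ℝ) 1,
      ‖L z - L y‖ ≤ ε + K * dist z y ^ 2)
    (n : ℕ) {y : Fin d → ℝ} (hy : y ∈ Set.Icc (0 : Fin d → ℝ) 1) (j : Fin d) :
    |∑ k ∈ indexBox d (n + 2), bernWeight n j y k * ((n + 1 : ℝ) *
        (f (bernNode (n + 1) (Function.update k j (k j + 1))) - f (bernNode (n + 1) k))) -
      L y (Pi.single j 1)| ≤ ε + K * (4 * d + 2) / (n + 1) := by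
  have hn : (0 : ℝ) < n + 1 := by positivity
  have h1 : ∀ k ∈ indexBox d (n + 2), |bernWeight n j y k * ((n + 1 : ℝ) *
        (f (bernNode (n + 1) (Function.update k j (k j + 1))) - f (bernNode (n + 1) k)) -
        L y (Pi.single j 1))| ≤ bernWeight n j y k *
        (ε + K * (2 * ∑ i, (bernNode (n + 1) k i - y i) ^ 2 + 2 / (n + 1) ^ 2)) := by
    intro k hk
    have hw := bernWeight_nonneg n j hy k
    -- For `k_j = n + 1` the next node is outside the cube, but the weight vanishes.
    by_cases hkj : k j = n + 1
    · have : bernWeight n j y k = 0 := by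
        rw [bernWeight_eq, hkj, bernVal_eq_zero (Nat.lt_succ_self n), zero_mul]
      simp [this]
    · have hk' : Function.update k j (k j + 1) ∈ indexBox d (n + 2) := by
        rw [mem_indexBox] at hk ⊢
        intro i
        by_cases h : i = j
        · subst h
          have := hk i
          simp only [Function.update_self]
          omega
        · simpa [h] using hk i
      set u := bernNode (n + 1) k with hu
      set v := bernNode (n + 1) (Function.update k j (k j + 1)) with hv
      have huv : v - u = (1 / (n + 1 : ℝ)) • Pi.single j (1 : ℝ) := by
        funext i
        by_cases h : i = j
        · subst h
          simp only [hu, hv, bernNode, Pi.sub_apply, Function.update_self, Pi.smul_apply,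
            Pi.single_eq_same, smul_eq_mul]
          push_cast
          field_simp
          ring
        · simp [hu, hv, bernNode, h]
      have hnorm : ‖v - u‖ = 1 / (n + 1 : ℝ) := by
        rw [huv, norm_smul, Pi.norm_single, norm_one, mul_one, Real.norm_eq_abs,
          abs_of_pos (by positivity)]
      have h2 := norm_increment_le (convex_Icc _ _) hf hK hLK (bernNode_mem n.succ_pos hk)
        (bernNode_mem n.succ_pos hk') hy
      rw [← hu, ← hv, hnorm, huv, map_smul, smul_eq_mul] at h2
      rw [abs_mul, abs_of_nonneg hw]
      refine mul_le_mul_of_nonneg_left ?_ hw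
      have h3 : (n + 1 : ℝ) * (f v - f u) - L y (Pi.single j 1) =
          (n + 1 : ℝ) * (f v - f u - 1 / (n + 1 : ℝ) * L y (Pi.single j 1)) := by
        field_simp
      rw [h3, abs_mul, abs_of_pos hn]
      calc _ ≤ (n + 1 : ℝ) * ((ε + K * (2 * ‖u - y‖ ^ 2 + 2 * (1 / (n + 1 : ℝ)) ^ 2)) *
            (1 / (n + 1 : ℝ))) := by gcongr
        _ = ε + K * (2 * ‖u - y‖ ^ 2 + 2 / (n + 1) ^ 2) := by field_simp
        _ ≤ _ := by
          have := norm_sq_le_sum_sq (u - y)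
          simp only [Pi.sub_apply] at this
          gcongr
  have h2 : ∑ k ∈ indexBox d (n + 2), bernWeight n j y k * ((n + 1 : ℝ) *
        (f (bernNode (n + 1) (Function.update k j (k j + 1))) - f (bernNode (n + 1) k))) -
      L y (Pi.single j 1) = ∑ k ∈ indexBox d (n + 2), bernWeight n j y k * ((n + 1 : ℝ) *
        (f (bernNode (n + 1) (Function.update k j (k j + 1))) - f (bernNode (n + 1) k)) -
        L y (Pi.single j 1)) := by
    simp_rw [mul_sub (bernWeight n j y _)]
    rw [Finset.sum_sub_distrib, ← Finset.sum_mul, sum_bernWeight, one_mul]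
  rw [h2]
  refine (Finset.abs_sum_le_sum_abs _ _).trans ((Finset.sum_le_sum h1).trans ?_)
  have h3 : ∀ k : Fin d → ℕ, bernWeight n j y k *
        (ε + K * (2 * ∑ i, (bernNode (n + 1) k i - y i) ^ 2 + 2 / (n + 1) ^ 2)) =
      (ε + K * (2 / (n + 1) ^ 2)) * bernWeight n j y k +
        2 * K * ∑ i, bernWeight n j y k * (bernNode (n + 1) k i - y i) ^ 2 := by
    intro k
    rw [← Finset.mul_sum]
    ring
  simp_rw [h3]
  rw [Finset.sum_add_distrib, ← Finset.mul_sum, sum_bernWeight, ← Finset.mul_sum, Finset.sum_comm]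
  have h4 : ∑ i, ∑ k ∈ indexBox d (n + 2), bernWeight n j y k *
      (bernNode (n + 1) k i - y i) ^ 2 ≤ d * (2 / (n + 1)) := by
    refine (Finset.sum_le_sum fun i _ => sum_bernWeight_sq_le n j i hy).trans ?_
    simp
  have h5 : (2 : ℝ) / (n + 1) ^ 2 ≤ 2 / (n + 1) := by
    gcongr
    nlinarith
  calc _ ≤ (ε + K * (2 / (n + 1))) * 1 + 2 * K * (d * (2 / (n + 1))) := by gcongr
    _ = _ := by ring

/-- A function on a cube with small partial derivatives is Lipschitz with a small constant: change
the coordinates of `y` into those of `x` one at a time. -/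
theorem abs_sub_le_of_abs_partial_deriv_le {e : (Fin d → ℝ) → ℝ} {e' : Fin d → (Fin d → ℝ) → ℝ}
    {C : ℝ} (he : ∀ x ∈ Set.Icc (0 : Fin d → ℝ) 1, ∀ j, ∀ t ∈ Set.Icc (0 : ℝ) 1,
      HasDerivWithinAt (fun t => e (Function.update x j t)) (e' j (Function.update x j t))
        (Set.Icc 0 1) t)
    (hC : ∀ x ∈ Set.Icc (0 : Fin d → ℝ) 1, ∀ j, |e' j x| ≤ C)
    {x y : Fin d → ℝ} (hx : x ∈ Set.Icc (0 : Fin d → ℝ) 1) (hy : y ∈ Set.Icc (0 : Fin d → ℝ) 1) :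
    |e x - e y| ≤ C * ∑ j, |x j - y j| := by
  classical
  have hmem : ∀ s : Finset (Fin d), s.piecewise x y ∈ Set.Icc (0 : Fin d → ℝ) 1 := by
    intro s
    constructor <;> intro i <;> by_cases h : i ∈ s
    · simpa [h] using hx.1 i
    · simpa [h] using hy.1 i
    · simpa [h] using hx.2 i
    · simpa [h] using hy.2 i
  have key : ∀ s : Finset (Fin d), |e (s.piecewise x y) - e y| ≤ C * ∑ j ∈ s, |x j - y j| := by
    intro s
    induction s using Finset.induction_on with
    | empty => simp
    | insert j s hj ih =>
      rw [Finset.sum_insert hj, mul_add, Finset.piecewise_insert]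
      refine (abs_sub_le _ (e (s.piecewise x y)) _).trans (add_le_add ?_ ih)
      have h1 : s.piecewise x y = Function.update (s.piecewise x y) j (y j) := by
        rw [eq_comm, Function.update_eq_self_iff]
        simp [hj]
      conv_lhs => rw [h1]
      rw [Function.update_idem]
      refine (convex_Icc (0 : ℝ) 1).norm_image_sub_le_of_norm_hasDerivWithin_le
        (f := fun t => e (Function.update (s.piecewise x y) j t))
        (f' := fun t => e' j (Function.update (s.piecewise x y) j t))
        (fun t ht => he _ (hmem s) j t ht) (fun t ht => hC _ ?_ j) ⟨hy.1 j, hy.2 j⟩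
        ⟨hx.1 j, hx.2 j⟩
      constructor <;> intro i <;> by_cases h : i = j
      · subst h; simpa using ht.1
      · simpa [h] using (hmem s).1 i
      · subst h; simpa using ht.2
      · simpa [h] using (hmem s).2 i
  have := key Finset.univ
  rwa [Finset.piecewise_univ] at this

theorem bernApprox_zero {N : ℕ} (f : (Fin d → ℝ) → ℝ) :
    bernApprox N f 0 = f 0 := by
  rw [bernApprox, Finset.sum_eq_single 0]
  · have : bernNode N (0 : Fin d → ℕ) = 0 := by
      funext j
      simp [bernNode]
    simp [bernVal, bernsteinPolynomial.eval_at_0, this]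
  · intro k _ hk
    obtain ⟨j, hj⟩ := Function.ne_iff.1 hk
    rw [Finset.prod_eq_zero (Finset.mem_univ j), zero_mul]
    simp only [bernVal, Pi.zero_apply, bernsteinPolynomial.eval_at_0]
    exact if_neg hj
  · intro h
    exact absurd (mem_indexBox.2 fun j => Nat.succ_pos _) h

/-- Bernstein approximations converge in the Lipschitz seminorm. -/
theorem exists_bernApprox {f : (Fin d → ℝ) → ℝ}
    (hf : ContDiffOn ℝ 1 f (Set.Icc (0 : Fin d → ℝ) 1)) {ε : ℝ} (hε : 0 < ε) :
    ∃ n : ℕ, ∀ x ∈ Set.Icc (0 : Fin d → ℝ) 1, ∀ y ∈ Set.Icc (0 : Fin d → ℝ) 1,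
      |(f x - bernApprox (n + 1) f x) - (f y - bernApprox (n + 1) f y)| ≤
        ε * ∑ j, |x j - y j| := by
  have huniq : UniqueDiffOn ℝ (Set.Icc (0 : Fin d → ℝ) 1) := by
    rw [← Set.pi_univ_Icc]
    exact UniqueDiffOn.univ_pi fun _ => uniqueDiffOn_Icc_zero_one
  have hder : ∀ x ∈ Set.Icc (0 : Fin d → ℝ) 1,
      HasFDerivWithinAt f (fderivWithin ℝ f (Set.Icc 0 1) x) (Set.Icc 0 1) x := fun x hx =>
    (hf.differentiableOn one_ne_zero x hx).hasFDerivWithinAt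
  obtain ⟨K, hK, hLK⟩ := isCompact_Icc.exists_dist_le_add_sq
    (hf.continuousOn_fderivWithin huniq le_rfl) (half_pos hε)
  have hlim : Tendsto (fun n : ℕ => K * (4 * d + 2) / ((n : ℝ) + 1)) atTop (𝓝 0) :=
    tendsto_const_div_atTop_nhds_zero_nat (K * (4 * d + 2)) |>.comp (tendsto_add_atTop_nat 1)
      |>.congr fun n => by simp
  obtain ⟨n, hn⟩ := (hlim.eventually (gt_mem_nhds (half_pos hε))).exists
  refine ⟨n, fun x hx y hy => ?_⟩
  refine abs_sub_le_of_abs_partial_deriv_le (e := fun x => f x - bernApprox (n + 1) f x)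
    (e' := fun j x => fderivWithin ℝ f (Set.Icc 0 1) x (Pi.single j 1) -
      ∑ k ∈ indexBox d (n + 2), bernWeight n j x k * ((n + 1 : ℝ) *
        (f (bernNode (n + 1) (Function.update k j (k j + 1))) - f (bernNode (n + 1) k))))
    ?_ ?_ hx hy
  · intro x hx j t ht
    refine HasDerivWithinAt.sub ?_ (hasDerivAt_bernApprox n f x j t).hasDerivWithinAt
    have hmaps : Set.MapsTo (fun t => Function.update x j t) (Set.Icc (0 : ℝ) 1)
        (Set.Icc (0 : Fin d → ℝ) 1) := by
      intro t ht
      constructor <;> intro i <;> by_cases h : i = j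
      · subst h; simpa using ht.1
      · simpa [h] using hx.1 i
      · subst h; simpa using ht.2
      · simpa [h] using hx.2 i
    exact (hder _ (hmaps ht)).comp_hasDerivWithinAt t (hasDerivAt_update x j t).hasDerivWithinAt
      hmaps
  · intro x hx j
    rw [abs_sub_comm]
    refine (abs_deriv_bernApprox_sub_le hder hK hLK n hx j).trans ?_
    linarith

/-- After the change of variables from `[0, 1]` to `[-1, 1]`, Bernstein approximations are expanded in
the Chebyshev basis. -/
theorem bernApprox_eq_chebSum (N : ℕ) (f : (Fin d → ℝ) → ℝ) :
    ∃ c : (Fin d → ℕ) → ℝ, ∀ x, bernApprox N f (fun j => (x j + 1) / 2) = chebSum N c x := by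
  have hq : ∀ k, ∃ a : ℕ → ℝ, ∀ t, bernVal N k ((t + 1) / 2) =
      ∑ m ∈ Finset.range (N + 1), a m * normChebyshev m t := by
    intro k
    set q : Polynomial ℝ := (bernsteinPolynomial ℝ N k).comp
      (Polynomial.C (1 / 2) * Polynomial.X + Polynomial.C (1 / 2)) with hqdef
    have hdeg : q.degree < ((N + 1 : ℕ) : WithBot ℕ) := by
      refine lt_of_le_of_lt Polynomial.degree_le_natDegree ?_
      have h1 : q.natDegree ≤ N := by
        rw [hqdef]
        refine Polynomial.natDegree_comp_le.trans ?_
        have h2 : (Polynomial.C (1 / 2 : ℝ) * Polynomial.X + Polynomial.C (1 / 2)).natDegree ≤ 1 :=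
          Polynomial.natDegree_linear_le
        have h3 : (bernsteinPolynomial ℝ N k).natDegree ≤ N := by
          by_cases h : N < k
          · rw [bernsteinPolynomial.eq_zero_of_lt ℝ h]; simp
          · rw [bernsteinPolynomial]
            have h4 : (1 - Polynomial.X : Polynomial ℝ).natDegree ≤ 1 :=
              (Polynomial.natDegree_sub_le _ _).trans (by simp)
            have h5 : ((1 - Polynomial.X : Polynomial ℝ) ^ (N - k)).natDegree ≤ N - k :=
              Polynomial.natDegree_pow_le.trans (by nlinarith)
            have h6 : ((N.choose k : Polynomial ℝ) * Polynomial.X ^ k).natDegree ≤ k := by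
              refine Polynomial.natDegree_mul_le.trans ?_
              rw [Polynomial.natDegree_natCast, Polynomial.natDegree_X_pow, zero_add]
            refine Polynomial.natDegree_mul_le.trans ?_
            omega
        calc _ ≤ N * 1 := Nat.mul_le_mul h3 h2
          _ = N := mul_one N
      exact_mod_cast Nat.lt_succ_iff.2 h1
    obtain ⟨a, ha⟩ := Polynomial.exists_eq_sum_of_degree degree_chebPolynomial (N + 1) q hdeg
    refine ⟨a, fun t => ?_⟩
    have h1 := congrArg (Polynomial.eval t) ha
    rw [hqdef, Polynomial.eval_comp, Polynomial.eval_finsetSum] at h1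
    simp only [Polynomial.eval_add, Polynomial.eval_mul, Polynomial.eval_C, Polynomial.eval_X,
      ← normChebyshev_eq_eval] at h1
    rw [← h1, bernVal]
    congr 1
    ring
  choose a ha using hq
  refine ⟨fun m => ∑ k ∈ indexBox d (N + 1), (∏ j, a (k j) (m j)) * f (bernNode N k), fun x => ?_⟩
  simp_rw [bernApprox, chebSum, ha, Finset.sum_mul]
  rw [Finset.sum_comm]
  refine Finset.sum_congr rfl fun k _ => ?_
  rw [Finset.prod_univ_sum, Finset.sum_mul]
  refine Finset.sum_congr rfl fun m _ => ?_
  rw [Finset.prod_mul_distrib, chebProd]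
  ring

/-- Polynomials are dense in `C¹([-1, 1]^d)` for the Lipschitz seminorm. The approximation is exact
at the corner `-1`, so that it is also uniform. -/
theorem exists_chebSum_approx {f : (Fin d → ℝ) → ℝ}
    (hf : ContDiffOn ℝ 1 f (Set.Icc (-1 : Fin d → ℝ) 1)) {ε : ℝ} (hε : 0 < ε) :
    ∃ (D : ℕ) (c : (Fin d → ℕ) → ℝ), chebSum D c (-1) = f (-1) ∧
      ∀ x ∈ Set.Icc (-1 : Fin d → ℝ) 1, ∀ y ∈ Set.Icc (-1 : Fin d → ℝ) 1,
        |(f x - chebSum D c x) - (f y - chebSum D c y)| ≤ ε * ∑ j, |x j - y j| := by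
  set g : (Fin d → ℝ) → ℝ := fun u => f (fun j => 2 * u j - 1) with hg
  have hgc : ContDiffOn ℝ 1 g (Set.Icc (0 : Fin d → ℝ) 1) := by
    refine hf.comp (t := Set.Icc (-1 : Fin d → ℝ) 1) (f := fun u : Fin d → ℝ => fun j => 2 * u j - 1)
      (by fun_prop) ?_
    intro u hu
    constructor <;> intro j
    · have := hu.1 j
      simp only [Pi.zero_apply, Pi.neg_apply, Pi.one_apply] at this ⊢
      linarith
    · have := hu.2 j
      simp only [Pi.one_apply] at this ⊢
      linarith
  obtain ⟨n, hn⟩ := exists_bernApprox hgc hε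
  obtain ⟨c, hc⟩ := bernApprox_eq_chebSum (n + 1) g
  have hmem : ∀ x ∈ Set.Icc (-1 : Fin d → ℝ) 1, (fun j => (x j + 1) / 2) ∈
      Set.Icc (0 : Fin d → ℝ) 1 := by
    intro x hx
    constructor <;> intro j
    · have := hx.1 j
      simp only [Pi.zero_apply, Pi.neg_apply, Pi.one_apply] at this ⊢
      linarith
    · have := hx.2 j
      simp only [Pi.one_apply] at this ⊢
      linarith
  have hgf : ∀ x : Fin d → ℝ, g (fun j => (x j + 1) / 2) = f x := by
    intro x
    simp only [hg]
    congr 1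
    funext j
    ring
  refine ⟨n + 1, c, ?_, fun x hx y hy => ?_⟩
  · rw [← hc, ← hgf]
    have : (fun j => ((-1 : Fin d → ℝ) j + 1) / 2) = 0 := by
      funext j
      simp
    rw [this, bernApprox_zero]
  · have h1 := hn _ (hmem x hx) _ (hmem y hy)
    rw [hc, hc, hgf, hgf] at h1
    refine h1.trans (mul_le_mul_of_nonneg_left (Finset.sum_le_sum fun j _ => ?_) hε.le)
    have : (x j + 1) / 2 - (y j + 1) / 2 = (x j - y j) / 2 := by ring
    rw [this, abs_div, abs_two]
    linarith [abs_nonneg (x j - y j)]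

end Bernstein

/-! ### Chebyshev coefficients -/

section Coefficients

open Polynomial.Chebyshev

theorem integrableOn_mul_arcsine {g : ℝ → ℝ} (hg : Continuous g) :
    Integrable (fun x => g x * (1 / (Real.pi * √(1 - x ^ 2))))
      (volume.restrict (Set.Icc (-1 : ℝ) 1)) := by
  have h1 := (intervalIntegrable_sqrt_one_sub_sq_inv.continuousOn_mul
    (hg.continuousOn (s := Set.uIcc (-1) 1))).const_mul (Real.pi)⁻¹
  rw [intervalIntegrable_iff_integrableOn_Icc_of_le (by norm_num)] at h1
  refine h1.congr (Eventually.of_forall fun x => ?_)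
  simp only [Real.sqrt_inv, one_div, mul_inv]
  ring

/-- Comparison with Mathlib's measure `measureT`, whose density has no factor `1 / π`. -/
theorem setIntegral_mul_arcsine (g : ℝ → ℝ) :
    ∫ x in Set.Icc (-1 : ℝ) 1, g x * (1 / (Real.pi * √(1 - x ^ 2))) =
      (Real.pi)⁻¹ * ∫ x, g x ∂measureT := by
  rw [integral_measureT, intervalIntegral.integral_of_le (by norm_num),
    ← integral_Icc_eq_integral_Ioc, ← integral_const_mul]
  refine integral_congr_ae (Eventually.of_forall fun x => ?_)
  simp only [Real.sqrt_inv, one_div, mul_inv]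
  ring

theorem normChebyshev_orthonormal (m k : ℕ) :
    ∫ x in Set.Icc (-1 : ℝ) 1, normChebyshev m x * normChebyshev k x *
      (1 / (Real.pi * √(1 - x ^ 2))) = if m = k then 1 else 0 := by
  rw [setIntegral_mul_arcsine]
  have h1 : ∀ m x, normChebyshev m x =
      (if m = 0 then 1 else √2) * (T ℝ (m : ℤ)).eval x := by
    intro m x
    rw [normChebyshev_eq_eval, chebPolynomial, Polynomial.eval_mul, Polynomial.eval_C]
  have h2 : ∀ x, normChebyshev m x * normChebyshev k x =
      ((if m = 0 then 1 else √2) * (if k = 0 then 1 else √2)) *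
        ((T ℝ (m : ℤ)).eval x * (T ℝ (k : ℤ)).eval x) := by
    intro x
    rw [h1, h1]
    ring
  simp_rw [h2]
  rw [integral_const_mul]
  by_cases hmk : m = k
  · subst hmk
    rw [if_pos rfl]
    rcases Nat.eq_zero_or_pos m with rfl | hm
    · have := integral_eval_T_real_mul_self_measureT_zero
      simp only [Nat.cast_zero] at this ⊢
      rw [this]
      simp [Real.pi_ne_zero]
    · rw [integral_T_real_mul_self_measureT_of_ne_zero hm.ne', if_neg hm.ne',
        Real.mul_self_sqrt (by norm_num)]
      field_simp
  · rw [if_neg hmk, integral_eval_T_real_mul_eval_T_real_measureT_of_ne hmk]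
    simp

variable {d : ℕ}

theorem restrict_cube : (volume : Measure (Fin d → ℝ)).restrict (Set.Icc (-1) 1) =
    Measure.pi fun _ => volume.restrict (Set.Icc (-1 : ℝ) 1) := by
  rw [volume_pi, ← Measure.restrict_pi_pi, Set.pi_univ_Icc]
  rfl

/-- The density against which the Chebyshev coefficient is computed. -/
noncomputable def chebDensity (k : Fin d → ℕ) (x : Fin d → ℝ) : ℝ :=
  ∏ j, (normChebyshev (k j) (x j) * (1 / (Real.pi * √(1 - x j ^ 2))))

theorem integrableOn_chebDensity (k : Fin d → ℕ) :
    IntegrableOn (chebDensity k) (Set.Icc (-1 : Fin d → ℝ) 1) := by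
  rw [IntegrableOn, restrict_cube]
  exact Integrable.fintype_prod (f := fun j (x : ℝ) =>
    normChebyshev (k j) x * (1 / (Real.pi * √(1 - x ^ 2))))
    fun j => integrableOn_mul_arcsine (continuous_normChebyshev (k j))

theorem integrableOn_mul_chebDensity {g : (Fin d → ℝ) → ℝ} (hg : Continuous g) (k : Fin d → ℕ) :
    IntegrableOn (fun x => g x * chebDensity k x) (Set.Icc (-1 : Fin d → ℝ) 1) :=
  (integrableOn_chebDensity k).continuousOn_mul hg.continuousOn isCompact_Icc

theorem chebCoeff_sub {f g : (Fin d → ℝ) → ℝ} (hf : Continuous f) (hg : Continuous g)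
    (k : Fin d → ℕ) : chebCoeff (fun x => f x - g x) k = chebCoeff f k - chebCoeff g k := by
  have := integral_sub (integrableOn_mul_chebDensity hf k) (integrableOn_mul_chebDensity hg k)
  rw [chebCoeff, chebCoeff, chebCoeff]
  simp only [chebDensity] at this
  rw [← this]
  simp_rw [sub_mul]

theorem abs_chebCoeff_le {g : (Fin d → ℝ) → ℝ} (hg : Continuous g) {C : ℝ}
    (hC : ∀ x ∈ Set.Icc (-1 : Fin d → ℝ) 1, |g x| ≤ C) (k : Fin d → ℕ) :
    |chebCoeff g k| ≤ C * ∫ x in Set.Icc (-1 : Fin d → ℝ) 1, |chebDensity k x| := by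
  rw [← integral_const_mul]
  refine abs_integral_le_integral_abs.trans ?_
  refine setIntegral_mono_on (integrableOn_mul_chebDensity hg k).abs
    ((integrableOn_chebDensity k).abs.const_mul C) measurableSet_Icc fun x hx => ?_
  have h1 := hC x hx
  change |g x * chebDensity k x| ≤ _
  rw [abs_mul]
  gcongr

theorem chebCoeff_chebSum (D : ℕ) (c : (Fin d → ℕ) → ℝ) (k : Fin d → ℕ) :
    chebCoeff (chebSum D c) k = if k ∈ indexBox d (D + 1) then c k else 0 := by
  have h1 : ∀ m : Fin d → ℕ, ∫ x in Set.Icc (-1 : Fin d → ℝ) 1, chebProd m x * chebDensity k x =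
      if m = k then 1 else 0 := by
    intro m
    rw [restrict_cube]
    simp_rw [chebProd, chebDensity, ← Finset.prod_mul_distrib, ← mul_assoc]
    rw [integral_fintype_prod_eq_prod (f := fun (j : Fin d) (x : ℝ) =>
      normChebyshev (m j) x * normChebyshev (k j) x * (1 / (Real.pi * √(1 - x ^ 2))))]
    simp_rw [normChebyshev_orthonormal, Finset.prod_boole, funext_iff]
    simp
  change ∫ x in Set.Icc (-1 : Fin d → ℝ) 1, chebSum D c x * chebDensity k x = _
  simp_rw [chebSum, Finset.sum_mul, mul_assoc]
  rw [integral_finsetSum _ fun m _ =>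
    (integrableOn_mul_chebDensity (continuous_chebProd m) k).const_mul _]
  simp_rw [integral_const_mul, h1]
  simp

theorem chebSum_sub (D D' : ℕ) (c c' : (Fin d → ℕ) → ℝ) :
    ∃ c'', ∀ x, chebSum D c x - chebSum D' c' x = chebSum (D + D') c'' x := by
  classical
  have h1 : ∀ (D E : ℕ) (c : (Fin d → ℕ) → ℝ) (x : Fin d → ℝ), D ≤ E → chebSum D c x =
      chebSum E (fun m => if m ∈ indexBox d (D + 1) then c m else 0) x := by
    intro D E c x hDE
    have hsub : indexBox d (D + 1) ⊆ indexBox d (E + 1) := fun m hm => by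
      rw [mem_indexBox] at hm ⊢
      exact fun j => (hm j).trans_le (by omega)
    simp_rw [chebSum, ite_mul, zero_mul]
    rw [← Finset.sum_filter, Finset.filter_mem_eq_inter, Finset.inter_eq_right.2 hsub]
  refine ⟨fun m => (if m ∈ indexBox d (D + 1) then c m else 0) -
    (if m ∈ indexBox d (D' + 1) then c' m else 0), fun x => ?_⟩
  rw [h1 D (D + D') c x (by omega), h1 D' (D + D') c' x (by omega), chebSum, chebSum, chebSum,
    ← Finset.sum_sub_distrib]
  exact Finset.sum_congr rfl fun m _ => by ring

/-- Coordinate functions are multiples of a Chebyshev polynomial. -/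
theorem exists_chebSum_coord (j : Fin d) :
    ∃ c : (Fin d → ℕ) → ℝ, chebSum 1 c = fun x => x j := by
  classical
  refine ⟨fun m => if m = Pi.single j 1 then (√2)⁻¹ else 0, funext fun x => ?_⟩
  have hmem : (Pi.single j 1 : Fin d → ℕ) ∈ indexBox d (1 + 1) := by
    rw [mem_indexBox]
    intro i
    by_cases h : i = j
    · subst h; simp
    · simp [h]
  simp_rw [chebSum, ite_mul, zero_mul]
  rw [Finset.sum_ite_eq', if_pos hmem, chebProd, Finset.prod_eq_single j]
  · simp [normChebyshev]
  · intro i _ hi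
    simp [hi, normChebyshev]
  · simp

/-- A partial sum of the limiting variance. -/
noncomputable def partialVar (F : Finset (Fin d → ℕ)) (g : (Fin d → ℝ) → ℝ) : ℝ :=
  1 / 2 * ∑ m ∈ F, (∑ j, (m j : ℝ)) * chebCoeff g m ^ 2

theorem partialVar_chebSum_le (F : Finset (Fin d → ℕ)) (D : ℕ) (c : (Fin d → ℕ) → ℝ) :
    partialVar F (chebSum D c) ≤
      1 / 2 * ∑ m ∈ indexBox d (D + 1), (∑ j, (m j : ℝ)) * c m ^ 2 := by
  classical
  rw [partialVar]
  gcongr 1 / 2 * ?_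
  calc _ = ∑ m ∈ F, if m ∈ indexBox d (D + 1) then (∑ j, (m j : ℝ)) * c m ^ 2 else 0 := by
        refine Finset.sum_congr rfl fun m _ => ?_
        rw [chebCoeff_chebSum]
        split_ifs <;> simp
    _ ≤ _ := by
        rw [← Finset.sum_filter]
        refine Finset.sum_le_sum_of_subset_of_nonneg
          (fun m hm => (Finset.mem_filter.1 hm).2) fun m _ _ => by positivity

theorem partialVar_chebSum_eq {F : Finset (Fin d → ℕ)} {D : ℕ} (hF : indexBox d (D + 1) ⊆ F)
    (c : (Fin d → ℕ) → ℝ) : partialVar F (chebSum D c) =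
      1 / 2 * ∑ m ∈ indexBox d (D + 1), (∑ j, (m j : ℝ)) * c m ^ 2 := by
  rw [partialVar, ← Finset.sum_subset hF]
  · congr 1
    refine Finset.sum_congr rfl fun m hm => ?_
    rw [chebCoeff_chebSum, if_pos hm]
  · intro m _ hm
    rw [chebCoeff_chebSum, if_neg hm]
    simp

/-- The elementary inequality `|a² - b²| ≤ η b² + (1 + 1/η) (a - b)²` behind all approximation
arguments for quadratic forms. -/
theorem abs_sq_sub_sq_le (a b : ℝ) {η : ℝ} (hη : 0 < η) :
    |a ^ 2 - b ^ 2| ≤ η * b ^ 2 + (1 + 1 / η) * (a - b) ^ 2 := by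
  have h1 : |2 * b * (a - b)| ≤ η * b ^ 2 + 1 / η * (a - b) ^ 2 := by
    have h2 : η * b ^ 2 + 1 / η * (a - b) ^ 2 - 2 * b * (a - b) =
        1 / η * (η * b - (a - b)) ^ 2 := by
      field_simp
      ring
    have h3 : η * b ^ 2 + 1 / η * (a - b) ^ 2 + 2 * b * (a - b) =
        1 / η * (η * b + (a - b)) ^ 2 := by
      field_simp
      ring
    have h4 : 0 ≤ 1 / η * (η * b - (a - b)) ^ 2 := by positivity
    have h5 : 0 ≤ 1 / η * (η * b + (a - b)) ^ 2 := by positivity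
    rw [abs_le]
    constructor <;> linarith
  have h2 : a ^ 2 - b ^ 2 = (a - b) ^ 2 + 2 * b * (a - b) := by ring
  rw [h2]
  refine (abs_add_le _ _).trans ?_
  rw [abs_of_nonneg (sq_nonneg (a - b))]
  linarith

theorem abs_partialVar_sub_le {f g : (Fin d → ℝ) → ℝ} (hf : Continuous f) (hg : Continuous g)
    {η : ℝ} (hη : 0 < η) (F : Finset (Fin d → ℕ)) :
    |partialVar F f - partialVar F g| ≤
      η * partialVar F g + (1 + 1 / η) * partialVar F (fun x => f x - g x) := by
  simp_rw [partialVar, chebCoeff_sub hf hg, Finset.mul_sum]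
  rw [← Finset.sum_sub_distrib, ← Finset.sum_add_distrib]
  refine (Finset.abs_sum_le_sum_abs _ _).trans (Finset.sum_le_sum fun m _ => ?_)
  have h1 := abs_sq_sub_sq_le (chebCoeff f m) (chebCoeff g m) hη
  have h2 : (0 : ℝ) ≤ 1 / 2 * ∑ j, (m j : ℝ) := by positivity
  calc _ = |1 / 2 * ∑ j, (m j : ℝ)| * |chebCoeff f m ^ 2 - chebCoeff g m ^ 2| := by
        rw [← abs_mul]
        congr 1
        ring
    _ ≤ (1 / 2 * ∑ j, (m j : ℝ)) * (η * chebCoeff g m ^ 2 +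
        (1 + 1 / η) * (chebCoeff f m - chebCoeff g m) ^ 2) := by
        rw [abs_of_nonneg h2]
        gcongr
    _ = _ := by ring

end Coefficients

/-! ### The variance as a Dirichlet-type form -/

section DirichletForm

variable {d : ℕ} {ν : Fin d → Measure ℝ} [∀ j, IsFiniteMeasure (ν j)]

theorem integrable_prod_of_continuous (hν : ∀ j, IsNevaiClass (ν j))
    {G : (Fin d → ℝ) × (Fin d → ℝ) → ℝ} (hG : Continuous G) :
    Integrable G ((Measure.pi ν).prod (Measure.pi ν)) := by
  refine hG.integrable_of_compl_null (K := Set.Icc (-1) 1 ×ˢ Set.Icc (-1) 1)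
    (isCompact_Icc.prod isCompact_Icc) ?_
  rw [Set.compl_prod_eq_union]
  refine measure_union_null ?_ ?_ <;> rw [Measure.prod_prod, pi_cube_compl_null hν] <;> simp

theorem ae_prod_mem_cube (hν : ∀ j, IsNevaiClass (ν j)) :
    ∀ᵐ z ∂((Measure.pi ν).prod (Measure.pi ν)),
      z.1 ∈ Set.Icc (-1 : Fin d → ℝ) 1 ∧ z.2 ∈ Set.Icc (-1 : Fin d → ℝ) 1 := by
  have h : ((Measure.pi ν).prod (Measure.pi ν))
      (Set.Icc (-1 : Fin d → ℝ) 1 ×ˢ Set.Icc (-1 : Fin d → ℝ) 1)ᶜ = 0 := by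
    rw [Set.compl_prod_eq_union]
    refine measure_union_null ?_ ?_ <;> rw [Measure.prod_prod, pi_cube_compl_null hν] <;> simp
  rw [ae_iff]
  exact h

theorem continuous_cdKernel_pi (hd : 0 < d) (hν : ∀ j, IsNevaiClass (ν j)) (N : ℕ) :
    Continuous fun z : (Fin d → ℝ) × (Fin d → ℝ) => cdKernel (Measure.pi ν) N z.1 z.2 := by
  have hφ := continuous_multiOrthoPoly_pi (ν := ν) hd hν
  exact continuous_finsetSum _ fun k _ =>
    ((hφ k).comp continuous_fst).mul ((hφ k).comp continuous_snd)

/-- `Var = ½ ∬ (g(x) - g(y))² K_N(x, y)² μ(dx) μ(dy)`. -/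
theorem integral_sq_sub_mul_cdKernel (hd : 0 < d) (hν : ∀ j, IsNevaiClass (ν j)) (N : ℕ)
    {g : (Fin d → ℝ) → ℝ} (hg : Continuous g) :
    ∫ z, (g z.1 - g z.2) ^ 2 * cdKernel (Measure.pi ν) N z.1 z.2 ^ 2
      ∂((Measure.pi ν).prod (Measure.pi ν)) = 2 * ensembleVar (Measure.pi ν) N g := by
  set μ := Measure.pi ν with hμ
  set φ := multiOrthoPoly μ with hφdef
  have hφ : ∀ k, Continuous (φ k) := continuous_multiOrthoPoly_pi hd hν
  have h1 : ∀ z : (Fin d → ℝ) × (Fin d → ℝ), (g z.1 - g z.2) ^ 2 * cdKernel μ N z.1 z.2 ^ 2 =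
      ∑ k ∈ Finset.range N, ∑ l ∈ Finset.range N,
        ((g z.1 ^ 2 * (φ k z.1 * φ l z.1)) * (φ k z.2 * φ l z.2) +
        (φ k z.1 * φ l z.1) * (g z.2 ^ 2 * (φ k z.2 * φ l z.2)) -
        2 * ((g z.1 * (φ k z.1 * φ l z.1)) * (g z.2 * (φ k z.2 * φ l z.2)))) := by
    intro z
    rw [cdKernel, sq (∑ k ∈ _, _), Finset.sum_mul_sum, Finset.mul_sum]
    refine Finset.sum_congr rfl fun k _ => ?_
    rw [Finset.mul_sum]
    exact Finset.sum_congr rfl fun l _ => by ring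
  have hc1 : ∀ k, Continuous fun z : (Fin d → ℝ) × (Fin d → ℝ) => φ k z.1 := fun k =>
    (hφ k).comp continuous_fst
  have hc2 : ∀ k, Continuous fun z : (Fin d → ℝ) × (Fin d → ℝ) => φ k z.2 := fun k =>
    (hφ k).comp continuous_snd
  have hi : ∀ {G : (Fin d → ℝ) × (Fin d → ℝ) → ℝ}, Continuous G → Integrable G (μ.prod μ) :=
    fun hG => integrable_prod_of_continuous hν hG
  have hterm : ∀ k l, ∫ z, ((g z.1 ^ 2 * (φ k z.1 * φ l z.1)) * (φ k z.2 * φ l z.2) +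
        (φ k z.1 * φ l z.1) * (g z.2 ^ 2 * (φ k z.2 * φ l z.2)) -
        2 * ((g z.1 * (φ k z.1 * φ l z.1)) * (g z.2 * (φ k z.2 * φ l z.2)))) ∂(μ.prod μ) =
      2 * ((∫ x, g x ^ 2 * (φ k x * φ l x) ∂μ) * (if k = l then 1 else 0) -
        (∫ x, g x * (φ k x * φ l x) ∂μ) ^ 2) := by
    intro k l
    have a1 := hc1 k
    have a2 := hc1 l
    have a3 := hc2 k
    have a4 := hc2 l
    rw [integral_sub (hi (by fun_prop)) (hi (by fun_prop)), integral_add (hi (by fun_prop))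
      (hi (by fun_prop)), integral_const_mul,
      integral_prod_mul (fun x => g x ^ 2 * (φ k x * φ l x)) (fun y => φ k y * φ l y),
      integral_prod_mul (fun x => φ k x * φ l x) (fun y => g y ^ 2 * (φ k y * φ l y)),
      integral_prod_mul (fun x => g x * (φ k x * φ l x)) (fun y => g y * (φ k y * φ l y)),
      multiOrthoPoly_pi_orthonormal hd hν]
    ring
  simp_rw [h1]
  have hci : ∀ k l, Integrable (fun z : (Fin d → ℝ) × (Fin d → ℝ) =>
      ((g z.1 ^ 2 * (φ k z.1 * φ l z.1)) * (φ k z.2 * φ l z.2) +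
        (φ k z.1 * φ l z.1) * (g z.2 ^ 2 * (φ k z.2 * φ l z.2)) -
        2 * ((g z.1 * (φ k z.1 * φ l z.1)) * (g z.2 * (φ k z.2 * φ l z.2))))) (μ.prod μ) := by
    intro k l
    have a1 := hc1 k
    have a2 := hc1 l
    have a3 := hc2 k
    have a4 := hc2 l
    exact hi (by fun_prop)
  rw [integral_finsetSum _ fun k _ => integrable_finsetSum _ fun l _ => hci k l]
  simp_rw [integral_finsetSum (Finset.range N) fun l _ => hci _ l, hterm]
  rw [ensembleVar, mul_sub, Finset.mul_sum, Finset.mul_sum, ← Finset.sum_sub_distrib]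
  refine Finset.sum_congr rfl fun k hk => ?_
  rw [← Finset.mul_sum, Finset.sum_sub_distrib, mul_sub]
  congr 2
  simp [Finset.mem_range.1 hk, hφdef]

theorem integrable_sq_sub_mul_cdKernel (hd : 0 < d) (hν : ∀ j, IsNevaiClass (ν j)) (N : ℕ)
    {g : (Fin d → ℝ) → ℝ} (hg : Continuous g) :
    Integrable (fun z : (Fin d → ℝ) × (Fin d → ℝ) =>
      (g z.1 - g z.2) ^ 2 * cdKernel (Measure.pi ν) N z.1 z.2 ^ 2)
      ((Measure.pi ν).prod (Measure.pi ν)) := by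
  have := continuous_cdKernel_pi hd hν N
  exact integrable_prod_of_continuous hν (by fun_prop)

/-- The variance of a Lipschitz linear statistic is controlled by those of the coordinates. -/
theorem ensembleVar_le_of_lipschitz (hd : 0 < d) (hν : ∀ j, IsNevaiClass (ν j)) (N : ℕ)
    {g : (Fin d → ℝ) → ℝ} (hg : Continuous g) {L : ℝ}
    (hL : ∀ x ∈ Set.Icc (-1 : Fin d → ℝ) 1, ∀ y ∈ Set.Icc (-1 : Fin d → ℝ) 1,
      |g x - g y| ≤ L * ∑ j, |x j - y j|) :
    ensembleVar (Measure.pi ν) N g ≤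
      L ^ 2 * (d * ∑ j, ensembleVar (Measure.pi ν) N (fun x => x j)) := by
  have hj : ∀ j : Fin d, Continuous fun x : Fin d → ℝ => x j := fun j => continuous_apply j
  have h1 : ∫ z, (g z.1 - g z.2) ^ 2 * cdKernel (Measure.pi ν) N z.1 z.2 ^ 2
      ∂((Measure.pi ν).prod (Measure.pi ν)) ≤
      ∫ z, (L ^ 2 * d) * ∑ j, (z.1 j - z.2 j) ^ 2 * cdKernel (Measure.pi ν) N z.1 z.2 ^ 2
      ∂((Measure.pi ν).prod (Measure.pi ν)) := by
    refine integral_mono_ae (integrable_sq_sub_mul_cdKernel hd hν N hg)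
      ((integrable_finsetSum _ fun j _ =>
        integrable_sq_sub_mul_cdKernel hd hν N (hj j)).const_mul _) ?_
    filter_upwards [ae_prod_mem_cube hν] with z hz
    have h2 := hL z.1 hz.1 z.2 hz.2
    have h3 : (g z.1 - g z.2) ^ 2 ≤ L ^ 2 * d * ∑ j, (z.1 j - z.2 j) ^ 2 := by
      calc (g z.1 - g z.2) ^ 2 = |g z.1 - g z.2| ^ 2 := (sq_abs _).symm
        _ ≤ (L * ∑ j, |z.1 j - z.2 j|) ^ 2 := by gcongr
        _ = L ^ 2 * (∑ j, |z.1 j - z.2 j|) ^ 2 := by ring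
        _ ≤ L ^ 2 * (d * ∑ j, |z.1 j - z.2 j| ^ 2) := by
            have := sq_sum_le_card_mul_sum_sq (s := Finset.univ) (f := fun j => |z.1 j - z.2 j|)
            rw [Finset.card_univ, Fintype.card_fin] at this
            gcongr
        _ = _ := by simp_rw [sq_abs]; ring
    rw [← Finset.sum_mul, ← mul_assoc]
    gcongr
  rw [integral_sq_sub_mul_cdKernel hd hν N hg, integral_const_mul, integral_finsetSum _ fun j _ =>
    integrable_sq_sub_mul_cdKernel hd hν N (hj j)] at h1
  simp_rw [fun j => integral_sq_sub_mul_cdKernel hd hν N (hj j)] at h1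
  rw [← Finset.mul_sum] at h1
  linarith

/-- Continuity of the variance as a quadratic form in the test function. -/
theorem abs_ensembleVar_sub_le (hd : 0 < d) (hν : ∀ j, IsNevaiClass (ν j)) (N : ℕ)
    {f g : (Fin d → ℝ) → ℝ} (hf : Continuous f) (hg : Continuous g) {η : ℝ} (hη : 0 < η) :
    |ensembleVar (Measure.pi ν) N f - ensembleVar (Measure.pi ν) N g| ≤
      η * ensembleVar (Measure.pi ν) N g +
        (1 + 1 / η) * ensembleVar (Measure.pi ν) N (fun x => f x - g x) := by
  have hfg : Continuous fun x => f x - g x := hf.sub hg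
  have If := integrable_sq_sub_mul_cdKernel hd hν N hf
  have Ig := integrable_sq_sub_mul_cdKernel hd hν N hg
  have Ifg := integrable_sq_sub_mul_cdKernel hd hν N hfg
  have h1 : |∫ z, ((f z.1 - f z.2) ^ 2 * cdKernel (Measure.pi ν) N z.1 z.2 ^ 2 -
      (g z.1 - g z.2) ^ 2 * cdKernel (Measure.pi ν) N z.1 z.2 ^ 2)
      ∂((Measure.pi ν).prod (Measure.pi ν))| ≤
      ∫ z, (η * ((g z.1 - g z.2) ^ 2 * cdKernel (Measure.pi ν) N z.1 z.2 ^ 2) + (1 + 1 / η) *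
        (((f z.1 - g z.1) - (f z.2 - g z.2)) ^ 2 * cdKernel (Measure.pi ν) N z.1 z.2 ^ 2))
      ∂((Measure.pi ν).prod (Measure.pi ν)) := by
    refine abs_integral_le_integral_abs.trans ?_
    refine integral_mono (If.sub Ig).abs ((Ig.const_mul _).add (Ifg.const_mul _)) fun z => ?_
    have h2 := abs_sq_sub_sq_le (f z.1 - f z.2) (g z.1 - g z.2) hη
    have h3 : (f z.1 - f z.2) - (g z.1 - g z.2) = (f z.1 - g z.1) - (f z.2 - g z.2) := by ring
    rw [h3] at h2
    beta_reduce
    rw [← sub_mul, abs_mul, abs_of_nonneg (sq_nonneg (cdKernel (Measure.pi ν) N z.1 z.2))]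
    calc _ ≤ (η * (g z.1 - g z.2) ^ 2 + (1 + 1 / η) *
          ((f z.1 - g z.1) - (f z.2 - g z.2)) ^ 2) * cdKernel (Measure.pi ν) N z.1 z.2 ^ 2 := by
          gcongr
      _ = _ := by ring
  rw [integral_sub If Ig, integral_add (Ig.const_mul _) (Ifg.const_mul _), integral_const_mul,
    integral_const_mul, integral_sq_sub_mul_cdKernel hd hν N hf,
    integral_sq_sub_mul_cdKernel hd hν N hg, integral_sq_sub_mul_cdKernel hd hν N hfg,
    ← mul_sub, abs_mul, abs_two] at h1
  linarith

end DirichletForm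

/-! ### Passage to the limit -/

section Limit

variable {d : ℕ} {ν : Fin d → Measure ℝ} [∀ j, IsFiniteMeasure (ν j)]

/-- There is `C` such that a function with Lipschitz constant `L` on the cube has variance at most
`C L² N^(1-1/d)`. -/
theorem exists_ensembleVar_le (hd : 0 < d) (hν : ∀ j, IsNevaiClass (ν j)) :
    ∃ C : ℝ, 0 ≤ C ∧ ∀ᶠ N : ℕ in atTop, ∀ (g : (Fin d → ℝ) → ℝ) (L : ℝ), Continuous g →
      (∀ x ∈ Set.Icc (-1 : Fin d → ℝ) 1, ∀ y ∈ Set.Icc (-1 : Fin d → ℝ) 1,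
        |g x - g y| ≤ L * ∑ j, |x j - y j|) →
      ensembleVar (Measure.pi ν) N g / (N : ℝ) ^ (1 - 1 / (d : ℝ)) ≤ C * L ^ 2 := by
  have h1 : ∀ j : Fin d, ∃ l : ℝ, Tendsto (fun N : ℕ => ensembleVar (Measure.pi ν) N
      (fun x => x j) / (N : ℝ) ^ (1 - 1 / (d : ℝ))) atTop (𝓝 l) := by
    intro j
    obtain ⟨c, hc⟩ := exists_chebSum_coord j
    rw [← hc]
    exact ⟨_, tendsto_ensembleVar_chebSum hd hν 1 c⟩
  choose l hl using h1
  have h2 := (tendsto_finsetSum Finset.univ fun j _ => hl j).const_mul (d : ℝ)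
  refine ⟨|d * ∑ j, l j| + 1, by positivity, ?_⟩
  have h3 : d * ∑ j, l j < |d * ∑ j, l j| + 1 := (le_abs_self _).trans_lt (lt_add_one _)
  filter_upwards [h2.eventually (gt_mem_nhds h3)] with N hN g L hg hL
  have h4 := ensembleVar_le_of_lipschitz hd hν N hg hL
  have h5 : (0 : ℝ) ≤ (N : ℝ) ^ (1 - 1 / (d : ℝ)) := by positivity
  calc _ ≤ L ^ 2 * (d * ∑ j, ensembleVar (Measure.pi ν) N (fun x => x j)) /
        (N : ℝ) ^ (1 - 1 / (d : ℝ)) := by gcongr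
    _ = L ^ 2 * (d * ∑ j, ensembleVar (Measure.pi ν) N (fun x => x j) /
        (N : ℝ) ^ (1 - 1 / (d : ℝ))) := by
        rw [← Finset.sum_div]
        ring
    _ ≤ L ^ 2 * (|d * ∑ j, l j| + 1) := by gcongr
    _ = _ := mul_comm _ _

/-- The bound on the variance passes to the limit: partial sums of the limiting variance of
`f - p` are controlled by its Lipschitz constant. -/
theorem partialVar_sub_le {f : (Fin d → ℝ) → ℝ} (hd : 0 < d) (hν : ∀ j, IsNevaiClass (ν j))
    (hfc : Continuous f)
    (hf : ContDiffOn ℝ 1 f (Set.Icc (-1 : Fin d → ℝ) 1)) {C : ℝ}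
    (hC : ∀ᶠ N : ℕ in atTop, ∀ (g : (Fin d → ℝ) → ℝ) (L : ℝ), Continuous g →
      (∀ x ∈ Set.Icc (-1 : Fin d → ℝ) 1, ∀ y ∈ Set.Icc (-1 : Fin d → ℝ) 1,
        |g x - g y| ≤ L * ∑ j, |x j - y j|) →
      ensembleVar (Measure.pi ν) N g / (N : ℝ) ^ (1 - 1 / (d : ℝ)) ≤ C * L ^ 2)
    {ε : ℝ} {D : ℕ} {c : (Fin d → ℕ) → ℝ}
    (hp : ∀ x ∈ Set.Icc (-1 : Fin d → ℝ) 1, ∀ y ∈ Set.Icc (-1 : Fin d → ℝ) 1,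
        |(f x - chebSum D c x) - (f y - chebSum D c y)| ≤ ε * ∑ j, |x j - y j|)
    (F : Finset (Fin d → ℕ)) : partialVar F (fun x => f x - chebSum D c x) ≤ C * ε ^ 2 := by
  -- Approximate `f` by polynomials `q n`, for which the bound follows from the polynomial case.
  have hex : ∀ n : ℕ, ∃ (D : ℕ) (c : (Fin d → ℕ) → ℝ), chebSum D c (-1) = f (-1) ∧
      ∀ x ∈ Set.Icc (-1 : Fin d → ℝ) 1, ∀ y ∈ Set.Icc (-1 : Fin d → ℝ) 1,
        |(f x - chebSum D c x) - (f y - chebSum D c y)| ≤ 1 / ((n : ℝ) + 1) * ∑ j, |x j - y j| :=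
    fun n => exists_chebSum_approx hf (by positivity)
  choose E e he1 he2 using hex
  have hlim0 : Tendsto (fun n : ℕ => 1 / ((n : ℝ) + 1)) atTop (𝓝 0) :=
    tendsto_one_div_add_atTop_nhds_zero_nat
  have hq : ∀ n, partialVar F (fun x => chebSum (E n) (e n) x - chebSum D c x) ≤
      C * (1 / ((n : ℝ) + 1) + ε) ^ 2 := by
    intro n
    obtain ⟨c', hc'⟩ := chebSum_sub (E n) D (e n) c
    have hfun : (fun x => chebSum (E n) (e n) x - chebSum D c x) = chebSum (E n + D) c' :=
      funext hc'
    rw [hfun]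
    refine (partialVar_chebSum_le F _ _).trans ?_
    refine le_of_tendsto (tendsto_ensembleVar_chebSum hd hν (E n + D) c') ?_
    filter_upwards [hC] with N hN
    refine hN _ _ (continuous_chebSum _ _) fun x hx y hy => ?_
    rw [← hc', ← hc']
    have h1 := he2 n x hx y hy
    have h2 := hp x hx y hy
    rw [add_mul]
    have h3 : chebSum (E n) (e n) x - chebSum D c x - (chebSum (E n) (e n) y - chebSum D c y) =
        ((f x - chebSum D c x) - (f y - chebSum D c y)) -
        ((f x - chebSum (E n) (e n) x) - (f y - chebSum (E n) (e n) y)) := by ring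
    rw [h3]
    exact (abs_sub _ _).trans (by linarith)
  have hcoef : ∀ m, Tendsto (fun n => chebCoeff (fun x => chebSum (E n) (e n) x - chebSum D c x) m)
      atTop (𝓝 (chebCoeff (fun x => f x - chebSum D c x) m)) := by
    intro m
    rw [chebCoeff_sub hfc (continuous_chebSum _ _)]
    simp_rw [fun n => chebCoeff_sub (continuous_chebSum (E n) (e n)) (continuous_chebSum D c) m]
    refine Tendsto.sub_const ?_ _
    rw [tendsto_iff_dist_tendsto_zero]
    have hb : ∀ n, dist (chebCoeff (chebSum (E n) (e n)) m) (chebCoeff f m) ≤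
        (1 / ((n : ℝ) + 1) * (2 * d)) *
          ∫ x in Set.Icc (-1 : Fin d → ℝ) 1, |chebDensity m x| := by
      intro n
      rw [dist_comm, Real.dist_eq, ← chebCoeff_sub hfc (continuous_chebSum _ _)]
      refine abs_chebCoeff_le (hfc.sub (continuous_chebSum _ _)) (fun x hx => ?_) m
      have hm1 : (-1 : Fin d → ℝ) ∈ Set.Icc (-1 : Fin d → ℝ) 1 :=
        ⟨le_rfl, fun j => by simp⟩
      have h1 := he2 n x hx (-1) hm1
      rw [he1, sub_self, sub_zero] at h1
      refine h1.trans ?_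
      gcongr
      calc ∑ j, |x j - (-1 : Fin d → ℝ) j| ≤ ∑ _j : Fin d, (2 : ℝ) := by
            refine Finset.sum_le_sum fun j _ => ?_
            have h2 := hx.1 j
            have h3 := hx.2 j
            simp only [Pi.neg_apply, Pi.one_apply] at h2 h3 ⊢
            rw [abs_le]
            constructor <;> linarith
        _ = 2 * d := by simp [mul_comm]
    refine squeeze_zero (fun _ => dist_nonneg) hb ?_
    simpa using (hlim0.mul_const (2 * (d : ℝ))).mul_const
      (∫ x in Set.Icc (-1 : Fin d → ℝ) 1, |chebDensity m x|)
  have hlim : Tendsto (fun n => partialVar F (fun x => chebSum (E n) (e n) x - chebSum D c x))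
      atTop (𝓝 (partialVar F (fun x => f x - chebSum D c x))) := by
    simp only [partialVar]
    exact (tendsto_finsetSum _ fun m _ => ((hcoef m).pow 2).const_mul _).const_mul _
  have hlim2 : Tendsto (fun n : ℕ => C * (1 / ((n : ℝ) + 1) + ε) ^ 2) atTop
      (𝓝 (C * (0 + ε) ^ 2)) := ((hlim0.add_const ε).pow 2).const_mul C
  rw [zero_add] at hlim2
  exact le_of_tendsto_of_tendsto' hlim hlim2 hq

/-- The limit theorem for the functional `ensembleVar`. -/
theorem tendsto_ensembleVar (hd : 0 < d) (hν : ∀ j, IsNevaiClass (ν j))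
    {f : (Fin d → ℝ) → ℝ} (hfc : Continuous f)
    (hf : ContDiffOn ℝ 1 f (Set.Icc (-1 : Fin d → ℝ) 1)) :
    Summable (fun k : Fin d → ℕ => (∑ j, (k j : ℝ)) * chebCoeff f k ^ 2) ∧
    Tendsto (fun N : ℕ => ensembleVar (Measure.pi ν) N f / (N : ℝ) ^ (1 - 1 / (d : ℝ))) atTop
      (𝓝 (limitVariance f)) := by
  obtain ⟨C, hC0, hC⟩ := exists_ensembleVar_le hd hν
  have hterm0 : ∀ k : Fin d → ℕ, 0 ≤ (∑ j, (k j : ℝ)) * chebCoeff f k ^ 2 := fun k => by positivity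
  -- Comparison of partial sums of `f` and of an approximating polynomial.
  have hcmp : ∀ (ε η : ℝ) (D : ℕ) (c : (Fin d → ℕ) → ℝ), 0 < η →
      (∀ x ∈ Set.Icc (-1 : Fin d → ℝ) 1, ∀ y ∈ Set.Icc (-1 : Fin d → ℝ) 1,
        |(f x - chebSum D c x) - (f y - chebSum D c y)| ≤ ε * ∑ j, |x j - y j|) →
      ∀ F, |partialVar F f - partialVar F (chebSum D c)| ≤
        η * (1 / 2 * ∑ m ∈ indexBox d (D + 1), (∑ j, (m j : ℝ)) * c m ^ 2) +
          (1 + 1 / η) * (C * ε ^ 2) := by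
    intro ε η D c hη hp F
    refine (abs_partialVar_sub_le hfc (continuous_chebSum D c) hη F).trans ?_
    have h1 := partialVar_sub_le hd hν hfc hf hC hp F
    have h2 := partialVar_chebSum_le F D c
    gcongr
  have hsum : Summable (fun k : Fin d → ℕ => (∑ j, (k j : ℝ)) * chebCoeff f k ^ 2) := by
    obtain ⟨D, c, -, hp⟩ := exists_chebSum_approx hf one_pos
    refine summable_of_sum_le hterm0 (c := 2 * ((1 / 2 * ∑ m ∈ indexBox d (D + 1),
      (∑ j, (m j : ℝ)) * c m ^ 2) + (1 * (1 / 2 * ∑ m ∈ indexBox d (D + 1),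
      (∑ j, (m j : ℝ)) * c m ^ 2) + (1 + 1 / 1) * (C * 1 ^ 2)))) fun F => ?_
    have h1 := (abs_le.1 (hcmp 1 1 D c one_pos hp F)).2
    have h2 := partialVar_chebSum_le F D c
    have h3 : ∑ k ∈ F, (∑ j, (k j : ℝ)) * chebCoeff f k ^ 2 = 2 * partialVar F f := by
      rw [partialVar]
      ring
    rw [h3]
    linarith
  refine ⟨hsum, ?_⟩
  have hpv : Tendsto (fun F => partialVar F f) atTop (𝓝 (limitVariance f)) :=
    hsum.hasSum.const_mul (1 / 2)
  have hcmp' : ∀ (ε η : ℝ) (D : ℕ) (c : (Fin d → ℕ) → ℝ), 0 < η →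
      (∀ x ∈ Set.Icc (-1 : Fin d → ℝ) 1, ∀ y ∈ Set.Icc (-1 : Fin d → ℝ) 1,
        |(f x - chebSum D c x) - (f y - chebSum D c y)| ≤ ε * ∑ j, |x j - y j|) →
      |limitVariance f - 1 / 2 * ∑ m ∈ indexBox d (D + 1), (∑ j, (m j : ℝ)) * c m ^ 2| ≤
        η * (1 / 2 * ∑ m ∈ indexBox d (D + 1), (∑ j, (m j : ℝ)) * c m ^ 2) +
          (1 + 1 / η) * (C * ε ^ 2) := by
    intro ε η D c hη hp
    refine le_of_tendsto (hpv.sub_const _).abs ?_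
    filter_upwards [eventually_ge_atTop (indexBox d (D + 1))] with F hF
    rw [← partialVar_chebSum_eq hF c]
    have := hcmp ε η D c hη hp F
    rwa [← partialVar_chebSum_eq hF c] at this
  have hV0 : 0 ≤ limitVariance f := by
    rw [limitVariance]
    have : 0 ≤ ∑' k : Fin d → ℕ, (∑ j, (k j : ℝ)) * chebCoeff f k ^ 2 := tsum_nonneg hterm0
    positivity
  rw [Metric.tendsto_nhds]
  intro τ hτ
  -- `B` bounds the limiting variance of all approximating polynomials that will be used.
  set B : ℝ := 2 * (limitVariance f + 3 * C) with hB
  have hB0 : 0 ≤ B := by positivity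
  set η : ℝ := τ / (8 * (B + 1)) with hηdef
  have hη : 0 < η := by positivity
  obtain ⟨ε, hε0, hε1, hε2⟩ : ∃ ε : ℝ, 0 < ε ∧ ε ≤ 1 ∧ (1 + 1 / η) * (C * ε ^ 2) < τ / 8 := by
    have hlim : Tendsto (fun ε : ℝ => (1 + 1 / η) * (C * ε ^ 2)) (𝓝[>] 0) (𝓝 0) := by
      have : Continuous fun ε : ℝ => (1 + 1 / η) * (C * ε ^ 2) := by fun_prop
      have h := this.tendsto 0
      simp only [ne_eq, OfNat.ofNat_ne_zero, not_false_eq_true, zero_pow, mul_zero] at h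
      exact h.mono_left nhdsWithin_le_nhds
    have h1 := hlim.eventually (gt_mem_nhds (show 0 < τ / 8 by positivity))
    have h2 : ∀ᶠ ε : ℝ in 𝓝[>] 0, ε ∈ Set.Ioc (0 : ℝ) 1 := Ioc_mem_nhdsGT one_pos
    obtain ⟨ε, h3, h4⟩ := (h1.and h2).exists
    exact ⟨ε, h4.1, h4.2, h3⟩
  obtain ⟨D, c, -, hp⟩ := exists_chebSum_approx hf hε0
  set S : ℝ := 1 / 2 * ∑ m ∈ indexBox d (D + 1), (∑ j, (m j : ℝ)) * c m ^ 2 with hS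
  have hS0 : 0 ≤ S := by positivity
  have hSB : S ≤ B := by
    have h1 := (abs_le.1 (hcmp' ε (1 / 2) D c (by norm_num) hp)).1
    rw [← hS] at h1
    have h2 : C * ε ^ 2 ≤ C * 1 := by
      gcongr
      exact pow_le_one₀ hε0.le hε1
    norm_num at h1
    linarith
  have h1 := hcmp' ε η D c hη hp
  rw [← hS] at h1
  have hηB : η * (B + 1) = τ / 8 := by
    rw [hηdef]
    field_simp
  have hlim := tendsto_ensembleVar_chebSum hd hν D c
  rw [← hS] at hlim
  have hev1 := (Metric.tendsto_nhds.1 hlim) (min 1 (τ / 8)) (by positivity)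
  filter_upwards [hev1, hC] with N hN1 hN2
  set r : ℝ := (N : ℝ) ^ (1 - 1 / (d : ℝ)) with hr
  have hr0 : 0 ≤ r := by positivity
  have h2 := hN2 (fun x => f x - chebSum D c x) ε (hfc.sub (continuous_chebSum D c)) hp
  have h3 := abs_ensembleVar_sub_le hd hν N hfc (continuous_chebSum D c) hη
  set vf := ensembleVar (Measure.pi ν) N f / r with hvf
  set vp := ensembleVar (Measure.pi ν) N (chebSum D c) / r with hvp
  have h4 : |vf - vp| ≤ η * vp + (1 + 1 / η) * (C * ε ^ 2) := by
    have h5 : |vf - vp| = |ensembleVar (Measure.pi ν) N f -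
        ensembleVar (Measure.pi ν) N (chebSum D c)| / r := by
      rw [hvf, hvp, ← sub_div, abs_div, abs_of_nonneg hr0]
    rw [h5]
    calc _ ≤ (η * ensembleVar (Measure.pi ν) N (chebSum D c) + (1 + 1 / η) *
          ensembleVar (Measure.pi ν) N (fun x => f x - chebSum D c x)) / r := by gcongr
      _ = η * vp + (1 + 1 / η) *
          (ensembleVar (Measure.pi ν) N (fun x => f x - chebSum D c x) / r) := by
          rw [hvp]
          ring
      _ ≤ _ := by gcongr
  rw [Real.dist_eq] at hN1 ⊢
  have h6 : |vp - S| < 1 := hN1.trans_le (min_le_left _ _)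
  have h7 : |vp - S| < τ / 8 := hN1.trans_le (min_le_right _ _)
  have h8 : η * vp ≤ η * (B + 1) := by
    have := (abs_lt.1 h6).2
    gcongr
    linarith
  have h9 : η * S ≤ η * (B + 1) := by
    gcongr
    linarith
  rw [abs_sub_comm] at h1
  calc |vf - limitVariance f| = |(vf - vp) + (vp - S) + (S - limitVariance f)| := by
        congr 1
        ring
    _ ≤ |vf - vp| + |vp - S| + |S - limitVariance f| := abs_add_three _ _ _
    _ < τ := by linarith

end Limit

/-! ### Linear statistics of functions defined on the cube -/

/-- The coordinatewise projection onto the cube `[-1, 1]^d`. -/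
noncomputable def clampCube {d : ℕ} (x : Fin d → ℝ) : Fin d → ℝ := fun j => max (-1) (min 1 (x j))

theorem clampCube_mem {d : ℕ} (x : Fin d → ℝ) : clampCube x ∈ Set.Icc (-1 : Fin d → ℝ) 1 :=
  ⟨fun _ => le_max_left _ _, fun _ => max_le (by norm_num) (min_le_left _ _)⟩

theorem clampCube_of_mem {d : ℕ} {x : Fin d → ℝ} (hx : x ∈ Set.Icc (-1 : Fin d → ℝ) 1) :
    clampCube x = x := by
  funext j
  have h1 := hx.1 j
  have h2 := hx.2 j
  simp only [Pi.neg_apply, Pi.one_apply] at h1 h2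
  simp [clampCube, h1, h2]

theorem continuous_clampCube {d : ℕ} : Continuous (clampCube (d := d)) := by
  unfold clampCube
  fun_prop

theorem mainTheorem4 (d : ℕ) (hd : 1 ≤ d)
    (ν : Fin d → Measure ℝ) [∀ j, IsFiniteMeasure (ν j)] (hν : ∀ j, IsNevaiClass (ν j))
    {Ω : ℕ → Type*} [∀ N, MeasurableSpace (Ω N)] (P : ∀ N, Measure (Ω N))
    (X : ∀ N, Fin N → Ω N → (Fin d → ℝ))
    (hX : ∀ N, HasLaw (fun ω i => X N i ω) (opEnsemble (Measure.pi ν) N) (P N))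
    (f : (Fin d → ℝ) → ℝ) (hf : ContDiffOn ℝ 1 f (Set.Icc (-1) 1)) :
    Summable (fun k : Fin d → ℕ => (∑ j, (k j : ℝ)) * chebCoeff f k ^ 2) ∧
    Tendsto
      (fun N : ℕ => 1 / (N : ℝ) ^ (1 - 1 / (d : ℝ)) * variance (fun ω => ∑ i, f (X N i ω)) (P N))
      atTop (𝓝 (limitVariance f)) := by
  -- The values of `f` outside the cube are arbitrary: replace `f` by a continuous extension.
  set g : (Fin d → ℝ) → ℝ := fun x => f (clampCube x) with hg
  have hgf : ∀ x ∈ Set.Icc (-1 : Fin d → ℝ) 1, g x = f x := fun x hx => by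
    simp only [hg, clampCube_of_mem hx]
  have hgc : Continuous g :=
    hf.continuousOn.comp_continuous continuous_clampCube clampCube_mem
  have hgd : ContDiffOn ℝ 1 g (Set.Icc (-1 : Fin d → ℝ) 1) := hf.congr hgf
  have hcoef : ∀ k, chebCoeff f k = chebCoeff g k := fun k =>
    setIntegral_congr_fun measurableSet_Icc fun x hx => by simp only [hgf x hx]
  have hlim : limitVariance f = limitVariance g := by
    simp only [limitVariance, hcoef]
  obtain ⟨h1, h2⟩ := tendsto_ensembleVar hd hν hgc hgd
  refine ⟨by simpa only [hcoef] using h1, ?_⟩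
  rw [hlim]
  refine h2.congr fun N => ?_
  have hae : ∀ᵐ x ∂((P N).map fun ω i => X N i ω), ∀ i, x i ∈ Set.Icc (-1 : Fin d → ℝ) 1 := by
    rw [(hX N).map_eq, ae_iff]
    convert opEnsemble_compl_null (pi_cube_compl_null hν) N using 2
    ext x
    simp only [Set.mem_compl_iff, Set.mem_univ_pi, Set.mem_ofPred_eq]
  have hae' : (fun ω => ∑ i, f (X N i ω)) =ᵐ[P N]
      (fun x : Fin N → Fin d → ℝ => ∑ i, g (x i)) ∘ fun ω i => X N i ω := by
    filter_upwards [ae_of_ae_map (hX N).aemeasurable hae] with ω hω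
    exact Finset.sum_congr rfl fun i _ => (hgf _ (hω i)).symm
  have hc : Continuous fun x : Fin N → Fin d → ℝ => ∑ i, g (x i) := by fun_prop
  rw [variance_congr hae', ← variance_map hc.aemeasurable (hX N).aemeasurable, (hX N).map_eq,
    variance_opEnsemble isCompact_Icc (pi_cube_compl_null hν)
      (continuous_multiOrthoPoly_pi hd hν) (multiOrthoPoly_pi_orthonormal hd hν) N hgc]
  ring
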